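/- Let $q\ge 0$ and let $H_q=-\tfrac12\frac{d^2}{dx^2}+q\delta(x)$ be the operator in $L^2(\mathbb R)=L^2(\mathbb R;\mathbb C)$ with $$D(H_q)=\{u\in H^1(\mathbb R)\cap H^2(\mathbb R\setminus\{0\}):\ u'(0+)-u'(0-)=2q\,u(0)\},\qquad H_qu=-\tfrac12u''\ \text{ on }\mathbb R\setminus\{0\}.$$ Then $H_q$ generates exactly one strongly continuous one-parameter unitary group $\{e^{-itH_q}\}_{t\in\mathbb R}$ on $L^2(\mathbb R)$ (one whose infinitesimal generator is $-iH_q$), and it has the following representation. Let $1_+$ and $1_-$ be the characteristic functions of $[0,\infty)$ and $(-\infty,0)$, and put $$\mathcal L_+[\phi](x)=\phi(x)-q1_-(x)e^{qx}\int_x^{-x}e^{q|y|}\phi(y)\,dy,\qquad \mathcal L_-[\phi](x)=\phi(x)-q1_+(x)e^{-qx}\int_{-x}^{x}e^{q|y|}\phi(y)\,dy .$$ For every $\phi\in L^2(\mathbb R)$ and every $t>0$, the functions $\mathcal L_\pm[\phi]$ belong to $L^2(\mathbb R)$ and, for almost every $x\in\mathbb R$, $$(e^{-itH_q}\phi)(x)=\begin{cases}\displaystyle\frac{e^{-i\pi/4}}{\sqrt{2\pi}}\,t^{-1/2}\int_{-\infty}^{\infty}e^{\frac{i(x-y)^2}{2t}}\mathcal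 L_+[\phi](y)\,dy&\text{if }x\ge0,\\[3mm]\displaystyle\frac{e^{-i\pi/4}}{\sqrt{2\pi}}\,t^{-1/2}\int_{-\infty}^{\infty}e^{\frac{i(x-y)^2}{2t}}\mathcal L_-[\phi](y)\,dy&\text{if }x<0.\end{cases}$$ Here $\int_{-\infty}^\infty$ denotes the limit in $L^2(\mathbb R,dx)$ of $\int_{-R}^{R}$ as $R\to\infty$, which exists. If moreover $\phi\in L^1(\mathbb R)$, then $\mathcal L_\pm[\phi]\in L^1(\mathbb R)$ and the formula also holds for almost every $x$ with absolutely convergent Lebesgue integrals. -/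

import Mathlib

open MeasureTheory Filter Set
open scoped Topology ContDiff ENNReal

noncomputable section

namespace DeltaSchrodinger

/-- The Hilbert space `L²(ℝ; ℂ)` (Lebesgue measure). -/
abbrev L2 : Type := Lp ℂ 2 (volume : Measure ℝ)

/-- `v` is the weak (distributional) derivative of `u` on the open set `Ω ⊆ ℝ`. -/
def IsWeakDerivOn (Ω : Set ℝ) (u v : L2) : Prop :=
  ∀ g : ℝ → ℝ, ContDiff ℝ ∞ g → HasCompactSupport g → tsupport g ⊆ Ω →
    ∫ x, deriv g x • u x = - ∫ x, g x • v x

/-- The continuous representative `f` of `u` is differentiable off the origin, its derivative has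
one-sided limits `f'(0+)` and `f'(0-)`, and `f'(0+) - f'(0-) = 2 q f(0)`. -/
def JumpCondition (q : ℝ) (u : L2) : Prop :=
  ∃ f : ℝ → ℂ, u =ᵐ[volume] f ∧ Continuous f ∧ (∀ x : ℝ, x ≠ 0 → DifferentiableAt ℝ f x) ∧
    ∃ a b : ℂ, Tendsto (deriv f) (𝓝[>] 0) (𝓝 a) ∧ Tendsto (deriv f) (𝓝[<] 0) (𝓝 b) ∧
      a - b = 2 * (q : ℂ) * f 0

/-- `w ∈ L²` is the second derivative on `ℝ \ {0}` of `u ∈ H¹(ℝ) ∩ H²(ℝ \ {0})`: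
`u` has a weak derivative `v ∈ L²` on `ℝ`, and `v` has the weak derivative `w` on `ℝ \ {0}`. -/
def HasSecondDeriv (u w : L2) : Prop :=
  ∃ v : L2, IsWeakDerivOn univ u v ∧ IsWeakDerivOn {0}ᶜ v w

lemma integrable_test_smul {g : ℝ → ℝ} (hg : Continuous g) (hc : HasCompactSupport g) (u : L2) :
    Integrable (fun x => g x • u x) :=
  ((Lp.memLp u).locallyIntegrable (by norm_num)).integrable_smul_left_of_hasCompactSupport hg hc

lemma IsWeakDerivOn.add {Ω : Set ℝ} {u v u' v' : L2} (h : IsWeakDerivOn Ω u v)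
    (h' : IsWeakDerivOn Ω u' v') : IsWeakDerivOn Ω (u + u') (v + v') := by
  intro g hg hc hs
  have hd : Continuous (deriv g) := hg.continuous_deriv (by simp)
  have e1 : ∫ x, deriv g x • (u + u') x = ∫ x, (deriv g x • u x + deriv g x • u' x) := by
    apply integral_congr_ae
    filter_upwards [Lp.coeFn_add u u'] with x hx
    rw [hx, Pi.add_apply, smul_add]
  have e2 : ∫ x, g x • (v + v') x = ∫ x, (g x • v x + g x • v' x) := by
    apply integral_congr_ae
    filter_upwards [Lp.coeFn_add v v'] with x hx
    rw [hx, Pi.add_apply, smul_add]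
  rw [e1, e2, integral_add (integrable_test_smul hd hc.deriv u)
    (integrable_test_smul hd hc.deriv u'), integral_add (integrable_test_smul hg.continuous hc v)
    (integrable_test_smul hg.continuous hc v'), h g hg hc hs, h' g hg hc hs, neg_add]

lemma IsWeakDerivOn.smul {Ω : Set ℝ} {u v : L2} (c : ℂ) (h : IsWeakDerivOn Ω u v) :
    IsWeakDerivOn Ω (c • u) (c • v) := by
  intro g hg hc hs
  have e1 : ∫ x, deriv g x • (c • u) x = ∫ x, c • (deriv g x • u x) := by
    apply integral_congr_ae
    filter_upwards [Lp.coeFn_smul c u] with x hx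
    rw [hx, Pi.smul_apply, smul_comm]
  have e2 : ∫ x, g x • (c • v) x = ∫ x, c • (g x • v x) := by
    apply integral_congr_ae
    filter_upwards [Lp.coeFn_smul c v] with x hx
    rw [hx, Pi.smul_apply, smul_comm]
  rw [e1, e2, integral_smul, integral_smul, h g hg hc hs, smul_neg]

lemma isWeakDerivOn_zero (Ω : Set ℝ) : IsWeakDerivOn Ω 0 0 := by
  intro g _ _ _
  have e1 : ∫ x, deriv g x • (0 : L2) x = 0 := by
    apply integral_eq_zero_of_ae
    filter_upwards with x
    simp
  have e2 : ∫ x, g x • (0 : L2) x = 0 := by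
    apply integral_eq_zero_of_ae
    filter_upwards with x
    simp
  rw [e1, e2, neg_zero]

lemma IsWeakDerivOn.unique {Ω : Set ℝ} (hΩ : IsOpen Ω) (hΩ' : ∀ᵐ x ∂(volume : Measure ℝ), x ∈ Ω)
    {u v v' : L2} (h : IsWeakDerivOn Ω u v) (h' : IsWeakDerivOn Ω u v') : v = v' := by
  have key := hΩ.ae_eq_zero_of_integral_contDiff_smul_eq_zero (μ := (volume : Measure ℝ))
    (f := fun x => v x - v' x)
    ((((Lp.memLp v).locallyIntegrable (by norm_num)).sub
      ((Lp.memLp v').locallyIntegrable (by norm_num))).locallyIntegrableOn Ω) ?_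
  · apply Lp.ext
    filter_upwards [key, hΩ'] with x hx hx'
    exact sub_eq_zero.mp (hx hx')
  · intro g hg hc hs
    simp only [smul_sub]
    rw [integral_sub (integrable_test_smul hg.continuous hc v)
      (integrable_test_smul hg.continuous hc v'), sub_eq_zero]
    exact neg_injective ((h g hg hc hs).symm.trans (h' g hg hc hs))

lemma HasSecondDeriv.unique {u w w' : L2} (h : HasSecondDeriv u w) (h' : HasSecondDeriv u w') :
    w = w' := by
  obtain ⟨v, h1, h2⟩ := h
  obtain ⟨v', h1', h2'⟩ := h'
  obtain rfl := h1.unique isOpen_univ (by simp) h1'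
  exact h2.unique isOpen_compl_singleton (by simp [ae_iff]) h2'

lemma HasSecondDeriv.add {u w u' w' : L2} (h : HasSecondDeriv u w) (h' : HasSecondDeriv u' w') :
    HasSecondDeriv (u + u') (w + w') := by
  obtain ⟨v, h1, h2⟩ := h
  obtain ⟨v', h1', h2'⟩ := h'
  exact ⟨v + v', h1.add h1', h2.add h2'⟩

lemma HasSecondDeriv.smul {u w : L2} (c : ℂ) (h : HasSecondDeriv u w) :
    HasSecondDeriv (c • u) (c • w) := by
  obtain ⟨v, h1, h2⟩ := h
  exact ⟨c • v, h1.smul c, h2.smul c⟩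

lemma JumpCondition.add {q : ℝ} {u u' : L2} (h : JumpCondition q u) (h' : JumpCondition q u') :
    JumpCondition q (u + u') := by
  obtain ⟨f, hf, hfc, hfd, a, b, ha, hb, hab⟩ := h
  obtain ⟨f', hf', hfc', hfd', a', b', ha', hb', hab'⟩ := h'
  have hd : ∀ x : ℝ, x ≠ 0 → deriv (f + f') x = deriv f x + deriv f' x := fun x hx =>
    deriv_add (hfd x hx) (hfd' x hx)
  refine ⟨f + f', (Lp.coeFn_add u u').trans (hf.add hf'), hfc.add hfc',
    fun x hx => (hfd x hx).add (hfd' x hx), a + a', b + b', ?_, ?_, ?_⟩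
  · refine (ha.add ha').congr' ?_
    filter_upwards [self_mem_nhdsWithin] with x hx using (hd x (ne_of_gt hx)).symm
  · refine (hb.add hb').congr' ?_
    filter_upwards [self_mem_nhdsWithin] with x hx using (hd x (ne_of_lt hx)).symm
  · rw [Pi.add_apply]
    linear_combination hab + hab'

lemma JumpCondition.smul {q : ℝ} {u : L2} (c : ℂ) (h : JumpCondition q u) :
    JumpCondition q (c • u) := by
  obtain ⟨f, hf, hfc, hfd, a, b, ha, hb, hab⟩ := h
  have hd : ∀ x : ℝ, x ≠ 0 → deriv (c • f) x = c • deriv f x := fun x hx =>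
    deriv_const_smul c (hfd x hx)
  refine ⟨c • f, (Lp.coeFn_smul c u).trans (hf.const_smul c), hfc.const_smul c,
    fun x hx => (hfd x hx).const_smul c, c • a, c • b, ?_, ?_, ?_⟩
  · refine (ha.const_smul c).congr' ?_
    filter_upwards [self_mem_nhdsWithin] with x hx using (hd x (ne_of_gt hx)).symm
  · refine (hb.const_smul c).congr' ?_
    filter_upwards [self_mem_nhdsWithin] with x hx using (hd x (ne_of_lt hx)).symm
  · simp only [Pi.smul_apply, smul_eq_mul]
    linear_combination c * hab

lemma jumpCondition_zero (q : ℝ) : JumpCondition q 0 := by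
  refine ⟨0, Lp.coeFn_zero ℂ 2 _, continuous_zero, fun x _ => differentiableAt_const 0, 0, 0,
    ?_, ?_, by simp⟩
  all_goals
    have : deriv (0 : ℝ → ℂ) = fun _ => 0 := by
      funext x
      exact deriv_const x (0 : ℂ)
    rw [this]
    exact tendsto_const_nhds

/-- `D(H_q) = {u ∈ H¹(ℝ) ∩ H²(ℝ \ {0}) : u'(0+) - u'(0-) = 2 q u(0)}`. -/
def deltaDomain (q : ℝ) : Submodule ℂ L2 where
  carrier := {u | (∃ w, HasSecondDeriv u w) ∧ JumpCondition q u}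
  zero_mem' := ⟨⟨0, 0, isWeakDerivOn_zero _, isWeakDerivOn_zero _⟩, jumpCondition_zero q⟩
  add_mem' := by
    rintro u u' ⟨⟨w, hw⟩, hj⟩ ⟨⟨w', hw'⟩, hj'⟩
    exact ⟨⟨w + w', hw.add hw'⟩, hj.add hj'⟩
  smul_mem' := by
    rintro c u ⟨⟨w, hw⟩, hj⟩
    exact ⟨⟨c • w, hw.smul c⟩, hj.smul c⟩

/-- The second derivative of `u ∈ D(H_q)` on `ℝ \ {0}`, as an element of `L²`
(it exists by the definition of the domain, and is unique). -/
def secondDeriv {q : ℝ} (u : deltaDomain q) : L2 := u.2.1.choose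

lemma hasSecondDeriv_secondDeriv {q : ℝ} (u : deltaDomain q) :
    HasSecondDeriv (u : L2) (secondDeriv u) := u.2.1.choose_spec

/-- The Hamiltonian `H_q = -(1/2) d²/dx² + q δ` as an unbounded operator in `L²(ℝ)`:
`H_q u = -(1/2) u''` (derivative taken on `ℝ \ {0}`) for `u ∈ D(H_q)`. -/
def deltaHamiltonian (q : ℝ) : L2 →ₗ.[ℂ] L2 where
  domain := deltaDomain q
  toFun :=
    { toFun := fun u => (-(1 / 2) : ℂ) • secondDeriv u
      map_add' := fun u u' => by
        rw [← smul_add]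
        congr 1
        exact (hasSecondDeriv_secondDeriv (u + u')).unique
          ((hasSecondDeriv_secondDeriv u).add (hasSecondDeriv_secondDeriv u'))
      map_smul' := fun c u => by
        rw [RingHom.id_apply, smul_comm]
        congr 1
        exact (hasSecondDeriv_secondDeriv (c • u)).unique
          ((hasSecondDeriv_secondDeriv u).smul c) }

/-- `U` is the unitary group `{e^{-itA}}_{t ∈ ℝ}`: a strongly continuous one-parameter group of
unitary operators whose infinitesimal generator is exactly `-iA`, i.e. `t ↦ U(t)ψ` has the
derivative `η` at `t = 0` if and only if `ψ ∈ D(A)` and `η = -i A ψ`. -/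
structure IsUnitaryGroupOf {E : Type*} [NormedAddCommGroup E] [InnerProductSpace ℂ E]
    [CompleteSpace E] (A : E →ₗ.[ℂ] E) (U : ℝ → E →L[ℂ] E) : Prop where
  mem_unitary : ∀ t, U t ∈ unitary (E →L[ℂ] E)
  map_zero : U 0 = 1
  map_add : ∀ s t, U (s + t) = U s * U t
  continuous : ∀ ψ, Continuous fun t => U t ψ
  generator : ∀ ψ η : E, HasDerivAt (fun t => U t ψ) η 0 ↔
    ∃ h : ψ ∈ A.domain, η = (-Complex.I) • A ⟨ψ, h⟩

/-- `L₊[φ](x) = φ(x) - q 1_{x<0} e^{qx} ∫_x^{-x} e^{q|y|} φ(y) dy`. -/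
def LPlus (q : ℝ) (φ : ℝ → ℂ) (x : ℝ) : ℂ :=
  φ x - (q : ℂ) * (Iio (0 : ℝ)).indicator 1 x * (Real.exp (q * x) : ℂ) *
    ∫ y in x..(-x), (Real.exp (q * |y|) : ℂ) * φ y

/-- `L₋[φ](x) = φ(x) - q 1_{x≥0} e^{-qx} ∫_{-x}^x e^{q|y|} φ(y) dy`. -/
def LMinus (q : ℝ) (φ : ℝ → ℂ) (x : ℝ) : ℂ :=
  φ x - (q : ℂ) * (Ici (0 : ℝ)).indicator 1 x * (Real.exp (-(q * x)) : ℂ) *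
    ∫ y in (-x)..x, (Real.exp (q * |y|) : ℂ) * φ y

/-- The free Schrödinger kernel `(e^{-iπ/4} / √(2π)) t^{-1/2} e^{i z² / (2t)}`, for `t > 0`. -/
def freeKernel (t z : ℝ) : ℂ :=
  Complex.exp (-(Complex.I * Real.pi / 4)) / (Real.sqrt (2 * Real.pi) : ℂ) *
    ((t ^ (-(1 / 2) : ℝ) : ℝ) : ℂ) * Complex.exp (Complex.I * (z : ℂ) ^ 2 / (2 * t))

/-- `G(x) = ∫_{-∞}^∞ freeKernel t (x - y) g(y) dy` as an element of `L²`, for `g ∈ L²`. As for the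
Fourier integral of an `L²` function, the integral is the limit in `L²(dx)`, as `R → ∞`, of the
absolutely convergent integrals over `[-R, R]`. -/
def IsFreeKernelIntegral (t : ℝ) (g : ℝ → ℂ) (G : L2) : Prop :=
  Tendsto (fun R : ℝ =>
      eLpNorm (fun x => (∫ y in Icc (-R) R, freeKernel t (x - y) * g y) - G x) 2 volume)
    atTop (𝓝 0)

end DeltaSchrodinger

end

noncomputable section

namespace DeltaSchrodinger

open scoped FourierTransform SchwartzMap ComplexConjugate

/-! ### Multiplication operators on `L²(ℝ)` -/

/-! Split `φ` into odd and even parts. Odd functions in the domain vanish at the origin and do not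
feel the delta, so on them the group is free. For even functions the jump condition is the Robin
condition `u'(0+) = q u(0)` on the half-line, and a generalised method of images applies: the
half-line function is extended to a function `g` on the line for which `g' - q g` is odd. On the
Fourier side this reads `ĝ(-ξ) = s(ξ) ĝ(ξ)` with `s(ξ) = (2πiξ - q) / (2πiξ + q)`, that is, `K g =
g` for `K = J R`, where `J` is the reflection and `R` the multiplier with symbol `s`. Since `s(-ξ)
s(ξ) = 1` and `conj s(ξ) = s(-ξ)`, `K` is a self-adjoint involution. It commutes with every even
Fourier multiplier, in particular with the free group, which therefore preserves its fixed space.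

Let `P` be the projection onto the half-line. As `R` is the identity minus a causal convolution, `P
K P = 0`, so `(1 + K) P` extends half-line data without altering them. The block `(1 - P) K (1 - P)`
has rank at most one and is minus a projection, whence `(1 + K) P (1 + K) = 1 + K` (`one_add_K_P`):
a vector fixed by `K` is the extension of its restriction. From these relations alone, sending `X`
commuting with `J` and `K` to "extend, apply `X`, restrict and reflect evenly, plus `X` on the odd
part" (`compress`) is unital, multiplicative and `*`-preserving. Its value on the free group is thus
a unitary group, and restricting it to each half-line gives the free group applied to `L₊[φ]` or
`L₋[φ]` (`deltaGroup_coeFn`).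

The generator is identified by two inclusions. The intertwining relations (`ext_compress`,
`odd_compress`) put the extension and the odd part of a differentiable vector in `H²(ℝ)`, where
oddness of `g' - q g` yields the jump condition (`mem_domain_of_invol_eq`). Conversely, the
compressed free resolvent at `-1/2` maps into the domain of the generator, and `H_q + 1/2` is
injective because decaying solutions of `u'' = u` cannot satisfy the jump condition when `q ≥ 0`
(`eq_zero_of_hasSecondDeriv_self`).

Uniqueness of the group is the usual energy argument (`IsUnitaryGroupOf.eq`). The free kernel is the
limit `ε → 0` of the Gaussians with transform `exp(-2π²(ε + it)ξ²)` (`freeGroup_eq_integral`). -/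

lemma norm_sq_eq_integral (f : L2) : ‖f‖ ^ 2 = ∫ x, ‖f x‖ ^ 2 := by
  have h : inner ℂ f f = ((∫ x, ‖f x‖ ^ 2 : ℝ) : ℂ) := by
    rw [L2.inner_def, ← integral_complex_ofReal]
    congr 1
    funext x
    rw [inner_self_eq_norm_sq_to_K]
    simp
  have h2 := inner_self_eq_norm_sq (𝕜 := ℂ) f
  rw [h] at h2
  exact h2.symm

lemma integrable_norm_sq (f : L2) : Integrable (fun x => ‖f x‖ ^ 2) :=
  (Lp.memLp f).integrable_norm_pow (by norm_num)

/-- Dominated convergence in `L²`. -/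
lemma tendsto_of_dominated {ι : Type*} {l : Filter ι} [l.IsCountablyGenerated] {F : ι → L2}
    {f : L2} (G : L2) (C : ℝ) (hb : ∀ᶠ i in l, ∀ᵐ x, ‖F i x‖ ≤ C * ‖G x‖)
    (hb' : ∀ᵐ x, ‖f x‖ ≤ C * ‖G x‖)
    (hl : ∀ᵐ x, Tendsto (fun i => F i x) l (𝓝 (f x))) : Tendsto F l (𝓝 f) := by
  rw [tendsto_iff_norm_sub_tendsto_zero]
  have key : Tendsto (fun i => ‖F i - f‖ ^ 2) l (𝓝 0) := by
    have : Tendsto (fun i => ∫ x, ‖F i x - f x‖ ^ 2) l (𝓝 (∫ _ : ℝ, (0 : ℝ))) := by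
      refine tendsto_integral_filter_of_dominated_convergence
        (fun x => (2 * C) ^ 2 * ‖G x‖ ^ 2) ?_ ?_ ((integrable_norm_sq G).const_mul _) ?_
      · refine Eventually.of_forall fun i => ?_
        exact (((Lp.aestronglyMeasurable (F i)).sub (Lp.aestronglyMeasurable f)).norm.pow 2)
      · filter_upwards [hb] with i hi
        filter_upwards [hi, hb'] with x h1 h2
        rw [Real.norm_of_nonneg (by positivity), ← mul_pow]
        refine pow_le_pow_left₀ (norm_nonneg _) ?_ 2
        calc _ ≤ ‖F i x‖ + ‖f x‖ := norm_sub_le _ _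
          _ ≤ _ := by linarith
      · filter_upwards [hl] with x hx
        have := ((hx.sub_const (f x)).norm).pow 2
        simpa using this
    rw [integral_zero] at this
    refine this.congr fun i => ?_
    rw [norm_sq_eq_integral]
    refine integral_congr_ae ?_
    filter_upwards [Lp.coeFn_sub (F i) f] with x hx
    rw [hx, Pi.sub_apply]
  have := key.sqrt
  simpa using this

open Classical in
/-- Multiplication by an essentially bounded function (zero if `m` is not in `L∞`). -/
def mulOp (m : ℝ → ℂ) : L2 →L[ℂ] L2 :=
  if h : MemLp m ∞ (volume : Measure ℝ) then
    (ContinuousLinearMap.lsmul ℂ ℂ).holderL volume ∞ 2 2 h.toLp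
  else 0

lemma mulOp_coeFn {m : ℝ → ℂ} (hm : MemLp m ∞ volume) (f : L2) :
    mulOp m f =ᵐ[volume] fun x => m x * f x := by
  rw [mulOp, dif_pos hm]
  filter_upwards [(ContinuousLinearMap.lsmul ℂ ℂ).coeFn_holder (r := 2) hm.toLp f,
    hm.coeFn_toLp] with x h1 h2
  simp only [ContinuousLinearMap.holderL_apply_apply]
  rw [h1, h2]
  simp

lemma mulOp_eq_of_ae {m : ℝ → ℂ} (hm : MemLp m ∞ volume) {f g : L2}
    (h : ∀ᵐ x, g x = m x * f x) : mulOp m f = g := by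
  apply Lp.ext
  filter_upwards [mulOp_coeFn hm f, h] with x h1 h2
  rw [h1, h2]

lemma mulOp_mul {m n : ℝ → ℂ} (hm : MemLp m ∞ volume) (hn : MemLp n ∞ volume)
    (hmn : MemLp (fun x => m x * n x) ∞ volume) :
    mulOp (fun x => m x * n x) = mulOp m * mulOp n := by
  ext1 f
  refine mulOp_eq_of_ae hmn ?_
  change ∀ᵐ x, mulOp m (mulOp n f) x = _
  filter_upwards [mulOp_coeFn hm (mulOp n f), mulOp_coeFn hn f] with x h1 h2
  rw [h1, h2, mul_assoc]

lemma memLp_top_one : MemLp (fun _ : ℝ => (1 : ℂ)) ∞ (volume : Measure ℝ) :=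
  memLp_top_const 1

lemma mulOp_one : mulOp (fun _ => 1) = 1 := by
  ext1 f
  exact mulOp_eq_of_ae memLp_top_one (Eventually.of_forall fun x => by simp)

lemma mulOp_sub {m n : ℝ → ℂ} (hm : MemLp m ∞ volume) (hn : MemLp n ∞ volume) :
    mulOp (fun x => m x - n x) = mulOp m - mulOp n := by
  ext1 f
  refine mulOp_eq_of_ae (hm.sub hn) ?_
  rw [sub_apply]
  filter_upwards [mulOp_coeFn hm f, mulOp_coeFn hn f, Lp.coeFn_sub (mulOp m f) (mulOp n f)]
    with x h1 h2 h3
  rw [h3, Pi.sub_apply, h1, h2, Pi.sub_apply, sub_mul]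

lemma mulOp_const_mul {m : ℝ → ℂ} (c : ℂ) (hm : MemLp m ∞ volume) :
    mulOp (fun x => c * m x) = c • mulOp m := by
  ext1 f
  refine mulOp_eq_of_ae (hm.const_mul c) ?_
  rw [smul_apply]
  filter_upwards [mulOp_coeFn hm f, Lp.coeFn_smul c (mulOp m f)]
    with x h1 h2
  rw [h2, Pi.smul_apply, h1, smul_eq_mul, mul_assoc]

lemma memLp_top_conj {m : ℝ → ℂ} (hm : MemLp m ∞ (volume : Measure ℝ)) :
    MemLp (fun x => conj (m x)) ∞ volume :=
  hm.star

lemma star_mulOp {m : ℝ → ℂ} (hm : MemLp m ∞ volume) :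
    star (mulOp m) = mulOp (fun x => conj (m x)) := by
  rw [ContinuousLinearMap.star_eq_adjoint, eq_comm, ContinuousLinearMap.eq_adjoint_iff]
  intro f g
  rw [L2.inner_def, L2.inner_def]
  refine integral_congr_ae ?_
  filter_upwards [mulOp_coeFn hm g, mulOp_coeFn (memLp_top_conj hm) f] with x h1 h2
  rw [h1, h2]
  simp only [RCLike.inner_apply, map_mul, Complex.conj_conj]
  ring

lemma mulOp_tendsto {ι : Type*} {l : Filter ι} [l.IsCountablyGenerated] {m : ι → ℝ → ℂ}
    {n : ℝ → ℂ} (hm : ∀ i, MemLp (m i) ∞ volume) (hn : MemLp n ∞ volume) (C : ℝ)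
    (hb : ∀ᶠ i in l, ∀ x, ‖m i x‖ ≤ C) (hb' : ∀ x, ‖n x‖ ≤ C)
    (hl : ∀ x, Tendsto (fun i => m i x) l (𝓝 (n x))) (f : L2) :
    Tendsto (fun i => mulOp (m i) f) l (𝓝 (mulOp n f)) := by
  -- Each `mulOp (m i) f` is known only up to a null set depending on `i`; along a sequence the
  -- exceptional sets have null union.
  refine tendsto_of_seq_tendsto fun u hu => ?_
  refine tendsto_of_dominated f C ?_ ?_ ?_
  · filter_upwards [hu.eventually hb] with i hi
    filter_upwards [mulOp_coeFn (hm (u i)) f] with x hx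
    rw [Function.comp_apply, hx, norm_mul]
    exact mul_le_mul_of_nonneg_right (hi x) (norm_nonneg _)
  · filter_upwards [mulOp_coeFn hn f] with x hx
    rw [hx, norm_mul]
    exact mul_le_mul_of_nonneg_right (hb' x) (norm_nonneg _)
  · filter_upwards [ae_all_iff.2 fun i => mulOp_coeFn (hm (u i)) f, mulOp_coeFn hn f]
      with x hx h2
    simp only [Function.comp_apply, hx, h2]
    exact ((hl x).comp hu).mul_const _

/-! ### Reflection -/

/-- The reflection `f ↦ f(-·)` on `L²(ℝ)`. -/
def reflect : L2 →L[ℂ] L2 :=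
  (Lp.compMeasurePreservingₗᵢ ℂ (fun x : ℝ => -x)
    (Measure.measurePreserving_neg (volume : Measure ℝ))).toContinuousLinearMap

lemma ae_neg {p : ℝ → Prop} (h : ∀ᵐ x, p x) : ∀ᵐ x, p (-x) :=
  (Measure.measurePreserving_neg (volume : Measure ℝ)).quasiMeasurePreserving.ae h

lemma reflect_coeFn (f : L2) : reflect f =ᵐ[volume] fun x => f (-x) :=
  Lp.coeFn_compMeasurePreserving f (Measure.measurePreserving_neg (volume : Measure ℝ))

lemma reflect_mul_reflect : reflect * reflect = 1 := by
  ext1 f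
  apply Lp.ext
  change reflect (reflect f) =ᵐ[volume] f
  filter_upwards [reflect_coeFn (reflect f), ae_neg (reflect_coeFn f)] with x h1 h2
  rw [h1, h2, neg_neg]

lemma reflect_reflect (f : L2) : reflect (reflect f) = f := DFunLike.congr_fun reflect_mul_reflect f

lemma star_reflect : star reflect = reflect := by
  rw [ContinuousLinearMap.star_eq_adjoint, eq_comm, ContinuousLinearMap.eq_adjoint_iff]
  intro f g
  rw [L2.inner_def, L2.inner_def,
    ← integral_neg_eq_self (μ := volume) (fun x => inner ℂ (f x) (reflect g x))]
  refine integral_congr_ae ?_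
  filter_upwards [reflect_coeFn f, ae_neg (reflect_coeFn g)] with x h1 h2
  rw [h1, h2, neg_neg]

lemma memLp_top_comp_neg {m : ℝ → ℂ} (hm : MemLp m ∞ (volume : Measure ℝ)) :
    MemLp (fun x => m (-x)) ∞ (volume : Measure ℝ) :=
  hm.comp_measurePreserving (Measure.measurePreserving_neg (volume : Measure ℝ))

lemma reflect_mulOp {m : ℝ → ℂ} (hm : MemLp m ∞ volume) :
    reflect * mulOp m = mulOp (fun x => m (-x)) * reflect := by
  ext1 f
  apply Lp.ext
  change reflect (mulOp m f) =ᵐ[volume] mulOp _ (reflect f)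
  filter_upwards [reflect_coeFn (mulOp m f), ae_neg (mulOp_coeFn hm f), reflect_coeFn f,
    mulOp_coeFn (memLp_top_comp_neg hm) (reflect f)] with x h1 h2 h3 h4
  rw [h1, h2, h4, h3]

/-! ### Fourier transform -/

/-- The Fourier transform on `L²(ℝ)`. -/
def four : L2 ≃ₗᵢ[ℂ] L2 := Lp.fourierTransformₗᵢ ℝ ℂ

/-- The `L²` transform agrees with the transform of tempered distributions, which is defined by this
duality. It lets `L²` identities be tested against Schwartz functions. -/
lemma integral_schwartz_mul_four (f : L2) (h : 𝓢(ℝ, ℂ)) :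
    ∫ x, h x * four f x = ∫ x, (𝓕 h) x * f x := by
  have h1 := congrArg (fun T => T h) (Lp.fourier_toTemperedDistribution_eq f)
  simp only [TemperedDistribution.fourier_apply, Lp.toTemperedDistribution_apply, smul_eq_mul] at h1
  exact h1.symm

lemma integral_schwartz_mul_fourier {b : ℝ → ℂ} (hb : Integrable b) (h : 𝓢(ℝ, ℂ)) :
    ∫ x, h x * 𝓕 b x = ∫ x, (𝓕 h) x * b x := by
  have := VectorFourier.integral_fourierIntegral_smul_eq_flip (L := innerₗ ℝ) (μ := volume)
    (ν := volume) Real.continuous_fourierChar continuous_inner h.integrable hb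
  rw [flip_innerₗ] at this
  rw [SchwartzMap.fourier_coe]
  exact this.symm

lemma eq_of_integral_schwartz {a b : ℝ → ℂ} (ha : LocallyIntegrable a) (hb : LocallyIntegrable b)
    (h : ∀ g : 𝓢(ℝ, ℂ), ∫ x, g x * a x = ∫ x, g x * b x) : a =ᵐ[volume] b := by
  refine ae_eq_of_integral_contDiff_smul_eq ha hb fun g hg hc => ?_
  have hc' : HasCompactSupport (fun x => (g x : ℂ)) := hc.comp_left (g := Complex.ofReal) rfl
  have := h (hc'.toSchwartzMap (Complex.ofRealCLM.contDiff.comp hg))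
  simpa using! this

lemma locallyIntegrable_L2 (f : L2) : LocallyIntegrable f :=
  (Lp.memLp f).locallyIntegrable (by norm_num)

/-- An `L²` function whose Fourier transform is that of an `L¹` function equals it. -/
lemma eq_of_four_eq_fourier {a : L2} {b : ℝ → ℂ} (hb : Integrable b)
    (h : four a =ᵐ[volume] 𝓕 b) : a =ᵐ[volume] b := by
  refine eq_of_integral_schwartz (locallyIntegrable_L2 a) hb.locallyIntegrable fun g => ?_
  -- Every Schwartz function is a Fourier transform, so testing `a` against `𝓕 k` is testing `four
  -- a` against `k`.
  obtain ⟨k, rfl⟩ : ∃ k : 𝓢(ℝ, ℂ), g = 𝓕 k := ⟨𝓕⁻ g, (FourierTransform.fourier_fourierInv_eq g).symm⟩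
  rw [← integral_schwartz_mul_four, ← integral_schwartz_mul_fourier hb]
  refine integral_congr_ae ?_
  filter_upwards [h] with x hx
  rw [hx]

/-- The `L²` Fourier transform agrees with the Fourier integral on `L¹ ∩ L²`. -/
lemma four_eq_fourier {a : L2} (ha : Integrable (a : ℝ → ℂ)) :
    four a =ᵐ[volume] 𝓕 (a : ℝ → ℂ) := by
  refine eq_of_integral_schwartz (locallyIntegrable_L2 _) ?_ fun g => ?_
  · exact (VectorFourier.fourierIntegral_continuous Real.continuous_fourierChar
      (innerSL ℝ).continuous₂ ha).locallyIntegrable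
  · rw [integral_schwartz_mul_four, integral_schwartz_mul_fourier ha]

/-- On the dense Schwartz space the transform is an integral and the substitution `x ↦ -x` applies;
both sides are continuous. -/
lemma reflect_four (f : L2) : reflect (four f) = four (reflect f) := by
  have hd := SchwartzMap.denseRange_toLpCLM (E := ℝ) (F := ℂ) (p := 2) (μ := volume)
    ENNReal.ofNat_ne_top
  refine DenseRange.induction_on hd
    (p := fun f : L2 => reflect (four f) = four (reflect f)) f ?_ fun φ => ?_
  · exact isClosed_eq (reflect.continuous.comp four.continuous)
      (four.continuous.comp reflect.continuous)
  · simp only [SchwartzMap.toLpCLM_apply]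
    have h0 := φ.coeFn_toLp 2 (volume : Measure ℝ)
    have hi : Integrable (φ.toLp 2 (volume : Measure ℝ) : ℝ → ℂ) :=
      φ.integrable.congr h0.symm
    have hi' : Integrable (reflect (φ.toLp 2 (volume : Measure ℝ)) : ℝ → ℂ) :=
      hi.comp_neg.congr (reflect_coeFn _).symm
    apply Lp.ext
    filter_upwards [reflect_coeFn (four (φ.toLp 2 (volume : Measure ℝ))),
      ae_neg (four_eq_fourier hi), four_eq_fourier hi'] with x h1 h2 h3
    rw [h1, h2, h3, Real.fourier_congr_ae (reflect_coeFn _)]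
    exact (Real.fourier_comp_linearIsometry (LinearIsometryEquiv.neg ℝ) _ x).symm

/-! ### Fourier multipliers -/

/-- The Fourier multiplier with symbol `m`. -/
def fourMul (m : ℝ → ℂ) : L2 →L[ℂ] L2 :=
  (four.symm : L2 →L[ℂ] L2) * mulOp m * (four : L2 →L[ℂ] L2)

lemma fourMul_apply (m : ℝ → ℂ) (f : L2) : fourMul m f = four.symm (mulOp m (four f)) := rfl

lemma four_fourMul_coeFn {m : ℝ → ℂ} (hm : MemLp m ∞ volume) (f : L2) :
    four (fourMul m f) =ᵐ[volume] fun ξ => m ξ * four f ξ := by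
  rw [fourMul_apply, LinearIsometryEquiv.apply_symm_apply]
  exact mulOp_coeFn hm _

lemma fourMul_mul {m n : ℝ → ℂ} (hm : MemLp m ∞ volume) (hn : MemLp n ∞ volume)
    (hmn : MemLp (fun x => m x * n x) ∞ volume) :
    fourMul (fun x => m x * n x) = fourMul m * fourMul n := by
  ext1 f
  change four.symm (mulOp _ (four f)) =
    four.symm (mulOp m (four (four.symm (mulOp n (four f)))))
  rw [LinearIsometryEquiv.apply_symm_apply, mulOp_mul hm hn hmn]
  rfl

lemma fourMul_one : fourMul (fun _ => 1) = 1 := by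
  ext1 f
  rw [fourMul_apply, mulOp_one]
  exact four.symm_apply_apply f

lemma star_fourMul {m : ℝ → ℂ} (hm : MemLp m ∞ volume) :
    star (fourMul m) = fourMul (fun x => conj (m x)) := by
  rw [ContinuousLinearMap.star_eq_adjoint, eq_comm, ContinuousLinearMap.eq_adjoint_iff]
  intro f g
  rw [fourMul_apply, fourMul_apply, ← four.inner_map_map, four.apply_symm_apply, ← star_mulOp hm,
    ContinuousLinearMap.star_eq_adjoint, ContinuousLinearMap.adjoint_inner_left,
    ← four.inner_map_map f, four.apply_symm_apply]

lemma fourMul_tendsto {ι : Type*} {l : Filter ι} [l.IsCountablyGenerated] {m : ι → ℝ → ℂ}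
    {n : ℝ → ℂ} (hm : ∀ i, MemLp (m i) ∞ volume) (hn : MemLp n ∞ volume) (C : ℝ)
    (hb : ∀ᶠ i in l, ∀ x, ‖m i x‖ ≤ C) (hb' : ∀ x, ‖n x‖ ≤ C)
    (hl : ∀ x, Tendsto (fun i => m i x) l (𝓝 (n x))) (f : L2) :
    Tendsto (fun i => fourMul (m i) f) l (𝓝 (fourMul n f)) :=
  (four.symm.continuous.tendsto _).comp (mulOp_tendsto hm hn C hb hb' hl (four f))

lemma reflect_fourMul {m : ℝ → ℂ} (hm : MemLp m ∞ volume) :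
    reflect * fourMul m = fourMul (fun x => m (-x)) * reflect := by
  ext1 f
  apply four.injective
  change four (reflect (four.symm (mulOp m (four f)))) =
    four (four.symm (mulOp (fun x => m (-x)) (four (reflect f))))
  rw [← reflect_four, four.apply_symm_apply, four.apply_symm_apply, ← reflect_four]
  exact DFunLike.congr_fun (reflect_mulOp hm) (four f)

lemma fourMul_commute {m n : ℝ → ℂ} (hm : MemLp m ∞ volume) (hn : MemLp n ∞ volume)
    (hmn : MemLp (fun x => m x * n x) ∞ volume) : Commute (fourMul m) (fourMul n) := by
  have h : (fun x => m x * n x) = fun x => n x * m x := by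
    funext x
    exact mul_comm _ _
  rw [commute_iff_eq, ← fourMul_mul hm hn hmn, ← fourMul_mul hn hm (h ▸ hmn), h]

/-- A convolution is a Fourier multiplier. -/
lemma fourMul_fourier {k : ℝ → ℂ} (hk : Integrable k) (hm : MemLp (𝓕 k) ∞ volume) {f : L2}
    (hf : Integrable (f : ℝ → ℂ)) :
    fourMul (𝓕 k) f =ᵐ[volume] fun x => ∫ y, k (x - y) * f y := by
  have hi := hf.integrable_convolution (ContinuousLinearMap.mul ℂ ℂ) hk
  have h1 : (convolution (f : ℝ → ℂ) k (ContinuousLinearMap.mul ℂ ℂ) volume) =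
      fun x => ∫ y, k (x - y) * f y := by
    funext x
    rw [convolution_def]
    refine integral_congr_ae (Eventually.of_forall fun y => ?_)
    exact mul_comm _ _
  rw [h1] at hi
  refine eq_of_four_eq_fourier hi ?_
  filter_upwards [four_fourMul_coeFn hm f, four_eq_fourier hf] with ξ h2 h3
  rw [h2, h3, ← h1, Real.fourier_mul_convolution_eq hf hk, mul_comm]

end DeltaSchrodinger
end

noncomputable section

namespace DeltaSchrodinger

/-! ### Compression of a commutant to the half-line

`J` plays the role of the reflection, `P` of the restriction to `[0, ∞)` and `K` of the self-adjoint
involution whose fixed vectors are determined by their restriction to `[0, ∞)`. -/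

section Algebra

set_option linter.unusedSectionVars false

variable {A : Type*} [Ring A] [Algebra ℂ A] [StarRing A]

/-- The relations between the reflection, the involution and the half-line projection. -/
structure HalfLineRelations (J K P : A) : Prop where
  JJ : J * J = 1
  KK : K * K = 1
  PP : P * P = P
  JP : J * P = (1 - P) * J
  PKP : P * K * P = 0
  DD : ((1 - P) * K * (1 - P)) * ((1 - P) * K * (1 - P)) = -((1 - P) * K * (1 - P))
  star_J : star J = J
  star_K : star K = K
  star_P : star P = P

/-- The projection onto even vectors. -/
def evenPart (J : A) : A := (1 / 2 : ℂ) • (1 + J)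

/-- The projection onto odd vectors. -/
def oddPart (J : A) : A := (1 / 2 : ℂ) • (1 - J)

/-- The extension of an even vector to a fixed vector of `K`. -/
def ext (J K P : A) : A := (1 + K) * P * evenPart J

/-- The even vector with a given restriction to the half-line. -/
def evenExt (J P : A) : A := (1 + J) * P

/-- The compression of an element `X` commuting with `J` and `K`. -/
def compress (J K P X : A) : A := evenExt J P * X * ext J K P + X * oddPart J

lemma evenPart_add_oddPart (J : A) : evenPart J + oddPart J = 1 := by
  rw [evenPart, oddPart, ← smul_add, add_add_sub_cancel, ← two_smul ℂ (1 : A), smul_smul]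
  norm_num

lemma two_evenPart (J : A) : evenPart J + evenPart J = 1 + J := by
  rw [evenPart, ← add_smul]
  norm_num

namespace HalfLineRelations

variable {J K P : A}

lemma J_even (h : HalfLineRelations J K P) : J * evenPart J = evenPart J := by
  rw [evenPart, mul_smul_comm, mul_add, mul_one, h.JJ, add_comm]

lemma even_J (h : HalfLineRelations J K P) : evenPart J * J = evenPart J := by
  rw [evenPart, smul_mul_assoc, add_mul, one_mul, h.JJ, add_comm]

lemma J_odd (h : HalfLineRelations J K P) : J * oddPart J = -oddPart J := by
  rw [oddPart, mul_smul_comm, mul_sub, mul_one, h.JJ, ← smul_neg, neg_sub]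

lemma odd_mul_one_add (h : HalfLineRelations J K P) : oddPart J * (1 + J) = 0 := by
  rw [oddPart, smul_mul_assoc, sub_mul, one_mul, mul_add, mul_one, h.JJ, add_comm J 1, sub_self,
    smul_zero]

lemma even_mul_one_add (h : HalfLineRelations J K P) : evenPart J * (1 + J) = 1 + J := by
  rw [mul_add, mul_one, h.even_J, two_evenPart]

lemma odd_even (h : HalfLineRelations J K P) : oddPart J * evenPart J = 0 := by
  rw [evenPart, mul_smul_comm, h.odd_mul_one_add, smul_zero]

lemma even_odd (h : HalfLineRelations J K P) : evenPart J * oddPart J = 0 := by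
  rw [oddPart, mul_smul_comm, mul_sub, mul_one, h.even_J, sub_self, smul_zero]

lemma odd_odd (h : HalfLineRelations J K P) : oddPart J * oddPart J = oddPart J := by
  have := congrArg (oddPart J * ·) (evenPart_add_oddPart J)
  simpa [mul_add, h.odd_even] using this

lemma PJP (h : HalfLineRelations J K P) : P * J * P = 0 := by
  rw [mul_assoc, h.JP, ← mul_assoc, mul_sub, mul_one, h.PP, sub_self, zero_mul]

/-- A vector fixed by `K` is the extension of its own restriction to the half-line. With `P K P = 0`
the block `(1 - P) K (1 - P)` equals `K - P K - K P`, and the relation `DD`, expanded with `K² = 1`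
and `P² = P`, is this identity rearranged. -/
lemma one_add_K_P (h : HalfLineRelations J K P) : (1 + K) * P * (1 + K) = 1 + K := by
  have h1 : ((1 - P) * K * (1 - P)) = K - P * K - K * P := by
    have : (1 - P) * K * (1 - P) = K - P * K - K * P + P * K * P := by noncomm_ring
    rw [this, h.PKP, add_zero]
  have h2 := h.DD
  rw [h1] at h2
  have h3 : (K - P * K - K * P) * (K - P * K - K * P) =
      K * K - K * P * K - (K * K) * P - P * (K * K) + (P * K * P) * K + P * (K * K) * P
        - K * P * K + K * (P * P) * K + K * (P * K * P) := by noncomm_ring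
  rw [h3, h.PKP, h.KK, h.PP, zero_mul, mul_zero, one_mul, mul_one, h.PP] at h2
  -- The bracket is the difference of the two sides of `h2`, hence zero.
  have h4 : (1 + K) * P * (1 + K) = 1 + K - (1 - K * P * K - P - P + 0 + P - K * P * K
      + K * P * K + 0 - -(K - P * K - K * P)) := by noncomm_ring
  rw [h4, h2, sub_self, sub_zero]

lemma P_evenExt (h : HalfLineRelations J K P) : P * evenExt J P = P := by
  rw [evenExt, ← mul_assoc, mul_add, mul_one, add_mul, h.PP, h.PJP, add_zero]

/-- By `P K P = 0` the extension has the same half-line restriction as the even part, and an even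
vector is recovered from that restriction. -/
lemma evenExt_ext (h : HalfLineRelations J K P) : evenExt J P * ext J K P = evenPart J := by
  have h1 : evenExt J P * ext J K P = (1 + J) * (P * P + P * K * P) * evenPart J := by
    rw [evenExt, ext]; noncomm_ring
  rw [h1, h.PP, h.PKP, add_zero, add_mul, one_mul, h.JP, add_mul, mul_assoc (1 - P), h.J_even,
    ← add_mul, add_sub_cancel, one_mul]

lemma ext_evenExt (h : HalfLineRelations J K P) : ext J K P * evenExt J P = (1 + K) * P := by
  have h1 : ext J K P * evenExt J P = (1 + K) * P * (evenPart J * (1 + J)) * P := by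
    rw [evenExt, ext]; noncomm_ring
  have h2 := h.P_evenExt
  rw [evenExt] at h2
  rw [h1, h.even_mul_one_add, mul_assoc, mul_assoc, h2]

lemma ext_odd (h : HalfLineRelations J K P) : ext J K P * oddPart J = 0 := by
  rw [ext, mul_assoc, h.even_odd, mul_zero]

lemma odd_evenExt (h : HalfLineRelations J K P) : oddPart J * evenExt J P = 0 := by
  rw [evenExt, ← mul_assoc, h.odd_mul_one_add, zero_mul]

lemma K_ext (h : HalfLineRelations J K P) : K * ext J K P = ext J K P := by
  rw [ext, ← mul_assoc, ← mul_assoc, mul_add, mul_one, h.KK, add_comm K 1]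

/-! ### Compressing elements that commute with `J` and `K` -/

section Commutant

variable {X Y : A}

lemma _root_.DeltaSchrodinger.commute_oddPart (hJ : Commute J X) : Commute (oddPart J) X :=
  ((Commute.one_left X).sub_left hJ).smul_left _

/-- `X` commutes with `K`, so `X` applied to an extension is again fixed by `K`; restricting it and
extending anew changes nothing, by `one_add_K_P`. -/
lemma ext_evenExt_mul_ext (h : HalfLineRelations J K P) (hK : Commute K X) : ext J K P * evenExt J P * X * ext J K P = X * ext J K P := by
  have hc : (1 + K) * X = X * (1 + K) := (Commute.one_left X).add_left hK
  rw [h.ext_evenExt, ext]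
  calc (1 + K) * P * X * ((1 + K) * P * evenPart J)
      = (1 + K) * P * (X * (1 + K)) * P * evenPart J := by noncomm_ring
    _ = (1 + K) * P * (1 + K) * X * P * evenPart J := by rw [← hc]; noncomm_ring
    _ = X * (1 + K) * P * evenPart J := by rw [h.one_add_K_P, hc]
    _ = _ := by noncomm_ring

/-- With `odd_compress` this says that the pair (extension, odd part) conjugates `compress X` to `X`
itself. Multiplicativity and the identification of the generator rest on these two relations. -/
lemma ext_compress (h : HalfLineRelations J K P) (hJ : Commute J X) (hK : Commute K X) : ext J K P * compress J K P X = X * ext J K P := by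
  rw [compress, mul_add, ← mul_assoc, ← mul_assoc, h.ext_evenExt_mul_ext hK, ← (commute_oddPart hJ).eq,
    ← mul_assoc, h.ext_odd, zero_mul, add_zero]

lemma odd_compress (h : HalfLineRelations J K P) (hJ : Commute J X) : oddPart J * compress J K P X = X * oddPart J := by
  rw [compress, mul_add, ← mul_assoc, ← mul_assoc, h.odd_evenExt, zero_mul, zero_mul, zero_add,
    ← mul_assoc, (commute_oddPart hJ).eq, mul_assoc, h.odd_odd]

/-- Source of the formula for `x ≥ 0`: no reflection is seen on the positive half-line, and `ext +
oddPart` is `φ ↦ L₊[φ]`. -/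
lemma P_compress (h : HalfLineRelations J K P) : P * compress J K P X = P * X * (ext J K P + oddPart J) := by
  rw [compress, mul_add, ← mul_assoc, ← mul_assoc, h.P_evenExt]
  noncomm_ring

/-- Source of the formula for `x < 0`: there the even extension is the reflection `J`, which passes
through `X`, and `J * ext + oddPart` is `φ ↦ L₋[φ]`. -/
lemma one_sub_P_compress (h : HalfLineRelations J K P) (hJ : Commute J X) :
    (1 - P) * compress J K P X = (1 - P) * X * (J * ext J K P + oddPart J) := by
  have h1 : (1 - P) * evenExt J P = (1 - P) * J := by
    rw [sub_mul, one_mul, h.P_evenExt, evenExt, add_mul, one_mul, h.JP, add_sub_cancel_left]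
  calc _ = ((1 - P) * evenExt J P) * X * ext J K P + (1 - P) * X * oddPart J := by
        rw [compress]; noncomm_ring
    _ = (1 - P) * (J * X) * ext J K P + (1 - P) * X * oddPart J := by rw [h1]; noncomm_ring
    _ = _ := by rw [hJ.eq]; noncomm_ring

lemma compress_mul (h : HalfLineRelations J K P) (hJY : Commute J Y) (hKY : Commute K Y) :
    compress J K P (X * Y) = compress J K P X * compress J K P Y := by
  rw [compress, compress, add_mul, mul_assoc (_ * X) (ext J K P), mul_assoc X (oddPart J)]
  change _ = _ * (ext J K P * compress J K P Y) + X * (oddPart J * compress J K P Y)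
  rw [h.ext_compress hJY hKY, h.odd_compress hJY]
  noncomm_ring

lemma compress_one (h : HalfLineRelations J K P) : compress J K P 1 = 1 := by
  rw [compress, mul_one, one_mul, h.evenExt_ext, evenPart_add_oddPart]

lemma star_compress [StarModule ℂ A] (h : HalfLineRelations J K P) (hJ : Commute J X)
    (hK : Commute K X) : star (compress J K P X) = compress J K P (star X) := by
  have hE : star (evenPart J) = evenPart J := by
    rw [evenPart, star_smul, star_add, star_one, h.star_J]
    congr 1
    simp
  have hO : star (oddPart J) = oddPart J := by
    rw [oddPart, star_smul, star_sub, star_one, h.star_J]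
    congr 1
    simp
  have hJs : Commute J (star X) := by
    have := hJ.star_star
    rwa [h.star_J] at this
  have hKs : Commute K (star X) := by
    have := hK.star_star
    rwa [h.star_K] at this
  have hc : (1 + K) * star X = star X * (1 + K) := (Commute.one_left _).add_left hKs
  rw [compress, compress, star_add, star_mul, star_mul, star_mul, hO, ext, evenExt, star_mul,
    star_mul, star_mul, star_add, star_add, star_one, hE, h.star_J, h.star_K, h.star_P,
    (commute_oddPart hJs).eq]
  congr 1
  -- Since `1 + J` is twice the even projection, the two ends of the product differ only by a factor
  -- 2, and moving `1 + K` across `star X` exchanges them.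
  rw [← two_evenPart J]
  calc evenPart J * (P * (1 + K)) * (star X * (P * (evenPart J + evenPart J)))
      = evenPart J * P * ((1 + K) * star X) * P * (evenPart J + evenPart J) := by noncomm_ring
    _ = evenPart J * P * (star X * (1 + K)) * P * (evenPart J + evenPart J) := by rw [hc]
    _ = _ := by noncomm_ring

end Commutant

end HalfLineRelations

end Algebra

end DeltaSchrodinger
end

noncomputable section

namespace DeltaSchrodinger

open scoped FourierTransform SchwartzMap ComplexConjugate

/-! ### Truncation and convolution -/

lemma memLp_top_indicator {s : Set ℝ} (hs : MeasurableSet s) :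
    MemLp (s.indicator (1 : ℝ → ℂ)) ∞ (volume : Measure ℝ) :=
  memLp_top_one.indicator hs

lemma mulOp_indicator_coeFn {s : Set ℝ} (hs : MeasurableSet s) (f : L2) :
    mulOp (s.indicator 1) f =ᵐ[volume] s.indicator f := by
  filter_upwards [mulOp_coeFn (memLp_top_indicator hs) f] with x hx
  rw [hx]
  by_cases h : x ∈ s <;> simp [h]

lemma norm_indicator_one_le (s : Set ℝ) (x : ℝ) : ‖s.indicator (1 : ℝ → ℂ) x‖ ≤ 1 := by
  by_cases h : x ∈ s <;> simp [h]

/-- Truncation to `[-r, r]`. -/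
def trunc (r : ℝ) : L2 →L[ℂ] L2 := mulOp ((Icc (-r) r).indicator 1)

lemma trunc_coeFn (r : ℝ) (f : L2) : trunc r f =ᵐ[volume] (Icc (-r) r).indicator f :=
  mulOp_indicator_coeFn measurableSet_Icc f

lemma integrable_trunc (r : ℝ) (f : L2) : Integrable (trunc r f : ℝ → ℂ) := by
  refine Integrable.congr ?_ (trunc_coeFn r f).symm
  rw [integrable_indicator_iff measurableSet_Icc]
  exact (locallyIntegrable_L2 f).integrableOn_isCompact isCompact_Icc

lemma tendsto_indicator_Icc (f : ℝ → ℂ) (x : ℝ) :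
    Tendsto (fun r : ℝ => (Icc (-r) r).indicator f x) atTop (𝓝 (f x)) := by
  refine tendsto_const_nhds.congr' ?_
  filter_upwards [eventually_ge_atTop |x|] with r hr
  rw [indicator_of_mem]
  exact abs_le.1 hr

lemma trunc_tendsto (f : L2) : Tendsto (fun r => trunc r f) atTop (𝓝 f) := by
  have := mulOp_tendsto (l := atTop) (m := fun r : ℝ => (Icc (-r) r).indicator 1) (n := fun _ => 1)
    (fun r => memLp_top_indicator measurableSet_Icc) memLp_top_one 1
    (Eventually.of_forall fun r x => norm_indicator_one_le _ x) (fun x => by simp)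
    (fun x => tendsto_indicator_Icc 1 x) f
  rwa [mulOp_one] at this

/-- Convergence in `L²` determines the almost everywhere limit of a sequence. -/
lemma ae_eq_of_tendsto {F : ℕ → L2} {f : L2} (h : Tendsto F atTop (𝓝 f)) {g : ℝ → ℂ}
    (hg : ∀ᵐ x, Tendsto (fun n => F n x) atTop (𝓝 (g x))) : f =ᵐ[volume] g := by
  obtain ⟨ns, hns, hae⟩ := (tendstoInMeasure_of_tendsto_Lp h).exists_seq_tendsto_ae
  filter_upwards [hae, hg] with x h1 h2
  exact tendsto_nhds_unique h1 (h2.comp hns.tendsto_atTop)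

lemma memLp_comp_sub {k : ℝ → ℂ} (hk : MemLp k 2 volume) (x : ℝ) :
    MemLp (fun y => k (x - y)) 2 volume :=
  hk.comp_measurePreserving (Measure.measurePreserving_sub_left volume x)

lemma integrable_kernel_mul {k : ℝ → ℂ} (hk : MemLp k 2 volume) (f : L2) (x : ℝ) :
    Integrable (fun y => k (x - y) * f y) :=
  (memLp_comp_sub hk x).integrable_mul (Lp.memLp f)

/-- Convolution with an `L¹ ∩ L²` kernel on `L²` as a Fourier multiplier. -/
lemma fourMul_fourier_of_memLp {k : ℝ → ℂ} (hk : Integrable k) (hk2 : MemLp k 2 volume)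
    (hm : MemLp (𝓕 k) ∞ volume) (f : L2) :
    fourMul (𝓕 k) f =ᵐ[volume] fun x => ∫ y, k (x - y) * f y := by
  have h1 : Tendsto (fun n : ℕ => fourMul (𝓕 k) (trunc n f)) atTop (𝓝 (fourMul (𝓕 k) f)) :=
    ((fourMul (𝓕 k)).continuous.tendsto f).comp
      ((trunc_tendsto f).comp tendsto_natCast_atTop_atTop)
  refine ae_eq_of_tendsto h1 ?_
  filter_upwards [ae_all_iff.2 fun n : ℕ => fourMul_fourier hk hm (integrable_trunc n f)] with x hx
  simp only [hx]
  have h2 : ∀ n : ℕ, ∫ y, k (x - y) * (trunc n f) y =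
      ∫ y, k (x - y) * (Icc (-(n : ℝ)) n).indicator f y := fun n => by
    refine integral_congr_ae ?_
    filter_upwards [trunc_coeFn n f] with y hy
    rw [hy]
  simp only [h2]
  -- Square integrability of `k` makes the untruncated integrand integrable for every `x`, so it
  -- dominates the truncated ones.
  refine tendsto_integral_of_dominated_convergence (fun y => ‖k (x - y) * f y‖) (fun n => ?_)
    (integrable_kernel_mul hk2 f x).norm (fun n => ?_) ?_
  · exact (memLp_comp_sub hk2 x).1.mul ((Lp.aestronglyMeasurable f).indicator measurableSet_Icc)
  · refine Eventually.of_forall fun y => ?_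
    rw [norm_mul, norm_mul]
    exact mul_le_mul_of_nonneg_left (norm_indicator_le_norm_self _ _) (norm_nonneg _)
  · refine Eventually.of_forall fun y => ?_
    exact ((tendsto_indicator_Icc f y).comp tendsto_natCast_atTop_atTop).const_mul _

/-! ### The exponential kernel and the involution -/

/-- The kernel `q e^{-qx} 1_{x>0}`. -/
def expKernel (q : ℝ) : ℝ → ℂ :=
  (Ioi (0 : ℝ)).indicator fun x => (q : ℂ) * Complex.exp (-(q : ℂ) * x)

lemma expKernel_zero : expKernel 0 = 0 := by
  funext x
  simp [expKernel]

lemma integrable_expKernel {q : ℝ} (hq : 0 ≤ q) : Integrable (expKernel q) := by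
  rcases hq.eq_or_lt with rfl | hq
  · rw [expKernel_zero]
    exact integrable_zero _ _ _
  · rw [expKernel, integrable_indicator_iff measurableSet_Ioi]
    exact (integrableOn_exp_mul_complex_Ioi (a := -(q : ℂ)) (by simpa using hq) 0).const_mul _

lemma norm_expKernel_le {q : ℝ} (hq : 0 ≤ q) (x : ℝ) : ‖expKernel q x‖ ≤ q := by
  rw [expKernel]
  by_cases h : x ∈ Ioi (0 : ℝ)
  · rw [indicator_of_mem h, norm_mul, Complex.norm_exp, Complex.norm_real, Real.norm_of_nonneg hq]
    have : Real.exp (-(q : ℂ) * x).re ≤ 1 := by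
      rw [Real.exp_le_one_iff]
      simp only [neg_mul, Complex.neg_re, Complex.re_ofReal_mul, Complex.ofReal_re]
      have := mul_nonneg hq (mem_Ioi.1 h).le
      linarith
    nlinarith
  · rw [indicator_of_notMem h, norm_zero]
    exact hq

lemma memLp_two_expKernel {q : ℝ} (hq : 0 ≤ q) : MemLp (expKernel q) 2 volume := by
  rw [memLp_two_iff_integrable_sq_norm (integrable_expKernel hq).1]
  refine Integrable.mono' ((integrable_expKernel hq).norm.const_mul q)
    ((integrable_expKernel hq).1.norm.pow 2) (Eventually.of_forall fun x => ?_)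
  rw [Real.norm_of_nonneg (by positivity), pow_two]
  exact mul_le_mul_of_nonneg_right (norm_expKernel_le hq x) (norm_nonneg _)

lemma fourier_expKernel {q : ℝ} (hq : 0 ≤ q) (ξ : ℝ) :
    𝓕 (expKernel q) ξ = q / (q + 2 * Real.pi * ξ * Complex.I) := by
  -- At `q = 0` the exponential is not integrable, but the kernel is zero; the right side vanishes
  -- as well, being `0 / 0 = 0` at `ξ = 0`.
  rcases hq.eq_or_lt with rfl | hq
  · rw [expKernel_zero, Real.fourier_real_eq]
    simp
  · have h1 : (fun v : ℝ => Complex.exp (↑(-2 * Real.pi * v * ξ) * Complex.I) • expKernel q v) =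
        (Ioi (0 : ℝ)).indicator fun v : ℝ =>
          (q : ℂ) * Complex.exp (-(q + 2 * Real.pi * ξ * Complex.I) * v) := by
      funext v
      by_cases h : v ∈ Ioi (0 : ℝ)
      · rw [expKernel, indicator_of_mem h, indicator_of_mem h, smul_eq_mul, mul_left_comm,
          ← Complex.exp_add]
        congr 2
        push_cast
        ring
      · rw [expKernel, indicator_of_notMem h, indicator_of_notMem h, smul_zero]
    rw [Real.fourier_real_eq_integral_exp_smul, h1, integral_indicator measurableSet_Ioi,
      integral_const_mul, integral_exp_mul_complex_Ioi (by simpa using hq)]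
    simp only [Complex.ofReal_zero, mul_zero, Complex.exp_zero]
    rw [neg_div_neg_eq, mul_one_div]

lemma memLp_top_fourier_expKernel {q : ℝ} (hq : 0 ≤ q) : MemLp (𝓕 (expKernel q)) ∞ volume := by
  refine memLp_top_of_bound ?_ 1 (Eventually.of_forall fun ξ => ?_)
  · exact (VectorFourier.fourierIntegral_continuous Real.continuous_fourierChar
      (innerSL ℝ).continuous₂ (integrable_expKernel hq)).aestronglyMeasurable
  · rw [fourier_expKernel hq, norm_div]
    refine div_le_one_of_le₀ ?_ (norm_nonneg _)
    have := Complex.abs_re_le_norm (q + 2 * Real.pi * ξ * Complex.I)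
    simpa using this

/-- The symbol `(2πiξ - q) / (2πiξ + q)`. -/
def scatSymbol (q ξ : ℝ) : ℂ := 1 - 2 * 𝓕 (expKernel q) ξ

lemma denom_ne_zero {q : ℝ} (hq : 0 < q) (ξ : ℝ) :
    (q : ℂ) + 2 * Real.pi * ξ * Complex.I ≠ 0 := by
  intro h
  have := congrArg Complex.re h
  simp at this
  exact hq.ne' this

/-- The form with denominators cleared also covers `q = 0`, where the symbol is identically `1`. -/
lemma scatSymbol_mul {q : ℝ} (hq : 0 ≤ q) (ξ : ℝ) :
    (q + 2 * Real.pi * ξ * Complex.I) * scatSymbol q ξ = 2 * Real.pi * ξ * Complex.I - q := by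
  rw [scatSymbol, fourier_expKernel hq]
  rcases hq.eq_or_lt with rfl | hq
  · simp
  · have := denom_ne_zero hq ξ
    field_simp
    ring

lemma scatSymbol_conj {q : ℝ} (hq : 0 ≤ q) (ξ : ℝ) :
    conj (scatSymbol q ξ) = scatSymbol q (-ξ) := by
  simp only [scatSymbol, fourier_expKernel hq]
  simp [map_ofNat]

/-- Numerator and denominator trade places, up to sign, under `ξ ↦ -ξ`. This is what makes `J R` an
involution. -/
lemma scatSymbol_neg_mul {q : ℝ} (hq : 0 ≤ q) (ξ : ℝ) :
    scatSymbol q (-ξ) * scatSymbol q ξ = 1 := by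
  rcases hq.eq_or_lt with rfl | hq'
  · simp [scatSymbol, fourier_expKernel le_rfl]
  · have h1 := scatSymbol_mul hq ξ
    have h2 := scatSymbol_mul hq (-ξ)
    have h3 := denom_ne_zero hq' ξ
    have h4 := denom_ne_zero hq' (-ξ)
    apply mul_left_cancel₀ (mul_ne_zero h3 h4)
    push_cast at h2 h4 ⊢
    linear_combination ((q : ℂ) + 2 * Real.pi * (-ξ) * Complex.I) * scatSymbol q (-ξ) * h1 +
      (2 * Real.pi * ξ * Complex.I - q) * h2

lemma memLp_top_scatSymbol {q : ℝ} (hq : 0 ≤ q) : MemLp (scatSymbol q) ∞ volume :=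
  memLp_top_one.sub ((memLp_top_fourier_expKernel hq).const_mul 2)

/-- The unitary operator with symbol `(2πiξ - q) / (2πiξ + q)`. -/
def scat (q : ℝ) : L2 →L[ℂ] L2 := fourMul (scatSymbol q)

lemma fourMul_sub {m n : ℝ → ℂ} (hm : MemLp m ∞ volume) (hn : MemLp n ∞ volume) :
    fourMul (fun x => m x - n x) = fourMul m - fourMul n := by
  rw [fourMul, fourMul, fourMul, mulOp_sub hm hn, mul_sub, sub_mul]

lemma fourMul_const_mul {m : ℝ → ℂ} (c : ℂ) (hm : MemLp m ∞ volume) :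
    fourMul (fun x => c * m x) = c • fourMul m := by
  rw [fourMul, fourMul, mulOp_const_mul c hm, mul_smul_comm, smul_mul_assoc]

lemma scat_coeFn {q : ℝ} (hq : 0 ≤ q) (f : L2) :
    scat q f =ᵐ[volume] fun x => f x - 2 * ∫ y, expKernel q (x - y) * f y := by
  have hk := memLp_top_fourier_expKernel hq
  have h1 : scat q = 1 - (2 : ℂ) • fourMul (𝓕 (expKernel q)) := by
    rw [scat, ← fourMul_const_mul 2 hk, ← fourMul_one, ← fourMul_sub memLp_top_one (hk.const_mul 2)]
    rfl
  rw [h1]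
  filter_upwards [fourMul_fourier_of_memLp (integrable_expKernel hq) (memLp_two_expKernel hq) hk f,
    Lp.coeFn_sub f ((2 : ℂ) • fourMul (𝓕 (expKernel q)) f),
    Lp.coeFn_smul (2 : ℂ) (fourMul (𝓕 (expKernel q)) f)] with x h2 h3 h4
  rw [← h2, ← smul_eq_mul]
  exact h3.trans (by rw [Pi.sub_apply, h4, Pi.smul_apply])

/-- The self-adjoint involution `J R`. -/
def invol (q : ℝ) : L2 →L[ℂ] L2 := reflect * scat q

/-- The projection onto functions supported in `[0, ∞)`. -/
def posProj : L2 →L[ℂ] L2 := mulOp ((Ici (0 : ℝ)).indicator 1)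

lemma posProj_coeFn (f : L2) : posProj f =ᵐ[volume] (Ici (0 : ℝ)).indicator f :=
  mulOp_indicator_coeFn measurableSet_Ici f

lemma invol_eq {q : ℝ} (hq : 0 ≤ q) : invol q = fourMul (fun ξ => scatSymbol q (-ξ)) * reflect :=
  reflect_fourMul (memLp_top_scatSymbol hq)

lemma invol_mul_invol {q : ℝ} (hq : 0 ≤ q) : invol q * invol q = 1 := by
  nth_rewrite 1 [invol_eq hq]
  have h1 : (fun ξ => scatSymbol q (-ξ) * scatSymbol q ξ) = fun _ => 1 := by
    funext ξ
    exact scatSymbol_neg_mul hq ξ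
  have hs := memLp_top_scatSymbol hq
  rw [invol, mul_assoc, ← mul_assoc reflect, reflect_mul_reflect, one_mul, scat,
    ← fourMul_mul (memLp_top_comp_neg hs) hs (h1 ▸ memLp_top_one), h1, fourMul_one]

lemma star_invol {q : ℝ} (hq : 0 ≤ q) : star (invol q) = invol q := by
  nth_rewrite 1 [invol_eq hq]
  have hs := memLp_top_scatSymbol hq
  rw [star_mul, star_reflect, star_fourMul (memLp_top_comp_neg hs), invol, scat]
  congr 2
  funext ξ
  rw [scatSymbol_conj hq, neg_neg]

lemma posProj_mul_posProj : posProj * posProj = posProj := by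
  have h1 : (fun x => (Ici (0 : ℝ)).indicator (1 : ℝ → ℂ) x * (Ici (0 : ℝ)).indicator 1 x) =
      (Ici (0 : ℝ)).indicator 1 := by
    funext x
    by_cases h : x ∈ Ici (0 : ℝ) <;> simp [indicator, h]
  have hm := memLp_top_indicator (measurableSet_Ici (a := (0 : ℝ)))
  have h2 := mulOp_mul hm hm (by rw [h1]; exact hm)
  rw [h1] at h2
  exact h2.symm

lemma star_posProj : star posProj = posProj := by
  rw [posProj, star_mulOp (memLp_top_indicator measurableSet_Ici)]
  congr 1
  funext x
  by_cases h : x ∈ Ici (0 : ℝ) <;> simp [indicator, h]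

lemma ae_ne_zero : ∀ᵐ x : ℝ, x ≠ 0 := by simp [ae_iff]

lemma one_sub_posProj_coeFn (f : L2) : (1 - posProj) f =ᵐ[volume] (Iio (0 : ℝ)).indicator f := by
  filter_upwards [Lp.coeFn_sub f (posProj f), posProj_coeFn f] with x h1 h2
  refine h1.trans ?_
  rw [Pi.sub_apply, h2]
  rcases lt_or_ge x 0 with h | h
  · rw [indicator_of_notMem (by simpa using h), indicator_of_mem (by simpa using h), sub_zero]
  · rw [indicator_of_mem (by simpa using h), indicator_of_notMem (by simpa using h), sub_self]

lemma reflect_mul_posProj : reflect * posProj = (1 - posProj) * reflect := by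
  ext1 f
  apply Lp.ext
  change reflect (posProj f) =ᵐ[volume] (1 - posProj) (reflect f)
  filter_upwards [reflect_coeFn (posProj f), ae_neg (posProj_coeFn f), reflect_coeFn f,
    one_sub_posProj_coeFn (reflect f), ae_ne_zero] with x h1 h2 h3 h4 h5
  rw [h1, h2, h4]
  rcases lt_or_gt_of_ne h5 with h | h
  · rw [indicator_of_mem (by simpa using h.le), indicator_of_mem (by simpa using h), h3]
  · rw [indicator_of_notMem (by simpa using h), indicator_of_notMem (by simpa using h.le)]

lemma invol_coeFn {q : ℝ} (hq : 0 ≤ q) (f : L2) :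
    invol q f =ᵐ[volume] fun x => f (-x) - 2 * ∫ y, expKernel q (-x - y) * f y := by
  filter_upwards [reflect_coeFn (scat q f), ae_neg (scat_coeFn hq f)] with x h1 h2
  exact h1.trans h2

/-- The kernel lives on `(0, ∞)`, so `scat` keeps supports inside `[0, ∞)`, and the reflection moves
them to the other half-line. -/
lemma posProj_invol_posProj {q : ℝ} (hq : 0 ≤ q) : posProj * invol q * posProj = 0 := by
  ext1 f
  apply Lp.ext
  change posProj (invol q (posProj f)) =ᵐ[volume] (0 : L2)
  filter_upwards [posProj_coeFn (invol q (posProj f)), invol_coeFn hq (posProj f),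
    ae_neg (posProj_coeFn f), ae_ne_zero, Lp.coeFn_zero ℂ 2 (volume : Measure ℝ)]
    with x h1 h2 h3 h4 h5
  rw [h1, h5]
  by_cases h : x ∈ Ici (0 : ℝ)
  · have hx : 0 < x := lt_of_le_of_ne h h4.symm
    rw [indicator_of_mem h, h2, h3, indicator_of_notMem (by simpa using hx), zero_sub,
      integral_eq_zero_of_ae, mul_zero, neg_zero, Pi.zero_apply]
    filter_upwards [posProj_coeFn f] with y hy
    rw [hy]
    by_cases h6 : 0 ≤ y
    · rw [expKernel, indicator_of_notMem (by simp only [mem_Ioi, not_lt]; linarith), zero_mul]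
      rfl
    · rw [indicator_of_notMem (s := Ici 0) (by simpa using h6), mul_zero]
      rfl
  · rw [indicator_of_notMem h]
    rfl

/-- For `x, y < 0` the cutoff in `expKernel q (-x - y)` is inactive and the exponential factors into
`e^{qx} e^{qy}`, while the term `f(-x)` drops out. The block therefore has rank at most one. -/
lemma negProj_invol_negProj_coeFn {q : ℝ} (hq : 0 ≤ q) (f : L2) :
    ((1 - posProj) * invol q * (1 - posProj)) f =ᵐ[volume] fun x => (Iio (0 : ℝ)).indicator
      (fun x : ℝ => -(2 * q) * Complex.exp (q * x) *
        ∫ y, (Iio (0 : ℝ)).indicator (fun y => Complex.exp (q * y) * f y) y) x := by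
  change (1 - posProj) (invol q ((1 - posProj) f)) =ᵐ[volume] _
  filter_upwards [one_sub_posProj_coeFn (invol q ((1 - posProj) f)),
    invol_coeFn hq ((1 - posProj) f), ae_neg (one_sub_posProj_coeFn f)] with x h1 h2 h3
  rw [h1]
  by_cases h : x ∈ Iio (0 : ℝ)
  · rw [indicator_of_mem h, indicator_of_mem h, h2, h3,
      indicator_of_notMem (by simpa using (mem_Iio.1 h).le), zero_sub, ← integral_const_mul,
      ← integral_const_mul, ← integral_neg]
    refine integral_congr_ae ?_
    filter_upwards [one_sub_posProj_coeFn f] with y hy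
    rw [hy]
    by_cases h6 : y < 0
    · rw [indicator_of_mem (s := Iio 0) h6, indicator_of_mem (s := Iio 0) h6, expKernel,
        indicator_of_mem (by simp only [mem_Ioi, mem_Iio] at h ⊢; linarith)]
      have : Complex.exp (-(q : ℂ) * ((-x - y : ℝ) : ℂ)) =
          Complex.exp (q * x) * Complex.exp (q * y) := by
        rw [← Complex.exp_add]
        congr 1
        push_cast
        ring
      rw [this]
      ring
    · rw [indicator_of_notMem (s := Iio 0) h6, indicator_of_notMem (s := Iio 0) h6]
      simp
  · rw [indicator_of_notMem h, indicator_of_notMem h]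

/-- For `q > 0` the rank-one block acts on its range as `-2q ∫_{-∞}^0 e^{2qy} dy = -1`; for `q = 0`
it is zero. -/
lemma negProj_invol_negProj_sq {q : ℝ} (hq : 0 ≤ q) :
    ((1 - posProj) * invol q * (1 - posProj)) * ((1 - posProj) * invol q * (1 - posProj)) =
      -((1 - posProj) * invol q * (1 - posProj)) := by
  set D := (1 - posProj) * invol q * (1 - posProj) with hD
  ext1 f
  apply Lp.ext
  change D (D f) =ᵐ[volume] ((-(D f) : L2) : ℝ → ℂ)
  filter_upwards [negProj_invol_negProj_coeFn hq f, negProj_invol_negProj_coeFn hq (D f),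
    Lp.coeFn_neg (D f)] with x h1 h2 h3
  rw [h3, Pi.neg_apply, h1, h2]
  by_cases h : x ∈ Iio (0 : ℝ)
  · rw [indicator_of_mem h, indicator_of_mem h]
    rcases hq.eq_or_lt with rfl | hq'
    · simp
    · set c := ∫ y, (Iio (0 : ℝ)).indicator (fun y => Complex.exp (q * y) * f y) y
      have h4 : ∫ y, (Iio (0 : ℝ)).indicator (fun y : ℝ => Complex.exp (q * y) * D f y) y =
          ∫ y, (Iio (0 : ℝ)).indicator (fun y : ℝ => -(2 * q) * c * Complex.exp (2 * q * y)) y := by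
        refine integral_congr_ae ?_
        filter_upwards [negProj_invol_negProj_coeFn hq f] with y hy
        by_cases h6 : y ∈ Iio (0 : ℝ)
        · rw [indicator_of_mem h6, indicator_of_mem h6, hy, indicator_of_mem h6]
          have : Complex.exp (2 * q * y) = Complex.exp (q * y) * Complex.exp (q * y) := by
            rw [← Complex.exp_add]
            ring_nf
          rw [this]
          ring
        · rw [indicator_of_notMem h6, indicator_of_notMem h6]
      have hq0 : (q : ℂ) ≠ 0 := by exact_mod_cast hq'.ne'
      rw [h4, integral_indicator measurableSet_Iio, integral_const_mul, ← integral_Iic_eq_integral_Iio,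
        integral_exp_mul_complex_Iic (by simpa using hq')]
      simp only [Complex.ofReal_zero, mul_zero, Complex.exp_zero]
      field_simp
  · rw [indicator_of_notMem h, indicator_of_notMem h, neg_zero]

lemma halfLineRelations {q : ℝ} (hq : 0 ≤ q) : HalfLineRelations reflect (invol q) posProj where
  JJ := reflect_mul_reflect
  KK := invol_mul_invol hq
  PP := posProj_mul_posProj
  JP := reflect_mul_posProj
  PKP := posProj_invol_posProj hq
  DD := negProj_invol_negProj_sq hq
  star_J := star_reflect
  star_K := star_invol hq
  star_P := star_posProj

/-! ### The free group -/

/-- The symbol of the free Schrödinger group. -/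
def freeSymbol (t ξ : ℝ) : ℂ := Complex.exp (-(2 * Real.pi ^ 2 * t * ξ ^ 2 : ℝ) * Complex.I)

lemma norm_freeSymbol (t ξ : ℝ) : ‖freeSymbol t ξ‖ = 1 := by
  rw [freeSymbol, ← Complex.ofReal_neg, Complex.norm_exp_ofReal_mul_I]

lemma memLp_top_of_continuous {m : ℝ → ℂ} (hm : Continuous m) (C : ℝ) (hC : ∀ x, ‖m x‖ ≤ C) :
    MemLp m ∞ (volume : Measure ℝ) :=
  memLp_top_of_bound hm.aestronglyMeasurable C (Eventually.of_forall hC)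

lemma continuous_freeSymbol (t : ℝ) : Continuous (freeSymbol t) := by
  unfold freeSymbol
  fun_prop

lemma memLp_top_freeSymbol (t : ℝ) : MemLp (freeSymbol t) ∞ volume :=
  memLp_top_of_continuous (continuous_freeSymbol t) 1 fun x => (norm_freeSymbol t x).le

/-- The free Schrödinger group. -/
def freeGroup (t : ℝ) : L2 →L[ℂ] L2 := fourMul (freeSymbol t)

lemma freeSymbol_add (s t : ℝ) : freeSymbol (s + t) = fun ξ => freeSymbol s ξ * freeSymbol t ξ := by
  funext ξ
  rw [freeSymbol, freeSymbol, freeSymbol, ← Complex.exp_add]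
  congr 1
  push_cast
  ring

lemma freeGroup_add (s t : ℝ) : freeGroup (s + t) = freeGroup s * freeGroup t := by
  have h := memLp_top_freeSymbol (s + t)
  rw [freeSymbol_add] at h
  rw [freeGroup, freeSymbol_add, fourMul_mul (memLp_top_freeSymbol s) (memLp_top_freeSymbol t) h]
  rfl

lemma freeGroup_zero : freeGroup 0 = 1 := by
  rw [freeGroup, ← fourMul_one]
  congr 1
  funext ξ
  simp [freeSymbol]

lemma star_freeGroup (t : ℝ) : star (freeGroup t) = freeGroup (-t) := by
  rw [freeGroup, freeGroup, star_fourMul (memLp_top_freeSymbol t)]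
  congr 1
  funext ξ
  rw [freeSymbol, freeSymbol, ← Complex.exp_conj]
  congr 1
  simp [map_ofNat]

lemma freeGroup_tendsto (t : ℝ) (f : L2) :
    Tendsto (fun s => freeGroup s f) (𝓝 t) (𝓝 (freeGroup t f)) := by
  refine fourMul_tendsto memLp_top_freeSymbol (memLp_top_freeSymbol t) 1
    (Eventually.of_forall fun s x => (norm_freeSymbol s x).le) (fun x => (norm_freeSymbol t x).le)
    (fun x => ?_) f
  have : Continuous fun s => freeSymbol s x := by
    unfold freeSymbol
    fun_prop
  exact this.tendsto t

lemma reflect_commute_fourMul {m : ℝ → ℂ} (hm : MemLp m ∞ volume) (he : ∀ x, m (-x) = m x) :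
    Commute reflect (fourMul m) := by
  rw [commute_iff_eq, reflect_fourMul hm]
  simp only [he]

lemma memLp_top_mul {m n : ℝ → ℂ} (hm : MemLp m ∞ (volume : Measure ℝ)) (hn : MemLp n ∞ volume) :
    MemLp (fun x => m x * n x) ∞ (volume : Measure ℝ) :=
  hn.mul (p := ∞) (q := ∞) (r := ∞) hm

/-- Multipliers commute with one another, and those with even symbol also commute with the
reflection. -/
lemma invol_commute_fourMul {q : ℝ} (hq : 0 ≤ q) {m : ℝ → ℂ} (hm : MemLp m ∞ volume)
    (he : ∀ x, m (-x) = m x) : Commute (invol q) (fourMul m) :=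
  (reflect_commute_fourMul hm he).mul_left (fourMul_commute (memLp_top_scatSymbol hq) hm
    (memLp_top_mul (memLp_top_scatSymbol hq) hm))

lemma freeSymbol_neg (t ξ : ℝ) : freeSymbol t (-ξ) = freeSymbol t ξ := by
  rw [freeSymbol, freeSymbol, neg_sq]

end DeltaSchrodinger
end

noncomputable section

namespace DeltaSchrodinger

open scoped FourierTransform SchwartzMap ComplexConjugate

/-! ### The free kernel -/

/-- The parameter of the Gaussian whose Fourier transform is `exp(-2π²(ε + it)ξ²)`. -/
def gaussParam (ε t : ℝ) : ℂ := 1 / (2 * Real.pi * (ε + t * Complex.I))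

/-- The Gaussian whose Fourier transform is `exp(-2π²(ε + it)ξ²)`. -/
def regKernel (ε t x : ℝ) : ℂ :=
  gaussParam ε t ^ (1 / 2 : ℂ) * Complex.exp (-Real.pi * gaussParam ε t * x ^ 2)

lemma gaussParam_re (ε t : ℝ) : (gaussParam ε t).re = ε / (2 * Real.pi * (ε ^ 2 + t ^ 2)) := by
  have : gaussParam ε t = ((1 / (2 * Real.pi) : ℝ) : ℂ) * (ε + t * Complex.I)⁻¹ := by
    rw [gaussParam, one_div, mul_inv]
    push_cast
    rw [one_div]
  rw [this, Complex.re_ofReal_mul, Complex.inv_re]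
  simp only [Complex.add_re, Complex.ofReal_re, Complex.mul_re, Complex.I_re, mul_zero,
    Complex.ofReal_im, Complex.I_im, mul_one, sub_self, add_zero, Complex.normSq_apply,
    Complex.add_im, Complex.mul_im, zero_add]
  rw [div_mul_div_comm, one_mul, pow_two, pow_two]

lemma gaussParam_re_pos {ε t : ℝ} (hε : 0 < ε) : 0 < (gaussParam ε t).re := by
  rw [gaussParam_re]
  positivity

lemma integrable_regKernel {ε : ℝ} (hε : 0 < ε) (t : ℝ) : Integrable (regKernel ε t) := by
  have := (integrable_cexp_neg_mul_sq (b := Real.pi * gaussParam ε t)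
    (by rw [Complex.re_ofReal_mul]; exact mul_pos Real.pi_pos (gaussParam_re_pos hε))).const_mul
    (gaussParam ε t ^ (1 / 2 : ℂ))
  refine this.congr (Eventually.of_forall fun x => ?_)
  simp only [regKernel, neg_mul]

lemma fourier_regKernel {ε : ℝ} (hε : 0 < ε) (t : ℝ) :
    𝓕 (regKernel ε t) = fun ξ : ℝ => Complex.exp (-(2 * Real.pi ^ 2 * (ε + t * Complex.I)) * ξ ^ 2) := by
  have hb := gaussParam_re_pos (t := t) hε
  have hb0 : gaussParam ε t ≠ 0 := fun h => by rw [h] at hb; exact lt_irrefl _ hb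
  have hε0 : (ε : ℂ) + t * Complex.I ≠ 0 := fun h => by
    rw [gaussParam, h, mul_zero, div_zero] at hb0
    exact hb0 rfl
  have hpi : (Real.pi : ℂ) ≠ 0 := by exact_mod_cast Real.pi_ne_zero
  have h1 := fourier_gaussian_pi hb
  funext ξ
  have h2 : 𝓕 (regKernel ε t) ξ = gaussParam ε t ^ (1 / 2 : ℂ) *
      𝓕 (fun x : ℝ => Complex.exp (-Real.pi * gaussParam ε t * x ^ 2)) ξ := by
    rw [Real.fourier_real_eq, Real.fourier_real_eq, ← integral_const_mul]
    congr 1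
    funext x
    rw [regKernel, mul_smul_comm]
  rw [h2, h1]
  dsimp only
  rw [← mul_assoc, mul_one_div_cancel (by simp [Complex.cpow_eq_zero_iff, hb0]), one_mul]
  congr 2
  rw [gaussParam]
  field_simp

/-- The number `1 / (2πit)` has modulus `1 / (2πt)` and principal argument `-π/2`; halving the
argument produces the phase `e^{-iπ/4}`. -/
lemma gaussParam_zero_cpow {t : ℝ} (ht : 0 < t) :
    gaussParam 0 t ^ (1 / 2 : ℂ) = Complex.exp (-(Complex.I * Real.pi / 4)) /
      (Real.sqrt (2 * Real.pi) : ℂ) * ((t ^ (-(1 / 2) : ℝ) : ℝ) : ℂ) := by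
  have h2t : 0 < 2 * Real.pi * t := by positivity
  have hw : gaussParam 0 t =
      Complex.exp (((-Real.log (2 * Real.pi * t) : ℝ) : ℂ) + ((-(Real.pi / 2) : ℝ) : ℂ) * Complex.I) := by
    rw [Complex.exp_add, ← Complex.ofReal_exp, Real.exp_neg, Real.exp_log h2t,
      Complex.exp_mul_I, ← Complex.ofReal_cos, ← Complex.ofReal_sin, Real.cos_neg, Real.sin_neg,
      Real.cos_pi_div_two, Real.sin_pi_div_two, gaussParam]
    have hpi : (Real.pi : ℂ) ≠ 0 := by exact_mod_cast Real.pi_ne_zero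
    have ht0 : (t : ℂ) ≠ 0 := by exact_mod_cast ht.ne'
    push_cast
    field_simp
    linear_combination (t : ℂ) * Complex.I_sq
  have hlog : Complex.log (gaussParam 0 t) =
      ((-Real.log (2 * Real.pi * t) : ℝ) : ℂ) + ((-(Real.pi / 2) : ℝ) : ℂ) * Complex.I := by
    rw [hw]
    apply Complex.log_exp
    all_goals
      simp only [Complex.add_im, Complex.ofReal_im, Complex.mul_im, Complex.ofReal_re,
        Complex.I_im, Complex.I_re]
      linarith [Real.pi_pos]
  have h0 : gaussParam 0 t ≠ 0 := by rw [hw]; exact Complex.exp_ne_zero _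
  rw [Complex.cpow_def_of_ne_zero h0, hlog]
  have h3 : (((-Real.log (2 * Real.pi * t) : ℝ) : ℂ) + ((-(Real.pi / 2) : ℝ) : ℂ) * Complex.I) *
      (1 / 2) = ((Real.log (2 * Real.pi * t) * (-(1 / 2)) : ℝ) : ℂ) +
        -(Complex.I * Real.pi / 4) := by
    push_cast
    ring
  rw [h3, Complex.exp_add, ← Complex.ofReal_exp, ← Real.rpow_def_of_pos h2t,
    Real.mul_rpow (by positivity) ht.le, Real.rpow_neg (by positivity), ← Real.sqrt_eq_rpow]
  push_cast
  field_simp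

lemma regKernel_zero {t : ℝ} (ht : 0 < t) (x : ℝ) : regKernel 0 t x = freeKernel t x := by
  rw [regKernel, freeKernel, gaussParam_zero_cpow ht]
  congr 2
  rw [gaussParam]
  have hpi : (Real.pi : ℂ) ≠ 0 := by exact_mod_cast Real.pi_ne_zero
  have ht0 : (t : ℂ) ≠ 0 := by exact_mod_cast ht.ne'
  rw [Complex.ofReal_zero, zero_add]
  field_simp
  rw [Complex.I_sq]
  ring

lemma norm_exp_gaussParam_le {ε : ℝ} (hε : 0 ≤ ε) (t x : ℝ) :
    ‖Complex.exp (-Real.pi * gaussParam ε t * x ^ 2)‖ ≤ 1 := by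
  rw [Complex.norm_exp, Real.exp_le_one_iff]
  have : (-(Real.pi : ℂ) * gaussParam ε t * x ^ 2) =
      ((-(Real.pi * x ^ 2) : ℝ) : ℂ) * gaussParam ε t := by
    push_cast
    ring
  rw [this, Complex.re_ofReal_mul, gaussParam_re, neg_mul, neg_nonpos]
  positivity

lemma tendsto_gaussParam {t : ℝ} (ht : 0 < t) :
    Tendsto (fun n : ℕ => gaussParam (1 / ((n : ℝ) + 1)) t) atTop (𝓝 (gaussParam 0 t)) := by
  have h1 : Tendsto (fun ε : ℝ => gaussParam ε t) (𝓝 0) (𝓝 (gaussParam 0 t)) := by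
    have : ContinuousAt (fun ε : ℝ => gaussParam ε t) 0 := by
      unfold gaussParam
      refine ContinuousAt.div (by fun_prop) (by fun_prop) ?_
      simp [Real.pi_ne_zero, ht.ne']
    exact this
  exact h1.comp tendsto_one_div_add_atTop_nhds_zero_nat

/-- The limit lies on the negative imaginary axis, off the branch cut, so the square root is
continuous there. -/
lemma gaussParam_zero_mem_slitPlane {t : ℝ} (ht : 0 < t) : gaussParam 0 t ∈ Complex.slitPlane := by
  right
  have : gaussParam 0 t = ((-1 / (2 * Real.pi * t) : ℝ) : ℂ) * Complex.I := by
    rw [gaussParam]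
    have hpi : (Real.pi : ℂ) ≠ 0 := by exact_mod_cast Real.pi_ne_zero
    have ht0 : (t : ℂ) ≠ 0 := by exact_mod_cast ht.ne'
    push_cast
    rw [zero_add]
    field_simp
    rw [Complex.I_sq, neg_neg]
  rw [this, Complex.im_ofReal_mul, Complex.I_im, mul_one]
  have : 0 < 2 * Real.pi * t := by positivity
  exact (div_neg_of_neg_of_pos (by norm_num) this).ne

lemma tendsto_gaussParam_cpow {t : ℝ} (ht : 0 < t) :
    Tendsto (fun n : ℕ => gaussParam (1 / ((n : ℝ) + 1)) t ^ (1 / 2 : ℂ)) atTop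
      (𝓝 (gaussParam 0 t ^ (1 / 2 : ℂ))) :=
  (continuousAt_cpow_const (gaussParam_zero_mem_slitPlane ht)).tendsto.comp
    (tendsto_gaussParam ht)

/-- The free Schrödinger group on `L¹ ∩ L²` is given by the free kernel. -/
lemma freeGroup_eq_integral {t : ℝ} (ht : 0 < t) {f : L2} (hf : Integrable (f : ℝ → ℂ)) :
    freeGroup t f =ᵐ[volume] fun x => ∫ y, freeKernel t (x - y) * f y := by
  -- A sequence of regularisations: the symbols converge boundedly, giving an `L²` limit, while the
  -- kernels converge pointwise, giving the integral. `ae_eq_of_tendsto` identifies the two limits.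
  set ε : ℕ → ℝ := fun n => 1 / ((n : ℝ) + 1) with hεdef
  have hε : ∀ n, 0 < ε n := fun n => Nat.one_div_pos_of_nat
  have hε0 : Tendsto ε atTop (𝓝 0) := tendsto_one_div_add_atTop_nhds_zero_nat
  have hle : ∀ n ξ, ‖𝓕 (regKernel (ε n) t) ξ‖ ≤ 1 := fun n ξ => by
    rw [fourier_regKernel (hε n)]
    dsimp only
    rw [Complex.norm_exp, Real.exp_le_one_iff]
    have : (-(2 * (Real.pi : ℂ) ^ 2 * (ε n + t * Complex.I)) * ξ ^ 2) =
      ((-(2 * Real.pi ^ 2 * ξ ^ 2) : ℝ) : ℂ) * (ε n + t * Complex.I) := by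
      push_cast
      ring
    rw [this, Complex.re_ofReal_mul]
    have h0 := hε n
    simp only [Complex.add_re, Complex.ofReal_re, Complex.mul_re, Complex.I_re, mul_zero,
      Complex.ofReal_im, zero_mul, sub_self, add_zero, neg_mul, neg_nonpos]
    positivity
  have hm : ∀ n, MemLp (𝓕 (regKernel (ε n) t)) ∞ volume := fun n => by
    refine memLp_top_of_continuous ?_ 1 (hle n)
    rw [fourier_regKernel (hε n)]
    fun_prop
  have h1 : Tendsto (fun n => fourMul (𝓕 (regKernel (ε n) t)) f) atTop (𝓝 (freeGroup t f)) := by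
    refine fourMul_tendsto hm (memLp_top_freeSymbol t) 1
      (Eventually.of_forall hle) (fun ξ => (norm_freeSymbol t ξ).le) (fun ξ => ?_) f
    simp only [fun n => fourier_regKernel (hε n) t]
    have hc : Continuous fun e : ℝ =>
        Complex.exp (-(2 * Real.pi ^ 2 * (e + t * Complex.I)) * (ξ : ℂ) ^ 2) := by fun_prop
    have := (hc.tendsto 0).comp hε0
    convert! this using 2
    rw [freeSymbol]
    push_cast
    ring_nf
  refine ae_eq_of_tendsto h1 ?_
  filter_upwards [ae_all_iff.2 fun n => fourMul_fourier (integrable_regKernel (hε n) t) (hm n) hf]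
    with x hx
  simp only [hx]
  -- The Gaussian factor has modulus at most `1`, so the convergent, hence bounded, prefactors bound
  -- the kernels uniformly; then `C * ‖f‖` dominates.
  obtain ⟨C, hC⟩ := (tendsto_gaussParam_cpow ht).norm.bddAbove_range
  have hreg : ∀ n z, ‖regKernel (ε n) t z‖ ≤ C := fun n z => by
    rw [regKernel, norm_mul]
    exact (mul_le_of_le_one_right (norm_nonneg _) (norm_exp_gaussParam_le (hε n).le t z)).trans
      (hC ⟨n, rfl⟩)
  refine tendsto_integral_of_dominated_convergence (fun y => C * ‖f y‖) (fun n => ?_)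
    (hf.norm.const_mul C) (fun n => Eventually.of_forall fun y => ?_)
    (Eventually.of_forall fun y => ?_)
  · refine AEStronglyMeasurable.mul ?_ hf.1
    refine Continuous.aestronglyMeasurable ?_
    unfold regKernel
    fun_prop
  · rw [norm_mul]
    exact mul_le_mul_of_nonneg_right (hreg n _) (norm_nonneg _)
  · refine Tendsto.mul_const _ ?_
    rw [← regKernel_zero ht]
    refine (tendsto_gaussParam_cpow ht).mul ?_
    exact (Complex.continuous_exp.tendsto _).comp
      (((tendsto_gaussParam ht).const_mul _).mul_const _)

/-- The free Schrödinger group on `L²` is given by the free kernel. -/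
lemma isFreeKernelIntegral_freeGroup {t : ℝ} (ht : 0 < t) (f : L2) {g : ℝ → ℂ}
    (hg : g =ᵐ[volume] f) : IsFreeKernelIntegral t g (freeGroup t f) := by
  have h1 : Tendsto (fun r => freeGroup t (trunc r f)) atTop (𝓝 (freeGroup t f)) :=
    ((freeGroup t).continuous.tendsto f).comp (trunc_tendsto f)
  rw [Lp.tendsto_Lp_iff_tendsto_eLpNorm'] at h1
  refine h1.congr fun r => eLpNorm_congr_ae ?_
  filter_upwards [freeGroup_eq_integral ht (integrable_trunc r f)] with x hx
  rw [Pi.sub_apply, hx, ← integral_indicator measurableSet_Icc]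
  congr 1
  refine integral_congr_ae ?_
  filter_upwards [trunc_coeFn r f, hg] with y hy hy2
  rw [hy]
  by_cases h : y ∈ Icc (-r) r
  · rw [indicator_of_mem h, indicator_of_mem h, hy2]
  · rw [indicator_of_notMem h, indicator_of_notMem h, mul_zero]

end DeltaSchrodinger
end

noncomputable section

namespace DeltaSchrodinger

open scoped FourierTransform SchwartzMap ComplexConjugate

/-! ### Weak derivatives on the Fourier side -/

/-- `v` is the derivative of `u`, expressed through the Fourier transform. -/
def FourierDeriv (u v : L2) : Prop :=
  four v =ᵐ[volume] fun ξ => (2 * Real.pi * ξ * Complex.I : ℂ) * four u ξ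

lemma exists_schwartz_eq {g : ℝ → ℝ} (hg : ContDiff ℝ ∞ g) (hc : HasCompactSupport g) :
    ∃ G : 𝓢(ℝ, ℂ), ∀ x, G x = g x :=
  ⟨HasCompactSupport.toSchwartzMap (f := fun x => (g x : ℂ))
    (hc.comp_left (g := Complex.ofReal) rfl) (Complex.ofRealCLM.contDiff.comp hg), fun _ => rfl⟩

lemma schwartz_fourierInv_deriv {G G' : 𝓢(ℝ, ℂ)} (h : deriv (G : ℝ → ℂ) = G') (ξ : ℝ) :
    (𝓕⁻ G') ξ = -(2 * Real.pi * ξ * Complex.I) * (𝓕⁻ G) ξ := by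
  have h1 := Real.fourier_deriv G.integrable G.differentiable (by rw [h]; exact G'.integrable)
  rw [h] at h1
  rw [SchwartzMap.fourierInv_coe, SchwartzMap.fourierInv_coe, Real.fourierInv_eq_fourier_neg,
    Real.fourierInv_eq_fourier_neg, h1]
  simp only [smul_eq_mul]
  push_cast
  ring

lemma integral_schwartz_mul_eq_fourierInv (G : 𝓢(ℝ, ℂ)) (u : L2) :
    ∫ x, G x * u x = ∫ ξ, (𝓕⁻ G) ξ * four u ξ := by
  rw [integral_schwartz_mul_four, FourierTransform.fourier_fourierInv_eq]

/-- Both integrals move to the Fourier side, where differentiating the test function multiplies its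
inverse transform by `-2πiξ`, the opposite of the factor relating `v` to `u`. -/
lemma FourierDeriv.isWeakDerivOn {u v : L2} (h : FourierDeriv u v) (Ω : Set ℝ) :
    IsWeakDerivOn Ω u v := by
  intro g hg hc _
  obtain ⟨G, hG⟩ := exists_schwartz_eq hg hc
  obtain ⟨G', hG'⟩ := exists_schwartz_eq (ContDiff.deriv' hg) hc.deriv
  have hder : deriv (G : ℝ → ℂ) = G' := by
    funext x
    have h1 : HasDerivAt g (deriv g x) x := (hg.differentiable (by simp) x).hasDerivAt
    rw [show (G : ℝ → ℂ) = fun x => (g x : ℂ) from funext hG, hG']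
    exact h1.ofReal_comp.deriv
  have e1 : ∫ x, deriv g x • u x = ∫ x, G' x * u x := by
    simp only [hG', Complex.real_smul]
  have e2 : ∫ x, g x • v x = ∫ x, G x * v x := by
    simp only [hG, Complex.real_smul]
  rw [e1, e2, integral_schwartz_mul_eq_fourierInv G', integral_schwartz_mul_eq_fourierInv G,
    ← integral_neg]
  refine integral_congr_ae ?_
  filter_upwards [h] with ξ hξ
  rw [hξ, schwartz_fourierInv_deriv hder]
  ring

/-! ### The generator of the free group -/

lemma freeSymbol_slope_norm_le (t ξ : ℝ) :
    ‖((t⁻¹ : ℝ) : ℂ) * (freeSymbol t ξ - 1)‖ ≤ 2 * Real.pi ^ 2 * ξ ^ 2 := by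
  -- At `t = 0` the left side is zero by the convention `0⁻¹ = 0`.
  rcases eq_or_ne t 0 with rfl | ht
  · simp
    positivity
  · rw [norm_mul, freeSymbol, mul_comm _ Complex.I, ← Complex.ofReal_neg]
    have h1 := Real.norm_exp_I_mul_ofReal_sub_one_le (x := -(2 * Real.pi ^ 2 * t * ξ ^ 2))
    calc _ ≤ ‖((t⁻¹ : ℝ) : ℂ)‖ * ‖-(2 * Real.pi ^ 2 * t * ξ ^ 2)‖ :=
          mul_le_mul_of_nonneg_left h1 (norm_nonneg _)
      _ = 2 * Real.pi ^ 2 * ξ ^ 2 := by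
          rw [Complex.norm_real, ← norm_mul, neg_eq_neg_one_mul, mul_left_comm, norm_mul, norm_neg,
            norm_one, one_mul]
          have : t⁻¹ * (2 * Real.pi ^ 2 * t * ξ ^ 2) = 2 * Real.pi ^ 2 * ξ ^ 2 := by field_simp
          rw [this, Real.norm_of_nonneg (by positivity)]

lemma freeSymbol_slope_tendsto (ξ : ℝ) :
    Tendsto (fun t : ℝ => ((t⁻¹ : ℝ) : ℂ) * (freeSymbol t ξ - 1)) (𝓝[≠] 0)
      (𝓝 (-(2 * Real.pi ^ 2 * ξ ^ 2) * Complex.I)) := by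
  have h1 : HasDerivAt (fun t : ℝ => freeSymbol t ξ) (-(2 * Real.pi ^ 2 * ξ ^ 2) * Complex.I) 0 := by
    have h2 : HasDerivAt (fun t : ℝ => (t : ℂ) * (-(2 * Real.pi ^ 2 * ξ ^ 2) * Complex.I))
        (1 * (-(2 * Real.pi ^ 2 * ξ ^ 2) * Complex.I)) 0 :=
      (hasDerivAt_id (0 : ℝ)).ofReal_comp.mul_const _
    have h3 := h2.cexp
    simp only [Complex.ofReal_zero, zero_mul, Complex.exp_zero, one_mul] at h3
    convert! h3 using 2 with t
    rw [freeSymbol]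
    congr 1
    push_cast
    ring
  have h2 := hasDerivAt_iff_tendsto_slope.1 h1
  refine h2.congr fun t => ?_
  rw [slope_def_module]
  simp [freeSymbol]

/-- `η` is the derivative at `t = 0` of `t ↦ U t ψ`, where `U 0 = 1`. -/
def HasGeneratorAt {E : Type*} [NormedAddCommGroup E] [InnerProductSpace ℂ E]
    (U : ℝ → E →L[ℂ] E) (ψ η : E) : Prop :=
  Tendsto (fun t : ℝ => ((t⁻¹ : ℝ) : ℂ) • (U t ψ - ψ)) (𝓝[≠] 0) (𝓝 η)

lemma hasDerivAt_iff_hasGeneratorAt {E : Type*} [NormedAddCommGroup E] [InnerProductSpace ℂ E]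
    {U : ℝ → E →L[ℂ] E} (h0 : U 0 = 1) (ψ η : E) :
    HasDerivAt (fun t => U t ψ) η 0 ↔ HasGeneratorAt U ψ η := by
  rw [hasDerivAt_iff_tendsto_slope, HasGeneratorAt]
  have : slope (fun t => U t ψ) 0 = fun t : ℝ => ((t⁻¹ : ℝ) : ℂ) • (U t ψ - ψ) := by
    funext t
    rw [slope_def_module, h0, sub_zero, one_apply_eq_self, Complex.coe_smul]
  rw [this]

/-- A derivative of the free group at `0` is multiplication by `-2π²iξ²` on the Fourier side. -/
lemma HasGeneratorAt.four_eq {g η : L2} (h : HasGeneratorAt freeGroup g η) :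
    four η =ᵐ[volume] fun ξ => (-(2 * Real.pi ^ 2 * ξ ^ 2) * Complex.I : ℂ) * four g ξ := by
  set τ : ℕ → ℝ := fun n => 1 / ((n : ℝ) + 1)
  have hτ : Tendsto τ atTop (𝓝[≠] 0) :=
    tendsto_nhdsWithin_iff.2 ⟨tendsto_one_div_add_atTop_nhds_zero_nat,
      Eventually.of_forall fun n => (Nat.one_div_pos_of_nat (α := ℝ)).ne'⟩
  have h2 := (four.continuous.tendsto η).comp (h.comp hτ)
  refine ae_eq_of_tendsto h2 ?_
  have h3 : ∀ n, four ((((τ n)⁻¹ : ℝ) : ℂ) • (freeGroup (τ n) g - g)) =ᵐ[volume]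
      fun ξ => (((τ n)⁻¹ : ℝ) : ℂ) * (freeSymbol (τ n) ξ - 1) * four g ξ := fun n => by
    rw [map_smul, map_sub]
    filter_upwards [Lp.coeFn_smul (((τ n)⁻¹ : ℝ) : ℂ) (four (freeGroup (τ n) g) - four g),
      Lp.coeFn_sub (four (freeGroup (τ n) g)) (four g),
      four_fourMul_coeFn (memLp_top_freeSymbol (τ n)) g] with ξ h5 h6 h7
    rw [h5, Pi.smul_apply, h6, Pi.sub_apply, freeGroup, h7, smul_eq_mul]
    ring
  filter_upwards [ae_all_iff.2 h3] with ξ hξ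
  simp only [Function.comp_apply, hξ]
  exact ((freeSymbol_slope_tendsto ξ).comp hτ).mul_const _

/-- An element of the domain of the free generator has two derivatives in `L²`. -/
lemma exists_fourierDeriv {g w : L2}
    (h : four w =ᵐ[volume] fun ξ => (-(4 * Real.pi ^ 2 * ξ ^ 2) : ℂ) * four g ξ) :
    ∃ v : L2, FourierDeriv g v ∧ FourierDeriv v w := by
  set m : ℝ → ℂ := fun ξ => 2 * Real.pi * ξ * Complex.I
  have hmem : MemLp (fun ξ => m ξ * four g ξ) 2 volume := by
    have hb : MemLp (fun ξ => ‖four g ξ‖ + ‖four w ξ‖) 2 volume :=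
      (Lp.memLp (four g)).norm.add (Lp.memLp (four w)).norm
    refine hb.mono ?_ ?_
    · exact (Continuous.aestronglyMeasurable (by fun_prop)).mul (Lp.aestronglyMeasurable _)
    · filter_upwards [h] with ξ hξ
      have h1 : ‖m ξ‖ = |2 * Real.pi * ξ| := by
        simp only [m]
        rw [norm_mul, Complex.norm_I, mul_one, ← Real.norm_eq_abs, ← Complex.norm_real]
        push_cast
        rfl
      have h2 : ‖(-(4 * Real.pi ^ 2 * ξ ^ 2) : ℂ)‖ = |2 * Real.pi * ξ| ^ 2 := by
        rw [norm_neg, sq_abs]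
        have : (4 * Real.pi ^ 2 * ξ ^ 2 : ℂ) = (((2 * Real.pi * ξ) ^ 2 : ℝ) : ℂ) := by
          push_cast
          ring
        rw [this, Complex.norm_real, Real.norm_of_nonneg (by positivity)]
      have h3 := norm_nonneg (four g ξ)
      have h4 : ‖m ξ * four g ξ‖ = |2 * Real.pi * ξ| * ‖four g ξ‖ := by rw [norm_mul, h1]
      have h5 : ‖four w ξ‖ = |2 * Real.pi * ξ| ^ 2 * ‖four g ξ‖ := by rw [hξ, norm_mul, h2]
      refine h4.trans_le ?_
      rw [Real.norm_of_nonneg (by positivity), h5]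
      -- This is `s ≤ 1 + s²` with `s = |2πξ|`: control of `ĝ` and `ξ² ĝ` gives control of `ξ ĝ`.
      nlinarith [sq_nonneg (|2 * Real.pi * ξ| - 1)]
  refine ⟨four.symm hmem.toLp, ?_, ?_⟩
  · rw [FourierDeriv, LinearIsometryEquiv.apply_symm_apply]
    exact hmem.coeFn_toLp
  · rw [FourierDeriv, LinearIsometryEquiv.apply_symm_apply]
    filter_upwards [h, hmem.coeFn_toLp] with ξ h1 h2
    rw [h1, h2]
    simp only [m]
    linear_combination (-(4 * Real.pi ^ 2 * ξ ^ 2) * four g ξ) * Complex.I_sq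

/-- The symbol of the free resolvent at `-1/2`. -/
def resolventSymbol (ξ : ℝ) : ℂ := ((2 * Real.pi ^ 2 * ξ ^ 2 + 1 / 2 : ℝ)⁻¹ : ℝ)

lemma continuous_resolventSymbol : Continuous resolventSymbol := by
  unfold resolventSymbol
  refine Complex.continuous_ofReal.comp (Continuous.inv₀ (by fun_prop) fun ξ => ?_)
  positivity

lemma norm_resolventSymbol_le (ξ : ℝ) : ‖resolventSymbol ξ‖ ≤ 2 := by
  rw [resolventSymbol, Complex.norm_real, Real.norm_of_nonneg (by positivity)]
  refine inv_le_of_inv_le₀ (by norm_num) ?_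
  have : 0 ≤ 2 * Real.pi ^ 2 * ξ ^ 2 := by positivity
  linarith

lemma memLp_top_resolventSymbol : MemLp resolventSymbol ∞ volume :=
  memLp_top_of_continuous continuous_resolventSymbol 2 norm_resolventSymbol_le

lemma resolventSymbol_mul (ξ : ℝ) :
    (2 * Real.pi ^ 2 * ξ ^ 2 : ℂ) * resolventSymbol ξ = 1 - 1 / 2 * resolventSymbol ξ := by
  have h : (2 * Real.pi ^ 2 * ξ ^ 2 + 1 / 2 : ℝ) ≠ 0 := by positivity
  have h1 : (2 * Real.pi ^ 2 * ξ ^ 2 + 1 / 2 : ℝ) * (2 * Real.pi ^ 2 * ξ ^ 2 + 1 / 2 : ℝ)⁻¹ = 1 :=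
    mul_inv_cancel₀ h
  have h2 := congrArg Complex.ofReal h1
  rw [Complex.ofReal_mul] at h2
  rw [resolventSymbol]
  push_cast at h2 ⊢
  linear_combination h2

/-- The range of the free resolvent lies in the domain of the free generator. -/
lemma hasGeneratorAt_freeGroup_resolvent (f : L2) :
    HasGeneratorAt freeGroup (fourMul resolventSymbol f)
      ((-Complex.I) • (f - (1 / 2 : ℂ) • fourMul resolventSymbol f)) := by
  rw [HasGeneratorAt]
  have hr := memLp_top_resolventSymbol
  -- The symbol of the difference quotient composed with the resolvent. It stays bounded by `1`
  -- because `2π²ξ²` times the resolvent symbol does, although the quotient alone has no bound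
  -- uniform in `ξ` and `t`.
  set μ : ℝ → ℝ → ℂ := fun t ξ => ((t⁻¹ : ℝ) : ℂ) * ((freeSymbol t ξ - 1) * resolventSymbol ξ)
  have hf : ∀ t, MemLp (fun ξ => freeSymbol t ξ - 1) ∞ volume :=
    fun t => (memLp_top_freeSymbol t).sub memLp_top_one
  have hμ0 : ∀ t, MemLp (fun ξ => (freeSymbol t ξ - 1) * resolventSymbol ξ) ∞ volume :=
    fun t => memLp_top_mul (hf t) hr
  have hμ : ∀ t, MemLp (μ t) ∞ volume := fun t => (hμ0 t).const_mul _
  have h2 : ∀ t : ℝ, ((t⁻¹ : ℝ) : ℂ) • (freeGroup t (fourMul resolventSymbol f) -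
      fourMul resolventSymbol f) = fourMul (μ t) f := fun t => by
    have e1 : fourMul (μ t) = ((t⁻¹ : ℝ) : ℂ) • ((freeGroup t - 1) * fourMul resolventSymbol) := by
      have e2 := fourMul_mul (hf t) hr (hμ0 t)
      have e3 := fourMul_sub (memLp_top_freeSymbol t) memLp_top_one
      rw [fourMul_one] at e3
      change fourMul (fun ξ => _ * ((freeSymbol t ξ - 1) * resolventSymbol ξ)) = _
      rw [fourMul_const_mul _ (hμ0 t)]
      congr 1
      exact e2.trans (by rw [freeGroup, ← e3])
    rw [e1]
    rfl
  set n : ℝ → ℂ := fun ξ => (-Complex.I) * (1 - 1 / 2 * resolventSymbol ξ)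
  have hn0 : MemLp (fun ξ => 1 - 1 / 2 * resolventSymbol ξ) ∞ volume :=
    memLp_top_one.sub (hr.const_mul (1 / 2))
  have h3 : fourMul n f = (-Complex.I) • (f - (1 / 2 : ℂ) • fourMul resolventSymbol f) := by
    have : fourMul n = (-Complex.I) • (1 - (1 / 2 : ℂ) • fourMul resolventSymbol) := by
      rw [← fourMul_one, ← fourMul_const_mul _ hr, ← fourMul_sub memLp_top_one (hr.const_mul _),
        ← fourMul_const_mul _ hn0]
    rw [this]
    rfl
  rw [← h3]
  have hmul : ∀ ξ, (2 * Real.pi ^ 2 * ξ ^ 2 : ℝ) * ‖resolventSymbol ξ‖ ≤ 1 := fun ξ => by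
    rw [resolventSymbol, Complex.norm_real, Real.norm_of_nonneg (by positivity), mul_inv_le_iff₀ (by positivity)]
    linarith
  have hslope : ∀ t ξ, ‖μ t ξ‖ ≤ 1 := fun t ξ => by
    simp only [μ]
    rw [← mul_assoc, norm_mul]
    exact (mul_le_mul_of_nonneg_right (freeSymbol_slope_norm_le t ξ) (norm_nonneg _)).trans (hmul ξ)
  have hlim : ∀ ξ, Tendsto (fun t => μ t ξ) (𝓝[≠] 0) (𝓝 (n ξ)) := fun ξ => by
    have := (freeSymbol_slope_tendsto ξ).mul_const (resolventSymbol ξ)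
    have e : -(2 * Real.pi ^ 2 * ξ ^ 2) * Complex.I * resolventSymbol ξ = n ξ := by
      simp only [n]
      rw [← resolventSymbol_mul]
      ring
    rw [e] at this
    refine this.congr fun t => ?_
    simp only [μ]
    ring
  refine (fourMul_tendsto hμ (hn0.const_mul _) 1 (Eventually.of_forall hslope) (fun ξ => ?_)
    hlim f).congr fun t => (h2 t).symm
  exact le_of_tendsto (hlim ξ).norm (Eventually.of_forall fun t => hslope t ξ)

end DeltaSchrodinger
end

noncomputable section

namespace DeltaSchrodinger

/-! ### Primitives and weak derivatives -/

lemma intervalIntegrable_of_locallyIntegrable {w : ℝ → ℂ} (hw : LocallyIntegrable w) (a b : ℝ) :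
    IntervalIntegrable w volume a b :=
  intervalIntegrable_iff.2 ((hw.integrableOn_isCompact isCompact_uIcc).mono_set uIoc_subset_uIcc)

lemma continuous_primitive {w : ℝ → ℂ} (hw : LocallyIntegrable w) :
    Continuous fun x => ∫ y in (0 : ℝ)..x, w y :=
  intervalIntegral.continuous_primitive (intervalIntegrable_of_locallyIntegrable hw) 0

/-- Integration by parts against the primitive of a locally integrable function. -/
lemma integral_deriv_smul_primitive {w : ℝ → ℂ} (hw : LocallyIntegrable w) {g : ℝ → ℝ}
    (hg : ContDiff ℝ ∞ g) (hc : HasCompactSupport g) :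
    ∫ x, deriv g x • ∫ y in (0 : ℝ)..x, w y = -∫ x, g x • w x := by
  have hg1 : ContDiff ℝ 1 g := hg.of_le (by norm_num)
  have hd : Continuous (deriv g) := hg1.continuous_deriv le_rfl
  have hdi : Integrable (deriv g) := hd.integrable_of_hasCompactSupport hc.deriv
  obtain ⟨R, hR⟩ : ∃ R : ℝ, tsupport g ⊆ Ioo (-R) R := by
    obtain ⟨R, hR⟩ := hc.isCompact.isBounded.subset_ball 0
    refine ⟨R, fun x hx => ?_⟩
    have := hR hx
    rw [Real.ball_eq_Ioo] at this
    simpa using this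
  have hg0 : ∀ x, x ∉ Ioc (-R) R → g x = 0 := fun x hx =>
    image_eq_zero_of_notMem_tsupport fun h => hx (Ioo_subset_Ioc_self (hR h))
  have hd0 : ∀ x, x ∉ Ioc (-R) R → deriv g x = 0 := fun x hx =>
    image_eq_zero_of_notMem_tsupport fun h =>
      hx (Ioo_subset_Ioc_self (hR (tsupport_deriv_subset h)))
  set W : ℝ → ℂ := (Ioc (-R) R).indicator w with hW
  have hWi : Integrable W := by
    rw [hW, integrable_indicator_iff measurableSet_Ioc]
    exact (hw.integrableOn_isCompact isCompact_Icc).mono_set Ioc_subset_Icc_self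
  -- The integrand `1_{y < x} g'(x) W(y)`: integrating in `y` produces the primitive of `w`,
  -- integrating in `x` produces `-g(y) W(y)`, and Fubini equates the two.
  set F : ℝ → ℝ → ℂ := fun x y => (Ioi y).indicator (fun x => deriv g x • W y) x with hF
  have hFi : Integrable (Function.uncurry F) (volume.prod volume) := by
    have h1 : Integrable (fun p : ℝ × ℝ => deriv g p.1 • W p.2) (volume.prod volume) :=
      hdi.smul_prod hWi
    have h2 := h1.indicator (measurableSet_lt measurable_snd measurable_fst)
    refine h2.congr (Eventually.of_forall fun p => ?_)
    simp only [Function.uncurry, hF, indicator, mem_ofPred_eq, mem_Ioi]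
  have e1 : ∀ x, ∫ y, F x y = deriv g x • ∫ y in (-R)..x, w y := fun x => by
    by_cases hx : x ∈ Ioc (-R) R
    · rw [intervalIntegral.integral_of_le hx.1.le, integral_Ioc_eq_integral_Ioo, ← integral_smul,
        ← integral_indicator measurableSet_Ioo]
      congr 1
      funext y
      simp only [hF, hW, indicator, mem_Ioi, mem_Ioo, mem_Ioc]
      by_cases h1 : -R < y <;> by_cases h2 : y < x <;> simp [h1, h2]
      intro h3
      exact absurd (h2.le.trans hx.2) (not_le.2 h3)
    · rw [hd0 x hx, zero_smul]
      refine integral_eq_zero_of_ae (Eventually.of_forall fun y => ?_)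
      simp [hF, indicator, hd0 x hx]
  have e2 : ∀ y, ∫ x, F x y = -(g y • w y) := fun y => by
    rw [hF, integral_indicator measurableSet_Ioi, integral_smul_const,
      hc.integral_Ioi_deriv_eq hg1 y, neg_smul, hW]
    by_cases hy : y ∈ Ioc (-R) R
    · rw [indicator_of_mem hy]
    · rw [indicator_of_notMem hy, hg0 y hy, zero_smul, zero_smul]
  -- This allows the base point of the primitive to move from `-R` to `0`, the difference being a
  -- constant.
  have e3 : ∫ x, deriv g x = 0 := by
    have := hc.integral_Ioi_deriv_eq hg1 (-R)
    rw [hg0 (-R) (by simp), neg_zero] at this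
    rw [← this, ← integral_indicator measurableSet_Ioi]
    congr 1
    funext x
    by_cases hx : x ∈ Ioi (-R)
    · rw [indicator_of_mem hx]
    · rw [indicator_of_notMem hx, hd0 x fun h => hx h.1]
  have hswap := integral_integral_swap hFi
  simp only [e1, e2, integral_neg] at hswap
  rw [← hswap]
  obtain ⟨c, e4⟩ : ∃ c, ∀ x, ∫ y in (-R)..x, w y = c + ∫ y in (0 : ℝ)..x, w y :=
    ⟨∫ y in (-R)..0, w y, fun x => (intervalIntegral.integral_add_adjacent_intervals
      (intervalIntegrable_of_locallyIntegrable hw _ _)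
      (intervalIntegrable_of_locallyIntegrable hw _ _)).symm⟩
  simp only [e4, smul_add]
  rw [integral_add (hdi.smul_const _), integral_smul_const, e3, zero_smul, zero_add]
  exact (continuous_primitive hw).locallyIntegrable.integrable_smul_left_of_hasCompactSupport hd
    hc.deriv

lemma exists_Icc_of_isCompact {Ω K : Set ℝ} (hΩ : Ω.OrdConnected) (hne : Ω.Nonempty)
    (hK : IsCompact K) (h : K ⊆ Ω) : ∃ a b, K ⊆ Icc a b ∧ Icc a b ⊆ Ω := by
  obtain ⟨x₀, hx₀⟩ := hne
  -- The compact set may be empty; adding a point of `Ω` makes its infimum and supremum meaningful.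
  set K' := insert x₀ K
  have hK' : IsCompact K' := hK.insert x₀
  have hn : K'.Nonempty := ⟨x₀, mem_insert _ _⟩
  have hs : K' ⊆ Ω := insert_subset hx₀ h
  refine ⟨sInf K', sSup K', fun x hx => ?_, hΩ.out (hs (hK'.sInf_mem hn)) (hs (hK'.sSup_mem hn))⟩
  exact ⟨csInf_le hK'.bddBelow (mem_insert_of_mem _ hx),
    le_csSup hK'.bddAbove (mem_insert_of_mem _ hx)⟩

/-- A test function of integral zero is the derivative of a test function. -/
lemma exists_test_primitive {Ω : Set ℝ} (hΩ : Ω.OrdConnected) (hne : Ω.Nonempty) {ψ : ℝ → ℝ}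
    (hψ : ContDiff ℝ ∞ ψ) (hc : HasCompactSupport ψ) (hs : tsupport ψ ⊆ Ω) (h0 : ∫ x, ψ x = 0) :
    ∃ G : ℝ → ℝ, ContDiff ℝ ∞ G ∧ HasCompactSupport G ∧ tsupport G ⊆ Ω ∧ deriv G = ψ := by
  obtain ⟨a, b, hab, habΩ⟩ := exists_Icc_of_isCompact hΩ hne hc.isCompact hs
  have hψ0 : ∀ x, x ∉ Icc a b → ψ x = 0 := fun x hx =>
    image_eq_zero_of_notMem_tsupport fun h => hx (hab h)
  have hi : Integrable ψ := hψ.continuous.integrable_of_hasCompactSupport hc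
  have hder : ∀ x, HasDerivAt (fun x => ∫ y in a..x, ψ y) (ψ x) x := fun x =>
    intervalIntegral.integral_hasDerivAt_right (hψ.continuous.intervalIntegrable _ _)
      (hψ.continuous.stronglyMeasurableAtFilter _ _) hψ.continuous.continuousAt
  have hd : deriv (fun x => ∫ y in a..x, ψ y) = ψ := funext fun x => (hder x).deriv
  have hG0 : ∀ x, x ∉ Icc a b → ∫ y in a..x, ψ y = 0 := fun x hx => by
    rcases lt_or_ge x a with h | h
    · rw [intervalIntegral.integral_symm, intervalIntegral.integral_of_le h.le,
        integral_Ioc_eq_integral_Ioo, setIntegral_eq_zero_of_forall_eq_zero, neg_zero]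
      exact fun y hy => hψ0 y fun h' => not_le.2 hy.2 h'.1
    · have hbx : b < x := by
        by_contra h'
        exact hx ⟨h, not_lt.1 h'⟩
      rw [intervalIntegral.integral_of_le h, ← integral_Icc_eq_integral_Ioc, ← h0,
        ← integral_indicator measurableSet_Icc]
      congr 1
      funext y
      by_cases hy : y ∈ Icc a x
      · rw [indicator_of_mem hy]
      · rw [indicator_of_notMem hy, hψ0 y fun h' => hy ⟨h'.1, h'.2.trans hbx.le⟩]
  have hts : tsupport (fun x => ∫ y in a..x, ψ y) ⊆ Icc a b :=
    closure_minimal (fun x hx => by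
      by_contra h
      exact hx (hG0 x h)) isClosed_Icc
  refine ⟨_, ?_, HasCompactSupport.intro isCompact_Icc hG0, hts.trans habΩ, hd⟩
  rw [contDiff_infty_iff_deriv, hd]
  exact ⟨fun x => (hder x).differentiableAt, hψ⟩

/-- The du Bois-Reymond lemma. -/
lemma ae_const_of_integral_deriv_eq_zero {Ω : Set ℝ} (hΩ : Ω.OrdConnected) (hne : Ω.Nonempty)
    (ho : IsOpen Ω) {f : ℝ → ℂ} (hf : LocallyIntegrable f)
    (h : ∀ g : ℝ → ℝ, ContDiff ℝ ∞ g → HasCompactSupport g → tsupport g ⊆ Ω →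
      ∫ x, deriv g x • f x = 0) : ∃ c : ℂ, ∀ᵐ x, x ∈ Ω → f x = c := by
  obtain ⟨x₀, hx₀⟩ := id hne
  obtain ⟨χ, hχs, hχc, hχd, hχr, hχ1⟩ := exists_contDiff_tsupport_subset (n := ⊤) (ho.mem_nhds hx₀)
  have hχi : Integrable χ := hχd.continuous.integrable_of_hasCompactSupport hχc
  have hpos : 0 < ∫ x, χ x := by
    refine hχd.continuous.integral_pos_of_hasCompactSupport_nonneg_nonzero hχc
      (fun x => (hχr ⟨x, rfl⟩).1) (x := x₀) ?_
    rw [hχ1]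
    exact one_ne_zero
  set m := ∫ x, χ x
  refine ⟨m⁻¹ • ∫ x, χ x • f x, ?_⟩
  have key := ho.ae_eq_zero_of_integral_contDiff_smul_eq_zero (μ := (volume : Measure ℝ))
    (f := fun x => f x - m⁻¹ • ∫ x, χ x • f x) ?_ ?_
  · filter_upwards [key] with x hx hxΩ
    exact sub_eq_zero.1 (hx hxΩ)
  · exact (hf.sub (continuous_const.locallyIntegrable)).locallyIntegrableOn Ω
  · intro g hg hgc hgs
    have hgi : Integrable g := hg.continuous.integrable_of_hasCompactSupport hgc
    -- Subtracting a multiple of the fixed bump `χ` makes the integral zero, so `ψ` is the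
    -- derivative of an admissible test function. The constant sought is the `χ`-weighted mean of
    -- `f`.
    set ψ : ℝ → ℝ := fun x => g x - ((∫ x, g x) * m⁻¹) * χ x with hψ
    have hψs : tsupport ψ ⊆ Ω := by
      refine (closure_mono (Function.support_sub _ _)).trans ?_
      rw [closure_union]
      refine union_subset hgs ((closure_mono ?_).trans hχs)
      exact Function.support_mul_subset_right _ _
    have hψ0 : ∫ x, ψ x = 0 := by
      rw [hψ, integral_sub hgi (hχi.const_mul _), integral_const_mul, mul_assoc,
        inv_mul_cancel₀ hpos.ne', mul_one, sub_self]
    obtain ⟨G, hG, hGc, hGs, hGd⟩ := exists_test_primitive hΩ hne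
      (hg.sub (contDiff_const.mul hχd)) (hgc.sub hχc.mul_left) hψs hψ0
    have h1 := h G hG hGc hGs
    rw [hGd] at h1
    have hgf : Integrable fun x => g x • f x :=
      hf.integrable_smul_left_of_hasCompactSupport hg.continuous hgc
    have hχf : Integrable fun x => χ x • f x :=
      hf.integrable_smul_left_of_hasCompactSupport hχd.continuous hχc
    simp only [sub_smul, mul_smul] at h1
    rw [integral_sub hgf, integral_smul, integral_smul] at h1
    · simp only [smul_sub]
      rw [integral_sub hgf (hgi.smul_const _), integral_smul_const]
      exact h1
    · exact (hχf.smul m⁻¹).smul (∫ x, g x)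

/-- A function with a weak derivative on an open interval is a primitive of it. -/
lemma IsWeakDerivOn.exists_primitive {Ω I : Set ℝ} {u v : L2} (h : IsWeakDerivOn Ω u v)
    (hI : I ⊆ Ω) (hc : I.OrdConnected) (hne : I.Nonempty) (ho : IsOpen I) :
    ∃ c : ℂ, ∀ᵐ x, x ∈ I → u x = c + ∫ y in (0 : ℝ)..x, v y := by
  have hv := locallyIntegrable_L2 v
  have hu := locallyIntegrable_L2 u
  have hp := (continuous_primitive hv).locallyIntegrable (μ := (volume : Measure ℝ))
  obtain ⟨c, hcx⟩ := ae_const_of_integral_deriv_eq_zero hc hne ho (hu.sub hp)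
    fun g hg hgc hgs => by
      have hd : Continuous (deriv g) := hg.continuous_deriv (by simp)
      simp only [Pi.sub_apply, smul_sub]
      rw [integral_sub (hu.integrable_smul_left_of_hasCompactSupport hd hgc.deriv)
        (hp.integrable_smul_left_of_hasCompactSupport hd hgc.deriv),
        integral_deriv_smul_primitive hv hg hgc, h g hg hgc (hgs.trans hI), sub_self]
  refine ⟨c, ?_⟩
  filter_upwards [hcx] with x hx hxI
  rw [← hx hxI, Pi.sub_apply, sub_add_cancel]

end DeltaSchrodinger
end

noncomputable section

namespace DeltaSchrodinger

/-! ### From the Fourier side to the domain of the Hamiltonian -/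

lemma hasDerivAt_primitive {V : ℝ → ℂ} (hV : Continuous V) (c : ℂ) (x : ℝ) :
    HasDerivAt (fun x => c + ∫ y in (0 : ℝ)..x, V y) (V x) x :=
  (intervalIntegral.integral_hasDerivAt_right (hV.intervalIntegrable _ _)
    (hV.stronglyMeasurableAtFilter _ _) hV.continuousAt).const_add c

/-- A twice weakly differentiable function is continuously differentiable. -/
lemma exists_hasDerivAt {g v w : L2} (h1 : IsWeakDerivOn univ g v) (h2 : IsWeakDerivOn univ v w) :
    ∃ f V : ℝ → ℂ, g =ᵐ[volume] f ∧ v =ᵐ[volume] V ∧ Continuous V ∧ ∀ x, HasDerivAt f (V x) x := by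
  obtain ⟨a, ha⟩ := h2.exists_primitive subset_rfl ordConnected_univ univ_nonempty isOpen_univ
  obtain ⟨c, hc⟩ := h1.exists_primitive subset_rfl ordConnected_univ univ_nonempty isOpen_univ
  set V : ℝ → ℂ := fun x => a + ∫ y in (0 : ℝ)..x, w y
  have hV : Continuous V := continuous_const.add (continuous_primitive (locallyIntegrable_L2 w))
  have hvV : v =ᵐ[volume] V := by
    filter_upwards [ha] with x hx using hx (mem_univ x)
  refine ⟨fun x => c + ∫ y in (0 : ℝ)..x, V y, V, ?_, hvV, hV, hasDerivAt_primitive hV c⟩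
  filter_upwards [hc] with x hx
  rw [hx (mem_univ x)]
  congr 1
  exact intervalIntegral.integral_congr_ae (by filter_upwards [hvV] with y hy _ using hy)

lemma eq_neg_comp_neg_of_reflect_eq_neg {u : L2} (h : reflect u = -u) {f : ℝ → ℂ}
    (hf : Continuous f) (hu : u =ᵐ[volume] f) (x : ℝ) : f (-x) = -f x := by
  have : (fun x => f (-x)) =ᵐ[volume] fun x => -f x := by
    filter_upwards [hu, ae_neg hu, reflect_coeFn u, Lp.coeFn_neg u] with x h1 h2 h3 h4
    rw [h, h4, Pi.neg_apply] at h3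
    rw [← h1, ← h2, h3]
  exact congrFun ((Continuous.ae_eq_iff_eq volume (by fun_prop) (by fun_prop)).1 this) x

/-- Odd functions in `H²(ℝ)` belong to the domain of the Hamiltonian. -/
lemma mem_domain_of_odd (q : ℝ) {g v w : L2} (h1 : IsWeakDerivOn univ g v)
    (h2 : ∀ Ω, IsWeakDerivOn Ω v w) (ho : reflect g = -g) :
    HasSecondDeriv g w ∧ JumpCondition q g := by
  refine ⟨⟨v, h1, h2 _⟩, ?_⟩
  obtain ⟨f, V, hgf, -, hV, hfV⟩ := exists_hasDerivAt h1 (h2 univ)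
  have hd : deriv f = V := funext fun x => (hfV x).deriv
  have hfc : Continuous f := continuous_iff_continuousAt.2 fun x => (hfV x).continuousAt
  -- With value zero at the origin, the jump condition reduces to continuity of the derivative.
  have h0 : f 0 = 0 := by
    have := eq_neg_comp_neg_of_reflect_eq_neg ho hfc hgf 0
    rw [neg_zero] at this
    exact self_eq_neg.1 this
  refine ⟨f, hgf, hfc, fun x _ => (hfV x).differentiableAt, V 0, V 0, ?_, ?_, by simp [h0]⟩
  all_goals
    rw [hd]
    exact hV.continuousAt.tendsto.mono_left nhdsWithin_le_nhds

/-! ### Even and odd extensions from the half-line -/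

lemma evenExt_coeFn (g : L2) : evenExt reflect posProj g =ᵐ[volume] fun x => g |x| := by
  change ((posProj g + reflect (posProj g) : L2) : ℝ → ℂ) =ᵐ[volume] _
  filter_upwards [Lp.coeFn_add (posProj g) (reflect (posProj g)), posProj_coeFn g,
    reflect_coeFn (posProj g), ae_neg (posProj_coeFn g), ae_ne_zero] with x h1 h2 h3 h4 h5
  rw [h1, Pi.add_apply, h2, h3, h4]
  rcases lt_or_gt_of_ne h5 with h | h
  · rw [indicator_of_notMem (by simpa using h), indicator_of_mem (by simpa using h.le),
      abs_of_neg h, zero_add]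
  · rw [indicator_of_mem (by simpa using h.le), indicator_of_notMem (by simpa using h),
      abs_of_pos h, add_zero]

/-- The odd function with a given restriction to the half-line. -/
def oddExt : L2 →L[ℂ] L2 := (1 - reflect) * posProj

lemma oddExt_coeFn (g : L2) :
    oddExt g =ᵐ[volume] fun x => if 0 < x then g x else -g (-x) := by
  change ((posProj g - reflect (posProj g) : L2) : ℝ → ℂ) =ᵐ[volume] _
  filter_upwards [Lp.coeFn_sub (posProj g) (reflect (posProj g)), posProj_coeFn g,
    reflect_coeFn (posProj g), ae_neg (posProj_coeFn g), ae_ne_zero] with x h1 h2 h3 h4 h5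
  rw [h1, Pi.sub_apply, h2, h3, h4]
  rcases lt_or_gt_of_ne h5 with h | h
  · rw [indicator_of_notMem (by simpa using h), indicator_of_mem (by simpa using h.le),
      if_neg (not_lt.2 h.le), zero_sub]
  · rw [indicator_of_mem (by simpa using h.le), indicator_of_notMem (by simpa using h),
      if_pos h, sub_zero]

lemma integral_eq_integral_Ioi_add_neg {h : ℝ → ℂ} (hi : Integrable h) :
    ∫ x, h x = ∫ x in Ioi (0 : ℝ), (h x + h (-x)) := by
  rw [integral_add hi.integrableOn hi.comp_neg.integrableOn, integral_comp_neg_Ioi, neg_zero,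
    add_comm, intervalIntegral.integral_Iic_add_Ioi hi.integrableOn hi.integrableOn]

lemma hasCompactSupport_comp_neg {φ : ℝ → ℝ} (hc : HasCompactSupport φ) :
    HasCompactSupport fun x => φ (-x) :=
  hc.comp_homeomorph (Homeomorph.neg ℝ)

/-- The integrand is the derivative of `(φ(x) - φ(-x)) f(x)`, which vanishes at `0` whatever `f 0`
is, and at infinity. This is why even reflection creates no singular term in the first derivative.
-/
lemma integral_Ioi_odd_test {φ : ℝ → ℝ} (hφ : ContDiff ℝ ∞ φ) (hc : HasCompactSupport φ)
    {f V : ℝ → ℂ} (hV : Continuous V) (hfV : ∀ x, HasDerivAt f (V x) x) :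
    ∫ x in Ioi (0 : ℝ), ((φ x - φ (-x)) • V x + (deriv φ x + deriv φ (-x)) • f x) = 0 := by
  have hd : Continuous (deriv φ) := hφ.continuous_deriv (by simp)
  have hφd : ∀ x, HasDerivAt φ (deriv φ x) x := fun x =>
    (hφ.differentiable (by simp) x).hasDerivAt
  have hfc : Continuous f := continuous_iff_continuousAt.2 fun x => (hfV x).continuousAt
  have hφc := hφ.continuous
  have hodd : ∀ x, HasDerivAt (fun x => φ x - φ (-x)) (deriv φ x + deriv φ (-x)) x := fun x => by
    have := (hφd x).sub ((hφd (-x)).comp x (hasDerivAt_neg x))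
    rwa [mul_neg_one, sub_neg_eq_add] at this
  have hFd : ∀ x, HasDerivAt (fun x => (φ x - φ (-x)) • f x)
      ((φ x - φ (-x)) • V x + (deriv φ x + deriv φ (-x)) • f x) x := fun x =>
    (hodd x).smul (hfV x)
  have hFc : HasCompactSupport fun x => φ x - φ (-x) := HasCompactSupport.sub hc (hasCompactSupport_comp_neg hc)
  have hFc' : HasCompactSupport fun x => deriv φ x + deriv φ (-x) :=
    HasCompactSupport.add hc.deriv (hasCompactSupport_comp_neg hc.deriv)
  have h1 : Integrable fun x => (φ x - φ (-x)) • V x :=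
    hV.locallyIntegrable.integrable_smul_left_of_hasCompactSupport (by fun_prop) hFc
  have h2 : Integrable fun x => (deriv φ x + deriv φ (-x)) • f x :=
    hfc.locallyIntegrable.integrable_smul_left_of_hasCompactSupport (by fun_prop) hFc'
  have hlim : Tendsto (fun x => (φ x - φ (-x)) • f x) atTop (𝓝 0) := by
    have hcs : HasCompactSupport fun x => (φ x - φ (-x)) • f x := hFc.smul_right
    exact hcs.is_zero_at_infty.mono_left atTop_le_cocompact
  rw [integral_Ioi_of_hasDerivAt_of_tendsto (hFd 0).continuousAt.continuousWithinAt
    (fun x _ => hFd x) (h1.add h2).integrableOn hlim]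
  simp

/-- Folding the integrals onto `(0, ∞)` pairs the even extension with `φ'(x) + φ'(-x)` and the odd
one with `φ(x) - φ(-x)`, which is the situation of `integral_Ioi_odd_test`. -/
lemma isWeakDerivOn_evenExt {g v w : L2} (h1 : IsWeakDerivOn univ g v)
    (h2 : IsWeakDerivOn univ v w) :
    IsWeakDerivOn univ (evenExt reflect posProj g) (oddExt v) := by
  obtain ⟨f, V, hgf, hvV, hV, hfV⟩ := exists_hasDerivAt h1 h2
  intro φ hφ hc _
  have hd : Continuous (deriv φ) := hφ.continuous_deriv (by simp)
  have hφd : ∀ x, HasDerivAt φ (deriv φ x) x := fun x =>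
    (hφ.differentiable (by simp) x).hasDerivAt
  have hi1 := integrable_test_smul hd hc.deriv (evenExt reflect posProj g)
  have hi2 := integrable_test_smul hφ.continuous hc (oddExt v)
  rw [← add_eq_zero_iff_eq_neg, ← integral_add hi1 hi2]
  refine (integral_eq_integral_Ioi_add_neg (hi1.add hi2)).trans ?_
  rw [← integral_Ioi_odd_test hφ hc hV hfV]
  refine setIntegral_congr_ae measurableSet_Ioi ?_
  filter_upwards [evenExt_coeFn g, ae_neg (evenExt_coeFn g), oddExt_coeFn v,
    ae_neg (oddExt_coeFn v), hgf, hvV] with x h3 h4 h5 h6 h7 h8 hx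
  have hx' : 0 < x := hx
  simp only [Pi.add_apply]
  rw [h3, h4, h5, h6, if_pos hx', if_neg (by simpa using hx'.le), abs_neg, neg_neg,
    abs_of_pos hx', h7, h8]
  simp only [Complex.real_smul]
  push_cast
  ring

/-- The odd extension may jump at `0`, so only test functions vanishing near `0` are allowed. For
these, `φ(x) + φ(-x)` cut off to `x > 0` is still smooth and can be tested against `v` on the whole
line. -/
lemma isWeakDerivOn_oddExt {v w : L2} (h : IsWeakDerivOn univ v w) :
    IsWeakDerivOn {0}ᶜ (oddExt v) (evenExt reflect posProj w) := by
  intro φ hφ hc hs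
  have hd : Continuous (deriv φ) := hφ.continuous_deriv (by simp)
  have hφd : ∀ x, HasDerivAt φ (deriv φ x) x := fun x =>
    (hφ.differentiable (by simp) x).hasDerivAt
  have h0 : ∀ᶠ x in 𝓝 (0 : ℝ), φ x = 0 := by
    have : (0 : ℝ) ∉ tsupport φ := fun h => hs h rfl
    exact notMem_tsupport_iff_eventuallyEq.1 this
  have h0n : ∀ᶠ x in 𝓝 (0 : ℝ), φ (-x) = 0 := by
    have : Tendsto (fun x : ℝ => -x) (𝓝 0) (𝓝 0) := by simpa using (continuous_neg.tendsto (0 : ℝ))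
    exact this.eventually h0
  set θ : ℝ → ℝ := (Ioi (0 : ℝ)).indicator fun x => φ x + φ (-x) with hθ
  have hpos : ∀ x : ℝ, 0 < x → θ =ᶠ[𝓝 x] fun x => φ x + φ (-x) := fun x hx => by
    filter_upwards [Ioi_mem_nhds hx] with y hy using indicator_of_mem hy _
  have hneg : ∀ x : ℝ, x ≤ 0 → θ =ᶠ[𝓝 x] fun _ => 0 := fun x hx => by
    rcases hx.eq_or_lt with rfl | hx
    · filter_upwards [h0, h0n] with y h1 h2
      by_cases hy : y ∈ Ioi (0 : ℝ)
      · rw [hθ, indicator_of_mem hy, h1, h2, add_zero]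
      · rw [hθ, indicator_of_notMem hy]
    · filter_upwards [Iio_mem_nhds hx] with y hy
      exact indicator_of_notMem (by simpa using (mem_Iio.1 hy).le) _
  have hθs : ContDiff ℝ ∞ θ := by
    rw [contDiff_iff_contDiffAt]
    intro x
    rcases lt_or_ge 0 x with hx | hx
    · refine ContDiffAt.congr_of_eventuallyEq ?_ (hpos x hx)
      exact (hφ.add (hφ.comp contDiff_neg)).contDiffAt
    · exact contDiffAt_const.congr_of_eventuallyEq (hneg x hx)
  have hθd : ∀ x, deriv θ x = (Ioi (0 : ℝ)).indicator (fun x => deriv φ x - deriv φ (-x)) x :=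
    fun x => by
    rcases lt_or_ge 0 x with hx | hx
    · rw [indicator_of_mem (mem_Ioi.2 hx), (hpos x hx).deriv_eq]
      have := (hφd x).add ((hφd (-x)).comp x (hasDerivAt_neg x))
      rw [mul_neg_one] at this
      exact this.deriv
    · rw [indicator_of_notMem (by simpa using hx), (hneg x hx).deriv_eq, deriv_const]
  have hθc : HasCompactSupport θ := by
    refine HasCompactSupport.mono
      (HasCompactSupport.add hc (hasCompactSupport_comp_neg hc)) ?_
    intro x hx
    rw [hθ, Function.mem_support, indicator_apply_ne_zero] at hx
    exact hx.2
  have key := h θ hθs hθc (subset_univ _)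
  have hi1 := integrable_test_smul hd hc.deriv (oddExt v)
  have hi2 := integrable_test_smul hφ.continuous hc (evenExt reflect posProj w)
  have e1 : ∫ x, deriv φ x • oddExt v x = ∫ x, deriv θ x • v x := by
    rw [integral_eq_integral_Ioi_add_neg hi1, ← integral_indicator measurableSet_Ioi]
    refine integral_congr_ae ?_
    filter_upwards [oddExt_coeFn v, ae_neg (oddExt_coeFn v)] with x h1 h2
    rw [hθd]
    by_cases hx : x ∈ Ioi (0 : ℝ)
    · have hx' : 0 < x := hx
      rw [indicator_of_mem hx, indicator_of_mem hx, h1, h2, if_pos hx',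
        if_neg (by simpa using hx'.le), neg_neg, smul_neg, ← sub_eq_add_neg, sub_smul]
    · rw [indicator_of_notMem hx, indicator_of_notMem hx, zero_smul]
  have e2 : ∫ x, φ x • evenExt reflect posProj w x = ∫ x, θ x • w x := by
    rw [integral_eq_integral_Ioi_add_neg hi2, ← integral_indicator measurableSet_Ioi]
    refine integral_congr_ae ?_
    filter_upwards [evenExt_coeFn w, ae_neg (evenExt_coeFn w)] with x h1 h2
    by_cases hx : x ∈ Ioi (0 : ℝ)
    · have hx' : 0 < x := hx
      rw [indicator_of_mem hx, hθ, indicator_of_mem hx, h1, h2, abs_neg, abs_of_pos hx', add_smul]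
    · rw [indicator_of_notMem hx, hθ, indicator_of_notMem hx, zero_smul]
  rw [e1, e2, key]

/-- On the fixed space of the involution, the boundary condition holds. -/
lemma reflect_sub_of_invol_eq {q : ℝ} (hq : 0 ≤ q) {g v : L2} (hv : FourierDeriv g v)
    (hK : invol q g = g) : reflect (v - (q : ℂ) • g) = -(v - (q : ℂ) • g) := by
  have hs := memLp_top_scatSymbol hq
  have h1 : reflect g = scat q g := by
    nth_rewrite 1 [← hK]
    exact reflect_reflect (scat q g)
  have h2 : four (v - (q : ℂ) • g) =ᵐ[volume]
      fun ξ => (2 * Real.pi * ξ * Complex.I - q : ℂ) * four g ξ := by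
    rw [map_sub, map_smul]
    filter_upwards [Lp.coeFn_sub (four v) ((q : ℂ) • four g), Lp.coeFn_smul (q : ℂ) (four g), hv]
      with ξ h3 h4 h5
    rw [h3, Pi.sub_apply, h4, h5, Pi.smul_apply, smul_eq_mul, sub_mul]
  -- The fixed-vector equation `J R g = g` is `J g = R g`, read on the Fourier side.
  have h3 : (fun ξ => four g (-ξ)) =ᵐ[volume] fun ξ => scatSymbol q ξ * four g ξ := by
    filter_upwards [reflect_coeFn (four g), four_fourMul_coeFn hs g] with ξ h4 h5
    rw [← h5, ← h4, reflect_four, h1]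
    rfl
  apply four.injective
  rw [← reflect_four, map_neg]
  apply Lp.ext
  filter_upwards [reflect_coeFn (four (v - (q : ℂ) • g)), h2, ae_neg h2, h3,
    Lp.coeFn_neg (four (v - (q : ℂ) • g))] with ξ h4 h5 h6 h7 h8
  rw [h4, h6, h8, Pi.neg_apply, h5, h7, ← scatSymbol_mul hq ξ]
  push_cast
  ring

/-- Even reflections of restrictions of vectors fixed by the involution belong to the domain. -/
lemma mem_domain_of_invol_eq {q : ℝ} (hq : 0 ≤ q) {g v w : L2} (hgv : FourierDeriv g v)
    (hvw : FourierDeriv v w) (hK : invol q g = g) :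
    HasSecondDeriv (evenExt reflect posProj g) (evenExt reflect posProj w) ∧
      JumpCondition q (evenExt reflect posProj g) := by
  have h1 := hgv.isWeakDerivOn univ
  have h2 := hvw.isWeakDerivOn univ
  refine ⟨⟨oddExt v, isWeakDerivOn_evenExt h1 h2, isWeakDerivOn_oddExt h2⟩, ?_⟩
  obtain ⟨f, V, hgf, hvV, hV, hfV⟩ := exists_hasDerivAt h1 h2
  have hfc : Continuous f := continuous_iff_continuousAt.2 fun x => (hfV x).continuousAt
  -- The continuous function `V - q f` is odd, hence zero at the origin: the Robin condition. Even
  -- reflection turns it into the jump `V 0 - (-V 0) = 2 q f 0`.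
  have h0 : V 0 = q * f 0 := by
    have hu : ((v - (q : ℂ) • g : L2) : ℝ → ℂ) =ᵐ[volume] fun x => V x - q * f x := by
      filter_upwards [Lp.coeFn_sub v ((q : ℂ) • g), Lp.coeFn_smul (q : ℂ) g, hgf, hvV]
        with x h3 h4 h5 h6
      rw [h3, Pi.sub_apply, h4, Pi.smul_apply, h5, h6, smul_eq_mul]
    have := eq_neg_comp_neg_of_reflect_eq_neg (reflect_sub_of_invol_eq hq hgv hK)
      (by fun_prop) hu 0
    rw [neg_zero] at this
    exact sub_eq_zero.1 (self_eq_neg.1 this)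
  have hdp : ∀ x : ℝ, 0 < x → HasDerivAt (fun x => f |x|) (V x) x := fun x hx => by
    refine (hfV x).congr_of_eventuallyEq ?_
    filter_upwards [Ioi_mem_nhds hx] with y hy
    rw [abs_of_pos hy]
  have hdn : ∀ x : ℝ, x < 0 → HasDerivAt (fun x => f |x|) (-V (-x)) x := fun x hx => by
    have : HasDerivAt (fun x => f (-x)) (-V (-x)) x := by
      simpa [Function.comp_def] using! (hfV (-x)).scomp x (hasDerivAt_neg x)
    refine this.congr_of_eventuallyEq ?_
    filter_upwards [Iio_mem_nhds hx] with y hy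
    rw [abs_of_neg hy]
  refine ⟨fun x => f |x|, ?_, by fun_prop, fun x hx => ?_, V 0, -V 0, ?_, ?_, ?_⟩
  · have hpos : ∀ᵐ x : ℝ, g |x| = f |x| := by
      filter_upwards [hgf, ae_neg hgf] with x h3 h4
      rcases abs_choice x with h | h <;> rw [h]
      exacts [h3, h4]
    filter_upwards [evenExt_coeFn g, hpos] with x h3 h4
    rw [h3, h4]
  · rcases lt_or_gt_of_ne hx with h | h
    exacts [(hdn x h).differentiableAt, (hdp x h).differentiableAt]
  · refine (hV.continuousAt.tendsto.mono_left nhdsWithin_le_nhds).congr' ?_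
    filter_upwards [self_mem_nhdsWithin] with x hx using (hdp x hx).deriv.symm
  · have : Tendsto (fun x => -V (-x)) (𝓝[<] 0) (𝓝 (-V 0)) := by
      have hc : Continuous fun x => -V (-x) := by fun_prop
      simpa using (hc.tendsto 0).mono_left nhdsWithin_le_nhds
    refine this.congr' ?_
    filter_upwards [self_mem_nhdsWithin] with x hx using (hdn x hx).deriv.symm
  · simp only [abs_zero, h0]
    ring

end DeltaSchrodinger
end

noncomputable section

namespace DeltaSchrodinger

/-! ### Injectivity of the shifted Hamiltonian -/

lemma exists_const_of_hasDerivAt_zero {f : ℝ → ℂ} (h : ∀ x, 0 < x → HasDerivAt f 0 x) :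
    ∃ c, ∀ x, 0 < x → f x = c := by
  refine isOpen_Ioi.exists_is_const_of_fderiv_eq_zero (𝕜 := ℝ) (s := Ioi (0 : ℝ))
    isPreconnected_Ioi (fun x hx => (h x hx).differentiableAt.differentiableWithinAt)
    fun x hx => ?_
  have := (h x hx).hasFDerivAt.fderiv
  rw [this]
  simp

/-- On a half-line, an `L²` solution of `f'' = f` with `f' ∈ L²` satisfies `f' = -f`. -/
lemma deriv_eq_neg_of_decay {u v : L2} {f V : ℝ → ℂ} (hu : ∀ᵐ x, 0 < x → u x = f x)
    (hv : ∀ᵐ x, 0 < x → v x = V x) (hf : ∀ x, 0 < x → HasDerivAt f (V x) x)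
    (hV : ∀ x, 0 < x → HasDerivAt V (f x) x) (x : ℝ) (hx : 0 < x) : V x = -f x := by
  have hexp : ∀ x : ℝ, HasDerivAt (fun x : ℝ => Complex.exp (-(x : ℂ))) (-Complex.exp (-(x : ℂ))) x :=
    fun x => by
    have := (hasDerivAt_id x).ofReal_comp.neg.cexp
    simpa using this
  -- The function `e^{-x}(f' + f)` has zero derivative, so `f' + f = c e^x`, which is square
  -- integrable on `(0, ∞)` only for `c = 0`.
  obtain ⟨c, hc⟩ := exists_const_of_hasDerivAt_zero
    (f := fun x => Complex.exp (-(x : ℂ)) * (V x + f x)) fun x hx => by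
      convert! (hexp x).mul ((hV x hx).add (hf x hx)) using 1
      rw [Pi.add_apply]
      ring
  have hVf : ∀ x, 0 < x → V x + f x = c * Complex.exp x := fun x hx => by
    rw [← hc x hx, mul_right_comm, ← Complex.exp_add, neg_add_cancel, Complex.exp_zero, one_mul]
  suffices h0 : c = 0 by
    have := hVf x hx
    rw [h0, zero_mul] at this
    exact eq_neg_of_add_eq_zero_left this
  by_contra hc0
  have hint : IntegrableOn (fun _ : ℝ => ‖c‖ ^ 2) (Ioi 0) := by
    refine Integrable.mono' (integrable_norm_sq (v + u)).integrableOn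
      aestronglyMeasurable_const ?_
    rw [ae_restrict_iff' measurableSet_Ioi]
    filter_upwards [hu, hv, Lp.coeFn_add v u] with y h1 h2 h3 hy
    have hy' : 0 < y := hy
    rw [h3, Pi.add_apply, h1 hy', h2 hy', hVf y hy', Real.norm_of_nonneg (by positivity),
      norm_mul]
    refine pow_le_pow_left₀ (norm_nonneg _) ?_ 2
    refine le_mul_of_one_le_right (norm_nonneg _) ?_
    rw [Complex.norm_exp, Complex.ofReal_re]
    exact Real.one_le_exp hy'.le
  rw [integrableOn_const_iff] at hint
  simp [hc0] at hint

/-- A continuous solution of `f' = -f` on `(0, ∞)` with `f(0) = 0` vanishes. -/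
lemma eq_zero_of_hasDerivAt_neg {f : ℝ → ℂ} (hf : Continuous f)
    (hd : ∀ x, 0 < x → HasDerivAt f (-f x) x) (h0 : f 0 = 0) (x : ℝ) (hx : 0 < x) : f x = 0 := by
  have hexp : ∀ x : ℝ, HasDerivAt (fun x : ℝ => Complex.exp (x : ℂ)) (Complex.exp (x : ℂ)) x :=
    fun x => by
    have := (hasDerivAt_id x).ofReal_comp.cexp
    simpa using this
  obtain ⟨c, hc⟩ := exists_const_of_hasDerivAt_zero
    (f := fun x => Complex.exp (x : ℂ) * f x) fun x hx => by
      convert! (hexp x).mul (hd x hx) using 1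
      ring
  have hcont : Continuous fun x : ℝ => Complex.exp (x : ℂ) * f x := by fun_prop
  have h1 : Tendsto (fun x : ℝ => Complex.exp (x : ℂ) * f x) (𝓝[>] 0) (𝓝 0) := by
    have := (hcont.tendsto 0).mono_left (nhdsWithin_le_nhds (s := Ioi 0))
    simpa [h0] using this
  have h2 : Tendsto (fun x : ℝ => Complex.exp (x : ℂ) * f x) (𝓝[>] 0) (𝓝 c) := by
    refine tendsto_const_nhds.congr' ?_
    filter_upwards [self_mem_nhdsWithin] with y hy using (hc y hy).symm
  have h3 := hc x hx
  rw [tendsto_nhds_unique h2 h1] at h3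
  exact (mul_eq_zero.1 h3).resolve_left (Complex.exp_ne_zero _)

/-- `H_q + 1/2` is injective. -/
lemma eq_zero_of_hasSecondDeriv_self {q : ℝ} (hq : 0 ≤ q) {u : L2} (h : HasSecondDeriv u u)
    (hj : JumpCondition q u) : u = 0 := by
  obtain ⟨v, h1, h2⟩ := h
  obtain ⟨f, huf, hf, -, a, b, ha, hb, hab⟩ := hj
  obtain ⟨c, hc⟩ := h1.exists_primitive subset_rfl ordConnected_univ univ_nonempty isOpen_univ
  obtain ⟨a', ha'⟩ := h2.exists_primitive (I := Ioi 0) (fun x hx => (ne_of_gt hx : x ≠ 0))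
    ordConnected_Ioi nonempty_Ioi isOpen_Ioi
  obtain ⟨b', hb'⟩ := h2.exists_primitive (I := Iio 0) (fun x hx => (ne_of_lt hx : x ≠ 0))
    ordConnected_Iio nonempty_Iio isOpen_Iio
  have hfc : ∀ x, f x = c + ∫ y in (0 : ℝ)..x, v y := by
    have hcont : Continuous fun x => c + ∫ y in (0 : ℝ)..x, v y :=
      continuous_const.add (continuous_primitive (locallyIntegrable_L2 v))
    refine congrFun ((Continuous.ae_eq_iff_eq volume hf hcont).1 ?_)
    filter_upwards [huf, hc] with x h3 h4
    rw [← h3, h4 (mem_univ x)]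
  have hI : ∀ x, ∫ y in (0 : ℝ)..x, u y = ∫ y in (0 : ℝ)..x, f y := fun x =>
    intervalIntegral.integral_congr_ae (by filter_upwards [huf] with y hy _ using hy)
  set V : ℂ → ℝ → ℂ := fun a x => a + ∫ y in (0 : ℝ)..x, f y with hVdef
  have hVc : ∀ a, Continuous (V a) := fun a =>
    continuous_const.add (continuous_primitive hf.locallyIntegrable)
  have hVd : ∀ a x, HasDerivAt (V a) (f x) x := fun a => hasDerivAt_primitive hf a
  have hvp : ∀ᵐ x, 0 < x → v x = V a' x := by
    filter_upwards [ha'] with x h3 hx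
    rw [h3 hx, hI]
  have hvn : ∀ᵐ x, x < 0 → v x = V b' x := by
    filter_upwards [hb'] with x h3 hx
    rw [h3 hx, hI]
  have hfp : ∀ x, 0 < x → HasDerivAt f (V a' x) x := fun x hx => by
    have := hasDerivAt_primitive (hVc a') c x
    refine this.congr_of_eventuallyEq ?_
    filter_upwards [Ioi_mem_nhds hx] with y hy
    have hy' : 0 < y := hy
    rw [hfc y]
    congr 1
    refine intervalIntegral.integral_congr_ae ?_
    filter_upwards [hvp] with z h3 hz
    rw [uIoc_of_le hy'.le] at hz
    exact h3 hz.1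
  have hfn : ∀ x, x < 0 → HasDerivAt f (V b' x) x := fun x hx => by
    have := hasDerivAt_primitive (hVc b') c x
    refine this.congr_of_eventuallyEq ?_
    filter_upwards [Iio_mem_nhds hx] with y hy
    have hy' : y < 0 := hy
    rw [hfc y]
    congr 1
    refine intervalIntegral.integral_congr_ae ?_
    -- The integration interval is `(y, 0]`, and its endpoint `0` is not covered by `hvn`.
    filter_upwards [hvn, ae_ne_zero] with z h3 h4 hz
    rw [uIoc_of_ge hy'.le] at hz
    exact h3 (lt_of_le_of_ne hz.2 h4)
  have hneg : ∀ {F F' : ℝ → ℂ}, (∀ x, x < 0 → HasDerivAt F (F' x) x) →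
      ∀ x, 0 < x → HasDerivAt (fun x => F (-x)) (-F' (-x)) x := fun {F F'} hF x hx => by
    have := (hF (-x) (neg_lt_zero.2 hx)).scomp x (hasDerivAt_neg x)
    simpa [Function.comp_def] using! this
  have hp := deriv_eq_neg_of_decay (huf.mono fun x h3 _ => h3) hvp hfp (fun x _ => hVd a' x)
  -- The negative half-line is the positive one for the reflected functions; reflection changes the
  -- sign of the derivative.
  have hn := deriv_eq_neg_of_decay (u := reflect u) (v := -reflect v) (f := fun x => f (-x))
    (V := fun x => -V b' (-x)) ?_ ?_ (hneg hfn) ?_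
  · have hfp' : ∀ x, 0 < x → HasDerivAt f (-f x) x := fun x hx => hp x hx ▸ hfp x hx
    have hfn' : ∀ x, 0 < x → HasDerivAt (fun x => f (-x)) (-f (-x)) x := fun x hx =>
      hn x hx ▸ hneg hfn x hx
    have ha0 : a = -f 0 := by
      refine tendsto_nhds_unique ha ?_
      have : Tendsto (fun x => -f x) (𝓝[>] 0) (𝓝 (-f 0)) :=
        (hf.neg.tendsto 0).mono_left nhdsWithin_le_nhds
      refine this.congr' ?_
      filter_upwards [self_mem_nhdsWithin] with x hx using (hfp' x hx).deriv.symm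
    have hb0 : b = f 0 := by
      refine tendsto_nhds_unique hb ?_
      refine ((hf.tendsto 0).mono_left nhdsWithin_le_nhds).congr' ?_
      filter_upwards [self_mem_nhdsWithin] with x hx
      have hx' : x < 0 := hx
      rw [(hfn x hx').deriv]
      have := hn (-x) (neg_pos.2 hx')
      simp only [neg_neg] at this
      exact (neg_injective this).symm
    -- The one-sided slopes are `-f 0` and `f 0`, so the jump condition says `(2q + 2) f 0 = 0`, and
    -- `q ≥ 0` excludes a bound state.
    have hf0 : f 0 = 0 := by
      have h3 : (2 * (q : ℂ) + 2) * f 0 = 0 := by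
        rw [ha0, hb0] at hab
        linear_combination -hab
      refine (mul_eq_zero.1 h3).resolve_left ?_
      have : ((2 * q + 2 : ℝ) : ℂ) ≠ 0 := by
        rw [Complex.ofReal_ne_zero]
        positivity
      exact_mod_cast this
    have h4 := eq_zero_of_hasDerivAt_neg hf hfp' hf0
    have h5 := eq_zero_of_hasDerivAt_neg (f := fun x => f (-x)) (by fun_prop) hfn' (by simp [hf0])
    apply Lp.ext
    filter_upwards [huf, ae_ne_zero, Lp.coeFn_zero ℂ 2 (volume : Measure ℝ)] with x h6 h7 h8
    rw [h6, h8]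
    rcases lt_or_gt_of_ne h7 with hx | hx
    · have := h5 (-x) (neg_pos.2 hx)
      simpa using this
    · exact h4 x hx
  · filter_upwards [reflect_coeFn u, ae_neg huf] with x h3 h4 _
    rw [h3, h4]
  · filter_upwards [Lp.coeFn_neg (reflect v), reflect_coeFn v, ae_neg hvn] with x h3 h4 h5 hx
    rw [h3, Pi.neg_apply, h4, h5 (neg_lt_zero.2 hx)]
  · intro x hx
    have := (hneg (F := V b') (fun x _ => hVd b' x) x hx).neg
    simpa using! this

end DeltaSchrodinger
end

noncomputable section

namespace DeltaSchrodinger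

/-! ### The unitary group of the Hamiltonian -/

/-- The unitary group generated by `-iH_q`, obtained from the free group by compression to the
half-line. -/
def deltaGroup (q t : ℝ) : L2 →L[ℂ] L2 := compress reflect (invol q) posProj (freeGroup t)

lemma reflect_commute_freeGroup (t : ℝ) : Commute reflect (freeGroup t) :=
  reflect_commute_fourMul (memLp_top_freeSymbol t) (freeSymbol_neg t)

lemma invol_commute_freeGroup {q : ℝ} (hq : 0 ≤ q) (t : ℝ) : Commute (invol q) (freeGroup t) :=
  invol_commute_fourMul hq (memLp_top_freeSymbol t) (freeSymbol_neg t)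

lemma resolventSymbol_neg (ξ : ℝ) : resolventSymbol (-ξ) = resolventSymbol ξ := by
  rw [resolventSymbol, resolventSymbol, neg_sq]

lemma deltaGroup_zero {q : ℝ} (hq : 0 ≤ q) : deltaGroup q 0 = 1 := by
  rw [deltaGroup, freeGroup_zero, (halfLineRelations hq).compress_one]

lemma deltaGroup_add {q : ℝ} (hq : 0 ≤ q) (s t : ℝ) :
    deltaGroup q (s + t) = deltaGroup q s * deltaGroup q t := by
  rw [deltaGroup, freeGroup_add, (halfLineRelations hq).compress_mul (reflect_commute_freeGroup t)
    (invol_commute_freeGroup hq t)]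
  rfl

lemma star_deltaGroup {q : ℝ} (hq : 0 ≤ q) (t : ℝ) : star (deltaGroup q t) = deltaGroup q (-t) := by
  rw [deltaGroup, (halfLineRelations hq).star_compress (reflect_commute_freeGroup t)
    (invol_commute_freeGroup hq t), star_freeGroup]
  rfl

lemma deltaGroup_mem_unitary {q : ℝ} (hq : 0 ≤ q) (t : ℝ) :
    deltaGroup q t ∈ unitary (L2 →L[ℂ] L2) := by
  rw [Unitary.mem_iff, star_deltaGroup hq, ← deltaGroup_add hq, ← deltaGroup_add hq,
    neg_add_cancel, add_neg_cancel, deltaGroup_zero hq]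
  exact ⟨rfl, rfl⟩

lemma deltaGroup_apply (q t : ℝ) (φ : L2) :
    deltaGroup q t φ = evenExt reflect posProj (freeGroup t (ext reflect (invol q) posProj φ)) +
      freeGroup t (oddPart reflect φ) := rfl

lemma continuous_deltaGroup (q : ℝ) (φ : L2) : Continuous fun t => deltaGroup q t φ := by
  simp only [deltaGroup_apply]
  have h : ∀ f, Continuous fun t => freeGroup t f := fun f =>
    continuous_iff_continuousAt.2 fun t => freeGroup_tendsto t f
  exact ((ContinuousLinearMap.continuous _).comp (h _)).add (h _)

lemma HasGeneratorAt.map {E : Type*} [NormedAddCommGroup E] [InnerProductSpace ℂ E]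
    {U V : ℝ → E →L[ℂ] E} {φ η : E} (h : HasGeneratorAt U φ η) (B : E →L[ℂ] E)
    (hB : ∀ t, B * U t = V t * B) : HasGeneratorAt V (B φ) (B η) := by
  refine ((B.continuous.tendsto η).comp h).congr fun t => ?_
  have h1 : B (U t φ) = V t (B φ) := DFunLike.congr_fun (hB t) φ
  rw [Function.comp_apply, map_smul, map_sub, h1]

/-- The free equation `η = (i/2) g''` gives the factor: `g'' = -2i η`. -/
lemma HasGeneratorAt.exists_fourierDeriv {g η : L2} (h : HasGeneratorAt freeGroup g η) :
    ∃ v, FourierDeriv g v ∧ FourierDeriv v ((-(2 * Complex.I)) • η) := by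
  refine DeltaSchrodinger.exists_fourierDeriv ?_
  rw [map_smul]
  filter_upwards [Lp.coeFn_smul (-(2 * Complex.I)) (four η), h.four_eq] with ξ h1 h2
  rw [h1, Pi.smul_apply, h2, smul_eq_mul]
  linear_combination (4 * Real.pi ^ 2 * ξ ^ 2 * four g ξ) * Complex.I_sq

lemma evenPart_apply_add_oddPart_apply (φ : L2) :
    evenPart reflect φ + oddPart reflect φ = φ :=
  DFunLike.congr_fun (evenPart_add_oddPart reflect) φ

lemma evenExt_ext_apply {q : ℝ} (hq : 0 ≤ q) (φ : L2) :
    evenExt reflect posProj (ext reflect (invol q) posProj φ) = evenPart reflect φ :=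
  DFunLike.congr_fun (halfLineRelations hq).evenExt_ext φ

/-- A vector at which the group is differentiable belongs to the domain of the Hamiltonian. -/
lemma HasGeneratorAt.mem_domain {q : ℝ} (hq : 0 ≤ q) {φ η : L2}
    (h : HasGeneratorAt (deltaGroup q) φ η) :
    HasSecondDeriv φ ((-(2 * Complex.I)) • η) ∧ JumpCondition q φ := by
  have hR := halfLineRelations hq
  -- Both intertwiners carry the difference quotients of the compressed group to those of the free
  -- group, so the odd part and the extension each have two derivatives in `L²`.
  obtain ⟨v, hv, hvw⟩ := (h.map (V := freeGroup) (oddPart reflect) fun t =>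
    hR.odd_compress (reflect_commute_freeGroup t)).exists_fourierDeriv
  obtain ⟨v', hv', hvw'⟩ := (h.map (V := freeGroup) (ext reflect (invol q) posProj) fun t =>
    hR.ext_compress (reflect_commute_freeGroup t) (invol_commute_freeGroup hq t)).exists_fourierDeriv
  obtain ⟨h1, h2⟩ := mem_domain_of_odd q (hv.isWeakDerivOn univ) hvw.isWeakDerivOn
    (DFunLike.congr_fun hR.J_odd φ)
  obtain ⟨h3, h4⟩ := mem_domain_of_invol_eq hq hv' hvw' (DFunLike.congr_fun hR.K_ext φ)
  have h5 := h3.add h1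
  have h6 := h4.add h2
  rw [map_smul, evenExt_ext_apply hq, evenExt_ext_apply hq, evenPart_apply_add_oddPart_apply,
    ← smul_add, evenPart_apply_add_oddPart_apply] at h5
  rw [evenExt_ext_apply hq, evenPart_apply_add_oddPart_apply] at h6
  exact ⟨h5, h6⟩

/-- The extension and the odd part of `u` are free resolvents of those of `f`, hence differentiable
under the free group; the two derivatives reassemble. The conclusion reads `(H_q + 1/2) u = f` at
the level of the generator. -/
lemma hasGeneratorAt_deltaGroup_resolvent {q : ℝ} (hq : 0 ≤ q) (f : L2) :
    HasGeneratorAt (deltaGroup q) (compress reflect (invol q) posProj (fourMul resolventSymbol) f)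
      ((-Complex.I) • (f - (1 / 2 : ℂ) •
        compress reflect (invol q) posProj (fourMul resolventSymbol) f)) := by
  have hR := halfLineRelations hq
  set u := compress reflect (invol q) posProj (fourMul resolventSymbol) f with hu
  have hu' : u = evenExt reflect posProj (fourMul resolventSymbol
      (ext reflect (invol q) posProj f)) + fourMul resolventSymbol (oddPart reflect f) := rfl
  have h1 : ext reflect (invol q) posProj u =
      fourMul resolventSymbol (ext reflect (invol q) posProj f) :=
    DFunLike.congr_fun (hR.ext_compress
      (reflect_commute_fourMul memLp_top_resolventSymbol resolventSymbol_neg)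
      (invol_commute_fourMul hq memLp_top_resolventSymbol resolventSymbol_neg)) f
  have h2 : oddPart reflect u = fourMul resolventSymbol (oddPart reflect f) :=
    DFunLike.congr_fun (hR.odd_compress
      (reflect_commute_fourMul memLp_top_resolventSymbol resolventSymbol_neg)) f
  have h3 := (((evenExt reflect posProj).continuous.tendsto _).comp
    (hasGeneratorAt_freeGroup_resolvent (ext reflect (invol q) posProj f))).add
    (hasGeneratorAt_freeGroup_resolvent (oddPart reflect f))
  have h4 : evenExt reflect posProj ((-Complex.I) • (ext reflect (invol q) posProj f -
      (1 / 2 : ℂ) • fourMul resolventSymbol (ext reflect (invol q) posProj f))) +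
      (-Complex.I) • (oddPart reflect f - (1 / 2 : ℂ) • fourMul resolventSymbol (oddPart reflect f))
      = (-Complex.I) • (f - (1 / 2 : ℂ) • u) := by
    rw [map_smul, map_sub, map_smul, evenExt_ext_apply hq, ← smul_add, sub_add_sub_comm,
      ← smul_add, ← hu', evenPart_apply_add_oddPart_apply]
  rw [h4] at h3
  refine h3.congr fun t => ?_
  rw [Function.comp_apply, map_smul, ← smul_add, map_sub, sub_add_sub_comm, ← hu',
    deltaGroup_apply, h1, h2]

lemma deltaHamiltonian_eq {q : ℝ} {u w : L2} (hu : u ∈ (deltaHamiltonian q).domain)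
    (h : HasSecondDeriv u w) : deltaHamiltonian q ⟨u, hu⟩ = (-(1 / 2) : ℂ) • w :=
  congrArg ((-(1 / 2) : ℂ) • ·) ((hasSecondDeriv_secondDeriv (⟨u, hu⟩ : deltaDomain q)).unique h)

/-- The group `deltaGroup` is generated by `-iH_q`. -/
lemma isUnitaryGroupOf_deltaGroup {q : ℝ} (hq : 0 ≤ q) :
    IsUnitaryGroupOf (deltaHamiltonian q) (deltaGroup q) where
  mem_unitary := deltaGroup_mem_unitary hq
  map_zero := deltaGroup_zero hq
  map_add := deltaGroup_add hq
  continuous := continuous_deltaGroup q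
  generator := fun ψ η => by
    rw [hasDerivAt_iff_hasGeneratorAt (deltaGroup_zero hq)]
    constructor
    · intro h
      obtain ⟨h1, h2⟩ := h.mem_domain hq
      have hd : ψ ∈ (deltaHamiltonian q).domain := ⟨⟨_, h1⟩, h2⟩
      refine ⟨hd, ?_⟩
      rw [deltaHamiltonian_eq _ h1, smul_smul, smul_smul]
      have : -Complex.I * -(1 / 2) * -(2 * Complex.I) = 1 := by
        linear_combination -Complex.I_sq
      rw [this, one_smul]
    · rintro ⟨hd, rfl⟩
      have hd' : (∃ w, HasSecondDeriv ψ w) ∧ JumpCondition q ψ := hd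
      obtain ⟨⟨w, hw⟩, hj⟩ := hd'
      rw [deltaHamiltonian_eq _ hw]
      -- This is `(H_q + 1/2) ψ`. Its compressed resolvent `u` solves the same equation and lies in
      -- the domain of the generator, so injectivity forces `ψ = u`.
      set f : L2 := (-(1 / 2) : ℂ) • w + (1 / 2 : ℂ) • ψ with hf
      have h1 := hasGeneratorAt_deltaGroup_resolvent hq f
      set u := compress reflect (invol q) posProj (fourMul resolventSymbol) f
      obtain ⟨h2, h3⟩ := h1.mem_domain hq
      have h4 : ψ + (-1 : ℂ) • u = 0 := by
        refine eq_zero_of_hasSecondDeriv_self hq ?_ (hj.add (h3.smul (-1)))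
        have h5 := hw.add (h2.smul (-1))
        convert h5 using 1
        rw [smul_smul, smul_smul, hf]
        have : -1 * -(2 * Complex.I) * -Complex.I = 2 := by
          linear_combination -2 * Complex.I_sq
        rw [this]
        module
      have h5 : ψ = u := by
        rw [neg_one_smul, ← sub_eq_add_neg] at h4
        exact sub_eq_zero.1 h4
      rw [← h5, hf, add_sub_cancel_right] at h1
      exact h1

end DeltaSchrodinger
end

noncomputable section

namespace DeltaSchrodinger

/-! ### A unitary group is determined by its generator -/

namespace IsUnitaryGroupOf

variable {E : Type*} [NormedAddCommGroup E] [InnerProductSpace ℂ E] [CompleteSpace E]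
  {A : E →ₗ.[ℂ] E} {U V : ℝ → E →L[ℂ] E}

lemma map_add_apply (hU : IsUnitaryGroupOf A U) (s t : ℝ) (ψ : E) :
    U (s + t) ψ = U s (U t ψ) :=
  DFunLike.congr_fun (hU.map_add s t) ψ

lemma hasDerivAt_apply (hU : IsUnitaryGroupOf A U) {ψ η : E}
    (h : HasDerivAt (fun t => U t ψ) η 0) (τ : ℝ) :
    HasDerivAt (fun t => U t (U τ ψ)) (U τ η) 0 := by
  rw [hasDerivAt_iff_hasGeneratorAt hU.map_zero] at h ⊢
  exact h.map (U τ) fun t => by rw [← hU.map_add, ← hU.map_add, add_comm]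

lemma hasDerivAt (hU : IsUnitaryGroupOf A U) {ψ η : E}
    (h : HasDerivAt (fun t => U t ψ) η 0) (τ : ℝ) : HasDerivAt (fun t => U t ψ) (U τ η) τ := by
  have h1 := hU.hasDerivAt_apply h τ
  rw [← sub_self τ] at h1
  have h2 := h1.comp_sub_const τ τ
  refine h2.congr_of_eventuallyEq (Eventually.of_forall fun t => ?_)
  change U t ψ = U (t - τ) (U τ ψ)
  rw [← hU.map_add_apply, sub_add_cancel]

lemma inner_map_map (hU : IsUnitaryGroupOf A U) (t : ℝ) (ψ χ : E) :
    inner ℂ (U t ψ) (U t χ) = inner ℂ ψ χ := by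
  have h := (Unitary.mem_iff.1 (hU.mem_unitary t)).1
  rw [← ContinuousLinearMap.adjoint_inner_right, ← ContinuousLinearMap.star_eq_adjoint]
  exact congrArg (inner ℂ ψ) (DFunLike.congr_fun h χ)

/-- Differentiating the constant `⟨U t ψ, U t ψ⟩` shows that the generator is skew-symmetric. -/
lemma inner_add_inner_eq_zero (hU : IsUnitaryGroupOf A U) {ψ η : E}
    (h : HasDerivAt (fun t => U t ψ) η 0) : inner ℂ ψ η + inner ℂ η ψ = 0 := by
  have h1 := h.inner ℂ h
  simp only [hU.inner_map_map, hU.map_zero] at h1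
  exact h1.unique (hasDerivAt_const _ _)

lemma hasDerivAt_congr (hU : IsUnitaryGroupOf A U) (hV : IsUnitaryGroupOf A V) {ψ η : E}
    (h : HasDerivAt (fun t => U t ψ) η 0) : HasDerivAt (fun t => V t ψ) η 0 :=
  (hV.generator ψ η).2 ((hU.generator ψ η).1 h)

/-- The difference `U τ ψ - V τ ψ` stays in the common generator domain and its derivative in `τ` is
the generator applied to it. Skew-symmetry makes its squared norm constant, and it vanishes at `0`.
-/
lemma apply_eq_of_hasDerivAt (hU : IsUnitaryGroupOf A U) (hV : IsUnitaryGroupOf A V) {ψ η : E}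
    (h : HasDerivAt (fun t => U t ψ) η 0) (t : ℝ) : U t ψ = V t ψ := by
  have hd : ∀ τ, HasDerivAt (fun t => U t ψ - V t ψ) (U τ η - V τ η) τ := fun τ =>
    (hU.hasDerivAt h τ).sub (hV.hasDerivAt (hU.hasDerivAt_congr hV h) τ)
  have hg : ∀ τ, HasDerivAt (fun t => U t (U τ ψ - V τ ψ)) (U τ η - V τ η) 0 := fun τ => by
    simp only [_root_.map_sub]
    exact (hU.hasDerivAt_apply h τ).sub
      (hV.hasDerivAt_congr hU (hV.hasDerivAt_apply (hU.hasDerivAt_congr hV h) τ))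
  have hi : ∀ τ, HasDerivAt (fun t => inner ℂ (U t ψ - V t ψ) (U t ψ - V t ψ)) 0 τ := fun τ => by
    have h1 := (hd τ).inner ℂ (hd τ)
    rwa [hU.inner_add_inner_eq_zero (hg τ)] at h1
  have h2 := is_const_of_deriv_eq_zero (fun τ => (hi τ).differentiableAt)
    (fun τ => (hi τ).deriv) t 0
  rw [hU.map_zero, hV.map_zero, sub_self, inner_zero_left, inner_self_eq_zero] at h2
  exact sub_eq_zero.1 h2

/-- Applying `U t` shifts the interval of integration by `t`, so time averages of orbits lie in the
domain of the generator. -/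
lemma hasDerivAt_integral (hU : IsUnitaryGroupOf A U) (ψ : E) (ε : ℝ) :
    HasDerivAt (fun t => U t (∫ s in (0 : ℝ)..ε, U s ψ)) (U ε ψ - ψ) 0 := by
  have hc := hU.continuous ψ
  have hF : ∀ t, HasDerivAt (fun t => ∫ s in (0 : ℝ)..t, U s ψ) (U t ψ) t := fun t =>
    intervalIntegral.integral_hasDerivAt_right (hc.intervalIntegrable _ _)
      (hc.stronglyMeasurableAtFilter _ _) hc.continuousAt
  have h1 : HasDerivAt (fun t => (∫ s in (0 : ℝ)..(t + ε), U s ψ) - ∫ s in (0 : ℝ)..t, U s ψ)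
      (U ε ψ - U 0 ψ) 0 := by
    have h2 := hF ε
    rw [← zero_add ε] at h2
    have h3 := h2.comp_add_const 0 ε
    rw [zero_add] at h3
    exact h3.sub (hF 0)
  rw [hU.map_zero] at h1
  refine h1.congr_of_eventuallyEq (Eventually.of_forall fun t => ?_)
  change U t (∫ s in (0 : ℝ)..ε, U s ψ) =
    (∫ s in (0 : ℝ)..(t + ε), U s ψ) - ∫ s in (0 : ℝ)..t, U s ψ
  rw [intervalIntegral.integral_interval_sub_left (hc.intervalIntegrable _ _)
    (hc.intervalIntegrable _ _), ← ContinuousLinearMap.intervalIntegral_comp_comm _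
    (hc.intervalIntegrable _ _)]
  simp only [← hU.map_add_apply]
  rw [intervalIntegral.integral_comp_add_left (fun s => U s ψ), add_zero]

/-- Two unitary groups with the same generator coincide. -/
lemma eq (hU : IsUnitaryGroupOf A U) (hV : IsUnitaryGroupOf A V) : U = V := by
  funext t
  ext ψ
  have hc := hU.continuous ψ
  have hF : HasDerivAt (fun t => ∫ s in (0 : ℝ)..t, U s ψ) (U 0 ψ) 0 :=
    intervalIntegral.integral_hasDerivAt_right (hc.intervalIntegrable _ _)
      (hc.stronglyMeasurableAtFilter _ _) hc.continuousAt
  rw [hU.map_zero] at hF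
  -- The averages determine `B ψ` as a derivative at `ε = 0`, which replaces an explicit density
  -- argument.
  have h1 : ∀ B : E →L[ℂ] E, HasDerivAt (fun ε => B (∫ s in (0 : ℝ)..ε, U s ψ)) (B ψ) 0 :=
    fun B => ((B.restrictScalars ℝ).hasFDerivAt).comp_hasDerivAt (0 : ℝ) hF
  refine (h1 (U t)).unique ?_
  simp only [hU.apply_eq_of_hasDerivAt hV (hU.hasDerivAt_integral ψ _) t]
  exact h1 (V t)

end IsUnitaryGroupOf

end DeltaSchrodinger
end

noncomputable section

namespace DeltaSchrodinger

/-! ### The functions `L₊[φ]` and `L₋[φ]` -/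

lemma evenPart_coeFn (φ : L2) :
    evenPart reflect φ =ᵐ[volume] fun x => (1 / 2 : ℂ) * (φ x + φ (-x)) := by
  change (((1 / 2 : ℂ) • (φ + reflect φ) : L2) : ℝ → ℂ) =ᵐ[volume] _
  filter_upwards [Lp.coeFn_smul (1 / 2 : ℂ) (φ + reflect φ), Lp.coeFn_add φ (reflect φ),
    reflect_coeFn φ] with x h1 h2 h3
  rw [h1, Pi.smul_apply, h2, Pi.add_apply, h3, smul_eq_mul]

lemma oddPart_coeFn (φ : L2) :
    oddPart reflect φ =ᵐ[volume] fun x => (1 / 2 : ℂ) * (φ x - φ (-x)) := by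
  change (((1 / 2 : ℂ) • (φ - reflect φ) : L2) : ℝ → ℂ) =ᵐ[volume] _
  filter_upwards [Lp.coeFn_smul (1 / 2 : ℂ) (φ - reflect φ), Lp.coeFn_sub φ (reflect φ),
    reflect_coeFn φ] with x h1 h2 h3
  rw [h1, Pi.smul_apply, h2, Pi.sub_apply, h3, smul_eq_mul]

/-- The correction term in the extension of an even function. -/
def extTail (q : ℝ) (φ : L2) (x : ℝ) : ℂ :=
  ∫ y, expKernel q (-x - y) * posProj (evenPart reflect φ) y

lemma extTail_of_nonneg (q : ℝ) (φ : L2) {x : ℝ} (hx : 0 ≤ x) : extTail q φ x = 0 := by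
  refine integral_eq_zero_of_ae ?_
  filter_upwards [posProj_coeFn (evenPart reflect φ)] with y hy
  rw [hy]
  by_cases h : 0 ≤ y
  · rw [expKernel, indicator_of_notMem (by simp only [mem_Ioi, not_lt]; linarith), zero_mul]
    rfl
  · rw [indicator_of_notMem (s := Ici 0) (by simpa using h), mul_zero]
    rfl

lemma intervalIntegrable_exp_mul (q : ℝ) (φ : L2) (a b : ℝ) :
    IntervalIntegrable (fun y => (Real.exp (q * |y|) : ℂ) * φ y) volume a b :=
  (intervalIntegrable_of_locallyIntegrable (locallyIntegrable_L2 φ) a b).continuousOn_mul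
    (Continuous.continuousOn (by fun_prop))

/-- The kernel cuts the integral off at `y < -x`, and the even part folds `φ` onto `(0, -x)`;
unfolding gives the symmetric interval, its factor `1/2` cancelling the `2`. -/
lemma extTail_of_neg (q : ℝ) (φ : L2) {x : ℝ} (hx : x < 0) :
    2 * extTail q φ x = (q : ℂ) * (Real.exp (q * x) : ℂ) *
      ∫ y in x..(-x), (Real.exp (q * |y|) : ℂ) * φ y := by
  have h1 : extTail q φ x = ∫ y in Ioc 0 (-x), (q : ℂ) * (Real.exp (q * x) : ℂ) *
      ((1 / 2 : ℂ) * ((Real.exp (q * |y|) : ℂ) * φ y + (Real.exp (q * |-y|) : ℂ) * φ (-y))) := by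
    rw [extTail, ← integral_indicator measurableSet_Ioc]
    refine integral_congr_ae ?_
    -- The cutoffs differ from `Ioc 0 (-x)` at the two endpoints, which are discarded as null.
    filter_upwards [posProj_coeFn (evenPart reflect φ), evenPart_coeFn φ, ae_ne_zero,
      (Measure.ae_ne volume (-x) : ∀ᵐ y : ℝ, y ≠ -x)] with y h2 h3 h4 h5
    rw [h2]
    by_cases hy : y ∈ Ioc 0 (-x)
    · have hy' : y < -x := lt_of_le_of_ne hy.2 h5
      rw [indicator_of_mem (s := Ici 0) hy.1.le, indicator_of_mem hy, h3, expKernel,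
        indicator_of_mem (by simpa using hy'), abs_neg, abs_of_pos hy.1]
      have : Complex.exp (-(q : ℂ) * ((-x - y : ℝ) : ℂ)) =
          (Real.exp (q * x) : ℂ) * (Real.exp (q * y) : ℂ) := by
        rw [← Complex.ofReal_mul, ← Real.exp_add, Complex.ofReal_exp]
        congr 1
        push_cast
        ring
      rw [this]
      ring
    · rw [indicator_of_notMem hy]
      rcases lt_or_gt_of_ne h4 with h | h
      · rw [indicator_of_notMem (s := Ici 0) (by simpa using h), mul_zero]
      · have : -x < y := by
          by_contra h6
          exact hy ⟨h, not_lt.1 h6⟩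
        rw [expKernel, indicator_of_notMem (by simp only [mem_Ioi, not_lt]; linarith), zero_mul]
  set g : ℝ → ℂ := fun y => (Real.exp (q * |y|) : ℂ) * φ y with hg
  have hgi := intervalIntegrable_exp_mul q φ
  have h2 : IntervalIntegrable (fun y => g (-y)) volume 0 (-x) := by
    have := (IntervalIntegrable.iff_comp_neg (f := g) (a := 0) (b := x)).1 (hgi 0 x)
    rwa [neg_zero] at this
  have h3 : ∫ y in x..(-x), g y = ∫ y in (0 : ℝ)..(-x), (g y + g (-y)) := by
    rw [intervalIntegral.integral_add (hgi 0 (-x)) h2, intervalIntegral.integral_comp_neg, neg_neg,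
      neg_zero, add_comm, intervalIntegral.integral_add_adjacent_intervals (hgi x 0) (hgi 0 (-x))]
  rw [h1, h3, integral_const_mul, integral_const_mul,
    intervalIntegral.integral_of_le (neg_nonneg.2 hx.le)]
  ring

/-- For `x < 0` the reflection inside `invol` supplies the even part and its convolution the tail;
for `x > 0` the projection supplies the even part directly. -/
lemma ext_coeFn {q : ℝ} (hq : 0 ≤ q) (φ : L2) :
    ext reflect (invol q) posProj φ =ᵐ[volume]
      fun x => evenPart reflect φ x - 2 * extTail q φ x := by
  set p := posProj (evenPart reflect φ) with hp
  change ((p + invol q p : L2) : ℝ → ℂ) =ᵐ[volume] _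
  filter_upwards [Lp.coeFn_add p (invol q p), invol_coeFn hq p, posProj_coeFn (evenPart reflect φ),
    ae_neg (posProj_coeFn (evenPart reflect φ)), evenPart_coeFn φ, ae_neg (evenPart_coeFn φ),
    ae_ne_zero] with x h1 h2 h3 h4 h5 h6 h7
  rw [h1, Pi.add_apply, h2, h3, h4]
  change _ + (_ - 2 * extTail q φ x) = _
  rw [← add_sub_assoc]
  congr 1
  rcases lt_or_gt_of_ne h7 with h | h
  · rw [indicator_of_notMem (by simpa using h), indicator_of_mem (by simpa using h.le), h5, h6,
      neg_neg]
    ring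
  · rw [indicator_of_mem (by simpa using h.le), indicator_of_notMem (by simpa using h), add_zero]

/-- `L₊[φ]` as an element of `L²`. -/
def lplus (q : ℝ) (φ : L2) : L2 := (ext reflect (invol q) posProj + oddPart reflect) φ

/-- `L₋[φ]` as an element of `L²`. -/
def lminus (q : ℝ) (φ : L2) : L2 := (reflect * ext reflect (invol q) posProj + oddPart reflect) φ

lemma LPlus_ae_eq {q : ℝ} (hq : 0 ≤ q) (φ : L2) : LPlus q φ =ᵐ[volume] lplus q φ := by
  change _ =ᵐ[volume] ((ext reflect (invol q) posProj φ + oddPart reflect φ : L2) : ℝ → ℂ)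
  filter_upwards [Lp.coeFn_add (ext reflect (invol q) posProj φ) (oddPart reflect φ),
    ext_coeFn hq φ, evenPart_coeFn φ, oddPart_coeFn φ] with x h1 h2 h3 h4
  rw [h1, Pi.add_apply, h2, h3, h4, LPlus]
  rcases lt_or_ge x 0 with h | h
  · rw [extTail_of_neg q φ h, indicator_of_mem (by simpa using h), Pi.one_apply]
    ring
  · rw [extTail_of_nonneg q φ h, indicator_of_notMem (by simpa using h)]
    ring

lemma LMinus_ae_eq {q : ℝ} (hq : 0 ≤ q) (φ : L2) : LMinus q φ =ᵐ[volume] lminus q φ := by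
  change _ =ᵐ[volume]
    ((reflect (ext reflect (invol q) posProj φ) + oddPart reflect φ : L2) : ℝ → ℂ)
  filter_upwards [Lp.coeFn_add (reflect (ext reflect (invol q) posProj φ)) (oddPart reflect φ),
    reflect_coeFn (ext reflect (invol q) posProj φ), ae_neg (ext_coeFn hq φ),
    ae_neg (evenPart_coeFn φ), oddPart_coeFn φ, ae_ne_zero] with x h1 h0 h2 h3 h4 h5
  rw [h1, Pi.add_apply, h0, h2, h3, h4, neg_neg, LMinus]
  rcases lt_or_gt_of_ne h5 with h | h
  · rw [extTail_of_nonneg q φ (neg_nonneg.2 h.le), indicator_of_notMem (by simpa using h)]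
    ring
  · rw [extTail_of_neg q φ (neg_lt_zero.2 h), indicator_of_mem (by simpa using h.le), Pi.one_apply,
      neg_neg, mul_neg]
    ring

lemma integrable_evenPart {φ : L2} (h : Integrable (φ : ℝ → ℂ)) :
    Integrable (evenPart reflect φ : ℝ → ℂ) :=
  ((h.add h.comp_neg).const_mul (1 / 2 : ℂ)).congr (evenPart_coeFn φ).symm

lemma integrable_oddPart {φ : L2} (h : Integrable (φ : ℝ → ℂ)) :
    Integrable (oddPart reflect φ : ℝ → ℂ) :=
  ((h.sub h.comp_neg).const_mul (1 / 2 : ℂ)).congr (oddPart_coeFn φ).symm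

lemma integrable_ext {q : ℝ} (hq : 0 ≤ q) {φ : L2} (h : Integrable (φ : ℝ → ℂ)) :
    Integrable (ext reflect (invol q) posProj φ : ℝ → ℂ) := by
  have h1 : Integrable (posProj (evenPart reflect φ) : ℝ → ℂ) :=
    ((integrable_evenPart h).indicator measurableSet_Ici).congr (posProj_coeFn _).symm
  have h2 := (h1.integrable_convolution (ContinuousLinearMap.mul ℂ ℂ)
    (integrable_expKernel hq)).comp_neg
  have h3 : Integrable (extTail q φ) := by
    refine h2.congr (Eventually.of_forall fun x => ?_)
    exact integral_congr_ae (Eventually.of_forall fun y => mul_comm _ _)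
  exact ((integrable_evenPart h).sub (h3.const_mul 2)).congr (ext_coeFn hq φ).symm

lemma integrable_lplus {q : ℝ} (hq : 0 ≤ q) {φ : L2} (h : Integrable (φ : ℝ → ℂ)) :
    Integrable (lplus q φ : ℝ → ℂ) :=
  ((integrable_ext hq h).add (integrable_oddPart h)).congr (Lp.coeFn_add _ _).symm

lemma integrable_lminus {q : ℝ} (hq : 0 ≤ q) {φ : L2} (h : Integrable (φ : ℝ → ℂ)) :
    Integrable (lminus q φ : ℝ → ℂ) :=
  (((integrable_ext hq h).comp_neg.congr (reflect_coeFn _).symm).add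
    (integrable_oddPart h)).congr (Lp.coeFn_add _ _).symm

/-- The two half-line identities `P_compress` and `one_sub_P_compress`, read pointwise. -/
lemma deltaGroup_coeFn {q : ℝ} (hq : 0 ≤ q) (t : ℝ) (φ : L2) :
    ∀ᵐ x : ℝ, (deltaGroup q t φ : ℝ → ℂ) x =
      if 0 ≤ x then freeGroup t (lplus q φ) x else freeGroup t (lminus q φ) x := by
  have hR := halfLineRelations hq
  have hp : posProj (deltaGroup q t φ) = posProj (freeGroup t (lplus q φ)) :=
    DFunLike.congr_fun hR.P_compress φ
  have hm : (1 - posProj) (deltaGroup q t φ) = (1 - posProj) (freeGroup t (lminus q φ)) :=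
    DFunLike.congr_fun (hR.one_sub_P_compress (reflect_commute_freeGroup t)) φ
  have h1 := posProj_coeFn (deltaGroup q t φ)
  have h2 := one_sub_posProj_coeFn (deltaGroup q t φ)
  rw [hp] at h1
  rw [hm] at h2
  filter_upwards [h1, h2, posProj_coeFn (freeGroup t (lplus q φ)),
    one_sub_posProj_coeFn (freeGroup t (lminus q φ))] with x h3 h4 h5 h6
  split_ifs with hx
  · rw [h5, indicator_of_mem (s := Ici 0) hx, indicator_of_mem (s := Ici 0) hx] at h3
    exact h3.symm
  · have hx' : x ∈ Iio (0 : ℝ) := not_le.1 hx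
    rw [h6, indicator_of_mem hx', indicator_of_mem hx'] at h4
    exact h4.symm

lemma freeGroup_eq_integral_of_ae_eq {t : ℝ} (ht : 0 < t) {f : L2} (hf : Integrable (f : ℝ → ℂ))
    {g : ℝ → ℂ} (hg : g =ᵐ[volume] f) :
    freeGroup t f =ᵐ[volume] fun x => ∫ y, freeKernel t (x - y) * g y := by
  filter_upwards [freeGroup_eq_integral ht hf] with x hx
  rw [hx]
  refine integral_congr_ae ?_
  filter_upwards [hg] with y hy
  rw [hy]

end DeltaSchrodinger
end

/-! ### The representation formula -/

theorem proposition2p1 (q : ℝ) (hq : 0 ≤ q) :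
    (∃! U : ℝ → DeltaSchrodinger.L2 →L[ℂ] DeltaSchrodinger.L2,
      DeltaSchrodinger.IsUnitaryGroupOf (DeltaSchrodinger.deltaHamiltonian q) U) ∧
    ∀ U : ℝ → DeltaSchrodinger.L2 →L[ℂ] DeltaSchrodinger.L2,
      DeltaSchrodinger.IsUnitaryGroupOf (DeltaSchrodinger.deltaHamiltonian q) U →
      ∀ (φ : DeltaSchrodinger.L2) (t : ℝ), 0 < t →
        (MemLp (DeltaSchrodinger.LPlus q φ) 2 volume ∧
          MemLp (DeltaSchrodinger.LMinus q φ) 2 volume ∧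
          ∃ Gp Gm : DeltaSchrodinger.L2,
            DeltaSchrodinger.IsFreeKernelIntegral t (DeltaSchrodinger.LPlus q φ) Gp ∧
            DeltaSchrodinger.IsFreeKernelIntegral t (DeltaSchrodinger.LMinus q φ) Gm ∧
            ∀ᵐ x : ℝ, (U t φ : ℝ → ℂ) x = if 0 ≤ x then Gp x else Gm x) ∧
        (Integrable (φ : ℝ → ℂ) volume →
          Integrable (DeltaSchrodinger.LPlus q φ) volume ∧
          Integrable (DeltaSchrodinger.LMinus q φ) volume ∧
          ∀ᵐ x : ℝ, (U t φ : ℝ → ℂ) x =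
            if 0 ≤ x then ∫ y, DeltaSchrodinger.freeKernel t (x - y) * DeltaSchrodinger.LPlus q φ y
            else ∫ y, DeltaSchrodinger.freeKernel t (x - y) * DeltaSchrodinger.LMinus q φ y) := by
  have hU := DeltaSchrodinger.isUnitaryGroupOf_deltaGroup hq
  refine ⟨⟨DeltaSchrodinger.deltaGroup q, hU, fun V hV => hV.eq hU⟩, fun V hV φ t ht => ?_⟩
  obtain rfl := hV.eq hU
  have hp := DeltaSchrodinger.LPlus_ae_eq hq φ
  have hm := DeltaSchrodinger.LMinus_ae_eq hq φ
  have hG := DeltaSchrodinger.deltaGroup_coeFn hq t φ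
  refine ⟨⟨(memLp_congr_ae hp).2 (Lp.memLp _), (memLp_congr_ae hm).2 (Lp.memLp _), _, _,
    DeltaSchrodinger.isFreeKernelIntegral_freeGroup ht _ hp,
    DeltaSchrodinger.isFreeKernelIntegral_freeGroup ht _ hm, hG⟩, fun hφ => ?_⟩
  have hpi := DeltaSchrodinger.integrable_lplus hq hφ
  have hmi := DeltaSchrodinger.integrable_lminus hq hφ
  refine ⟨hpi.congr hp.symm, hmi.congr hm.symm, ?_⟩
  filter_upwards [hG, DeltaSchrodinger.freeGroup_eq_integral_of_ae_eq ht hpi hp,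
    DeltaSchrodinger.freeGroup_eq_integral_of_ae_eq ht hmi hm] with x h1 h2 h3
  rw [h1, h2, h3]
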